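/- **Setting.** Let $n\ge 1$ be an integer and $r\in(0,+\infty]$. Let $W_n$ be the set of all finite words in the letters $1,\dots,n$; for $\alpha\in W_n$ let $|\alpha|$ be its length and let $b(\alpha)$ be the number of its maximal blocks of equal consecutive letters (so $b(\alpha)=0$ only for the empty word). Put $$\mathcal F(\mathbb D_r^n)=\Big\{a=\sum_{\alpha\in W_n}c_\alpha\zeta_\alpha:\ \|a\|_{\rho,\tau}=\sum_\alpha|c_\alpha|\rho^{|\alpha|}\tau^{b(\alpha)}<\infty\ \ \forall\rho\in(0,r),\ \forall\tau\ge1\Big\},$$ $$\mathcal F(\mathbb B_r^n)=\Big\{a=\sum_{\alpha\in W_n}c_\alpha\zeta_\alpha:\ \|a\|_{\rho}=\sum_{d=0}^\infty\Big(\sum_{|\alpha|=d}|c_\alpha|^2\Big)^{1/2}\rho^d<\infty\ \ \forall\rho\in(0,r)\Big\}$$ (the algebras of holomorphic functions on the free polydisk and on the free ball of radius $r$), with $c_\alpha\in\mathbb C$, multiplication by concatenation of words, and the topologies given by the displayed norms. The algebra $\mathcal F(\mathbb D_r^n)$ is the coproduct, in the category of Arens–Michael algebras, of $n$ copies of the algebra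 of holomorphic functions on the open disk of radius $r$. For $F=\mathcal F(\mathbb D_r^n)$ or $F=\mathcal F(\mathbb B_r^n)$ let $\mathcal O(\mathbb C^\times,F)$ be the algebra of holomorphic $F$-valued functions on $\mathbb C^\times=\mathbb C\setminus\{0\}$ with the compact-open topology, let $z$ be the complex coordinate on $\mathbb C^\times$, and let $I$ be the closed two-sided ideal of $\mathcal O(\mathbb C^\times,F)$ generated by the elements $\zeta_i\zeta_j-z\,\zeta_j\zeta_i$ $(i<j)$. The quotients $\mathcal O(\mathbb C^\times,F)/I$ are denoted $\mathcal O_{\mathrm{def}}(\mathbb D_r^n)$ and $\mathcal O_{\mathrm{def}}(\mathbb B_r^n)$, respectively; they are algebras over $\mathcal O(\mathbb C^\times)$. For $A=\mathcal O_{\mathrm{def}}(\mathbb D_r^n)$ or $A=\mathcal O_{\mathrm{def}}(\mathbb B_r^n)$ and $q\in\mathbb C^\times$ let $A_q=A/\overline{\mathfrak m_qA}$, where $\mathfrak m_q=\{f\in\mathcal O(\mathbb C^\times): f(q)=0\}$, and for $u\in A$ let $u_q$ be the image of $u$ in $A_q$. The bundle $\mathbf E(A)$ over $\mathbb C^\times$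 is the disjoint union $E=\bigsqcup_q A_q$ with its projection $p:E\to\mathbb C^\times$, equipped with * the topology that has as a base the sets $\{v\in E: p(v)\in V,\ \|v-u_{p(v)}\|<\varepsilon\}$, where $V\subset\mathbb C^\times$ is open, $u\in A$, $\varepsilon>0$, and $\|\cdot\|$ is the seminorm on $E$ given on each $A_q$ by the quotient seminorm of a continuous seminorm on $A$; * the locally convex uniform vector structure $\mathcal U$ determined by the family of all these seminorms on $E$. Here a family $\mathcal N$ of seminorms on $E$ (i.e. of functions $E\to[0,\infty)$ that restrict to a seminorm on each fiber) is *directed* if any two of its members are bounded by a constant multiple of a third. It determines the structure $\mathcal U_{\mathcal N}$ consisting of all subsets of $E$ that are absolutely convex in each fiber and contain $\{v\in E:\|v\|<\varepsilon\}$ for some $\|\cdot\|\in\mathcal N$ and $\varepsilon>0$. A directed family $\mathcal N$ is *admissible* if the sets $\{v\in E:p(v)\in V,\ \|v-s_{p(v)}\|<\varepsilon\}$ ($V\subset\mathbb C^\times$ open, $s$ a continuous section over $V$, $\|\cdot\|\in\mathcal N$, $\varepsilon>0$) are open and form a base of the topology of $E$, and if for each $q$ the values at $q$ of continuous sections over neighborhoods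 of $q$ are dense in $A_q$ for the topology generated by $\mathcal N$. The bundle is *continuous* if there is an admissible directed family $\mathcal N$ of seminorms that are continuous functions on $E$ such that $\mathcal U=\mathcal U_{\mathcal N}$. It is a *Fréchet algebra bundle* if: (a) $p$ is continuous and open, and the zero section, the addition $E\times_{\mathbb C^\times}E\to E$ and the multiplication by scalars $\mathbb C\times E\to E$ are continuous; (b) every set in $\mathcal U$ is absorbing and absolutely convex in each fiber, $\mathcal U$ is nonempty and closed under multiplication by nonzero scalars, under finite intersections and under passing to absolutely convex supersets, and every member of $\mathcal U$ contains an open member; (c) the sets $\{s_x+u: x\in V,\ u\in U\cap A_x\}$ ($V$ open, $s$ a continuous section over $V$, $U\in\mathcal U$ open) form a base of the topology of $E$; (d) for each $q$ the values at $q$ of continuous sections over neighborhoods of $q$ are dense in $A_q$; (e) the fiberwise multiplication $E\times_{\mathbb C^\times}E\to E$ is continuous, and for each $U\in\mathcal U$ there is $V\in\mathcal U$ with $V\cdot V\subset U$; (f) each $A_q$ is a complete metrizable locally convex algebra in the topology inherited from $E$. **Corollary 8.19.** For all $n\ge1$ and $r\in(0,+\infty]$, the bundles $\mathbf E(\mathbb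 D_r^n)=\mathbf E(\mathcal O_{\mathrm{def}}(\mathbb D_r^n))$ and $\mathbf E(\mathbb B_r^n)=\mathbf E(\mathcal O_{\mathrm{def}}(\mathbb B_r^n))$ are continuous Fréchet algebra bundles over $\mathbb C^\times$. -/

import Mathlib

open Filter Topology
open scoped ENNReal NNReal

namespace QDef

noncomputable section

/-! ## Formal series in `n` noncommuting variables

A word in the letters `0, …, n - 1` is a list in `Fin n`; concatenation is `++`, length is
`List.length`. -/

/-- The formal series `∑ c_α ζ_α` over all words `α`, stored as the coefficient function
`α ↦ c_α`. -/
def FreeSeries (n : ℕ) : Type := List (Fin n) → ℂ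

namespace FreeSeries

variable {n : ℕ}

instance : AddCommGroup (FreeSeries n) := inferInstanceAs (AddCommGroup (List (Fin n) → ℂ))

instance : Module ℂ (FreeSeries n) := inferInstanceAs (Module ℂ (List (Fin n) → ℂ))

/-- Multiplication is concatenation of words: the coefficient of `w` in `a * b` is the sum of
`a u * b v` over all factorizations `w = u ++ v`. -/
instance : Mul (FreeSeries n) :=
  ⟨fun a b w => ∑ i ∈ Finset.range (w.length + 1), a (w.take i) * b (w.drop i)⟩

instance : One (FreeSeries n) := ⟨fun w => if w = [] then 1 else 0⟩

/-- The variable `ζ_i`. -/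
def X (i : Fin n) : FreeSeries n := fun w => if w = [i] then 1 else 0

theorem ext {a b : FreeSeries n} (h : ∀ w, a w = b w) : a = b := funext h

theorem add_apply (a b : FreeSeries n) (w : List (Fin n)) : (a + b) w = a w + b w := rfl

theorem zero_apply (w : List (Fin n)) : (0 : FreeSeries n) w = 0 := rfl

theorem smul_apply (c : ℂ) (a : FreeSeries n) (w : List (Fin n)) : (c • a) w = c * a w := rfl

theorem mul_apply (a b : FreeSeries n) (w : List (Fin n)) :
    (a * b) w = ∑ i ∈ Finset.range (w.length + 1), a (w.take i) * b (w.drop i) := rfl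

theorem one_nil : (1 : FreeSeries n) [] = 1 := rfl

theorem one_cons (x : Fin n) (w : List (Fin n)) : (1 : FreeSeries n) (x :: w) = 0 := rfl

/-- The series whose coefficient at `w` is the coefficient of `a` at `x :: w`. -/
def shift (x : Fin n) (a : FreeSeries n) : FreeSeries n := fun w => a (x :: w)

theorem mul_nil (a b : FreeSeries n) : (a * b) [] = a [] * b [] := by
  simp [mul_apply]

theorem mul_cons (a b : FreeSeries n) (x : Fin n) (w : List (Fin n)) :
    (a * b) (x :: w) = a [] * b (x :: w) + (shift x a * b) w := by
  rw [mul_apply, List.length_cons, Finset.sum_range_succ', mul_apply, add_comm]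
  simp [shift]

theorem shift_mul (a b : FreeSeries n) (x : Fin n) :
    shift x (a * b) = a [] • shift x b + shift x a * b :=
  ext fun w => mul_cons a b x w

theorem zero_mul_aux (a : FreeSeries n) : 0 * a = 0 :=
  ext fun w => by simp [mul_apply, zero_apply]

theorem mul_zero_aux (a : FreeSeries n) : a * 0 = 0 :=
  ext fun w => by simp [mul_apply, zero_apply]

theorem add_mul_aux (a b c : FreeSeries n) : (a + b) * c = a * c + b * c :=
  ext fun w => by simp [mul_apply, add_apply, add_mul, Finset.sum_add_distrib]

theorem mul_add_aux (a b c : FreeSeries n) : a * (b + c) = a * b + a * c :=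
  ext fun w => by simp [mul_apply, add_apply, mul_add, Finset.sum_add_distrib]

theorem smul_mul_aux (t : ℂ) (a b : FreeSeries n) : (t • a) * b = t • (a * b) :=
  ext fun w => by simp [mul_apply, smul_apply, Finset.mul_sum, mul_assoc]

theorem mul_smul_aux (t : ℂ) (a b : FreeSeries n) : a * (t • b) = t • (a * b) :=
  ext fun w => by simp [mul_apply, smul_apply, Finset.mul_sum, mul_left_comm]

theorem mul_assoc_apply (w : List (Fin n)) :
    ∀ a b c : FreeSeries n, ((a * b) * c) w = (a * (b * c)) w := by
  induction w with
  | nil => intro a b c; simp [mul_nil, mul_assoc]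
  | cons x w ih =>
    intro a b c
    rw [mul_cons, mul_cons, mul_cons, mul_nil, shift_mul, add_mul_aux, add_apply, ih,
      smul_mul_aux, smul_apply]
    ring

theorem one_mul_aux (a : FreeSeries n) : 1 * a = a :=
  ext fun w => by
    cases w with
    | nil => rw [mul_nil, one_nil, one_mul]
    | cons x w =>
      have h : shift x (1 : FreeSeries n) = 0 := ext fun v => one_cons x v
      rw [mul_cons, one_nil, h, zero_mul_aux, zero_apply, one_mul, add_zero]

theorem mul_one_apply (w : List (Fin n)) : ∀ a : FreeSeries n, (a * 1) w = a w := by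
  induction w with
  | nil => intro a; rw [mul_nil, one_nil, mul_one]
  | cons x w ih => intro a; rw [mul_cons, one_cons, ih, mul_zero, zero_add]; rfl

instance : Ring (FreeSeries n) :=
  { (inferInstance : AddCommGroup (FreeSeries n)) with
    mul := (· * ·)
    one := 1
    zero_mul := zero_mul_aux
    mul_zero := mul_zero_aux
    left_distrib := mul_add_aux
    right_distrib := add_mul_aux
    mul_assoc := fun a b c => ext fun w => mul_assoc_apply w a b c
    one_mul := one_mul_aux
    mul_one := fun a => ext fun w => mul_one_apply w a }

instance : Algebra ℂ (FreeSeries n) := Algebra.ofModule smul_mul_aux mul_smul_aux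

end FreeSeries

/-! ## Algebras cut out by a family of submultiplicative norms with values in `[0, ∞]` -/

/-- A submultiplicative seminorm with values in `[0, ∞]` on a complex algebra. -/
structure ExtNorm (R : Type) [Ring R] [Algebra ℂ R] where
  toFun : R → ℝ≥0∞
  add_le : ∀ a b, toFun (a + b) ≤ toFun a + toFun b
  smul_eq : ∀ (c : ℂ) a, toFun (c • a) = ‖c‖ₑ * toFun a
  mul_le : ∀ a b, toFun (a * b) ≤ toFun a * toFun b
  one_ne_top : toFun 1 ≠ ∞

section FinitePart

variable {R : Type} [Ring R] [Algebra ℂ R] {ι : Type}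

theorem ExtNorm.zero_eq (p : ExtNorm R) : p.toFun 0 = 0 := by
  have := p.smul_eq 0 0
  simpa using this

/-- The subalgebra of all elements at which every member of the family is finite. -/
def finitePart (p : ι → ExtNorm R) : Subalgebra ℂ R where
  carrier := {a | ∀ i, (p i).toFun a ≠ ∞}
  mul_mem' {a b} ha hb i :=
    ne_top_of_le_ne_top (ENNReal.mul_ne_top (ha i) (hb i)) ((p i).mul_le a b)
  add_mem' {a b} ha hb i :=
    ne_top_of_le_ne_top (ENNReal.add_ne_top.2 ⟨ha i, hb i⟩) ((p i).add_le a b)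
  algebraMap_mem' c i := by
    rw [Algebra.algebraMap_eq_smul_one, (p i).smul_eq]
    exact ENNReal.mul_ne_top enorm_ne_top (p i).one_ne_top

/-- The restriction of the `i`-th norm of the family to `finitePart p`. -/
def finiteSeminorm (p : ι → ExtNorm R) (i : ι) : Seminorm ℂ (finitePart p) :=
  Seminorm.of (fun a => ((p i).toFun (a : R)).toReal)
    (fun a b => by
      rw [← ENNReal.toReal_add (a.2 i) (b.2 i)]
      exact ENNReal.toReal_mono (ENNReal.add_ne_top.2 ⟨a.2 i, b.2 i⟩) ((p i).add_le _ _))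
    (fun c a => by
      change ((p i).toFun (c • (a : R))).toReal = _
      rw [(p i).smul_eq, ENNReal.toReal_mul, toReal_enorm])

theorem finiteSeminorm_apply (p : ι → ExtNorm R) (i : ι) (a : finitePart p) :
    finiteSeminorm p i a = ((p i).toFun (a : R)).toReal := rfl

theorem finiteSeminorm_mul_le (p : ι → ExtNorm R) (i : ι) (a b : finitePart p) :
    finiteSeminorm p i (a * b) ≤ finiteSeminorm p i a * finiteSeminorm p i b := by
  simp only [finiteSeminorm_apply]
  rw [← ENNReal.toReal_mul]
  exact ENNReal.toReal_mono (ENNReal.mul_ne_top (a.2 i) (b.2 i)) ((p i).mul_le _ _)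

/-- The topology of `finitePart p` is the locally convex topology given by the norms of the
family. -/
instance finitePartTopology (p : ι → ExtNorm R) : TopologicalSpace (finitePart p) :=
  ⨅ i, (finiteSeminorm p i).toSeminormedAddCommGroup.toUniformSpace.toTopologicalSpace

instance (p : ι → ExtNorm R) : IsTopologicalRing (finitePart p) := by
  have h1 : IsTopologicalAddGroup (finitePart p) :=
    topologicalAddGroup_iInf fun i => by
      let _ := (finiteSeminorm p i).toSeminormedAddCommGroup
      infer_instance
  have h2 : ContinuousMul (finitePart p) :=
    continuousMul_iInf fun i => by
      let _ : NonUnitalSeminormedRing (finitePart p) :=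
        { (finiteSeminorm p i).toSeminormedAddCommGroup,
          (inferInstance : NonUnitalRing (finitePart p)) with
          norm_mul_le := finiteSeminorm_mul_le p i }
      infer_instance
  exact { h1, h2 with }

instance (p : ι → ExtNorm R) : ContinuousSMul ℂ (finitePart p) :=
  continuousSMul_iInf fun i => by
    let _ : SeminormedAddCommGroup (finitePart p) := (finiteSeminorm p i).toSeminormedAddCommGroup
    let _ : NormedSpace ℂ (finitePart p) :=
      ⟨fun c a => (map_smul_eq_mul (finiteSeminorm p i) c a).le⟩
    infer_instance

end FinitePart

/-! ## The free polydisk -/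

/-- The number of maximal blocks of equal consecutive letters in a word; for a nonempty word this
is one more than the number of positions with `α_i ≠ α_{i+1}`, and for the empty word it is `0`. -/
def blocks {n : ℕ} : List (Fin n) → ℕ
  | [] => 0
  | [_] => 1
  | x :: y :: l => (if x = y then 0 else 1) + blocks (y :: l)

theorem blocks_append_le {n : ℕ} (u v : List (Fin n)) :
    blocks (u ++ v) ≤ blocks u + blocks v := by
  induction u with
  | nil => simp [blocks]
  | cons x u ih =>
    cases u with
    | nil =>
      cases v with
      | nil => simp [blocks]
      | cons y v =>
        simp only [List.cons_append, List.nil_append, blocks]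
        split_ifs <;> omega
    | cons y u =>
      simp only [List.cons_append, blocks] at ih ⊢
      omega

theorem tsum_splits_le {n : ℕ} (f : List (Fin n) → List (Fin n) → ℝ≥0∞) :
    ∑' w : List (Fin n), ∑ i ∈ Finset.range (w.length + 1), f (w.take i) (w.drop i) ≤
      ∑' u, ∑' v, f u v := by
  have h1 : ∀ w : List (Fin n), ∑ i ∈ Finset.range (w.length + 1), f (w.take i) (w.drop i) =
      ∑' i : Fin (w.length + 1), f (w.take i) (w.drop i) := fun w => by
    rw [tsum_fintype, Finset.sum_range]
  simp_rw [h1]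
  rw [← ENNReal.tsum_sigma' (fun s : (w : List (Fin n)) × Fin (w.length + 1) =>
    f (s.1.take s.2) (s.1.drop s.2)), ← ENNReal.tsum_prod]
  refine ENNReal.tsum_comp_le_tsum_of_injective
    (f := fun s : (w : List (Fin n)) × Fin (w.length + 1) => (s.1.take s.2, s.1.drop s.2)) ?_
    (fun q => f q.1 q.2)
  rintro ⟨w, i⟩ ⟨w', i'⟩ h
  simp only [Prod.mk.injEq] at h
  have hw : w = w' := by
    rw [← List.take_append_drop i w, h.1, h.2, List.take_append_drop]
  subst hw
  have hi : (i : ℕ) = i' := by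
    have := congrArg List.length h.1
    simp only [List.length_take] at this
    omega
  exact Sigma.ext rfl (heq_of_eq (Fin.ext hi))

/-- The norm `∑_α |c_α| ρ^{|α|} τ^{blocks α}`. -/
def diskNorm (n : ℕ) (ρ τ : ℝ≥0) (hτ : 1 ≤ τ) : ExtNorm (FreeSeries n) where
  toFun a := ∑' w : List (Fin n), ‖a w‖ₑ * (ρ : ℝ≥0∞) ^ w.length * (τ : ℝ≥0∞) ^ blocks w
  add_le a b := by
    rw [← ENNReal.tsum_add]
    refine ENNReal.tsum_le_tsum fun w => ?_
    rw [← add_mul, ← add_mul]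
    gcongr
    exact enorm_add_le (a w) (b w)
  smul_eq c a := by
    rw [← ENNReal.tsum_mul_left]
    refine tsum_congr fun w => ?_
    rw [FreeSeries.smul_apply, enorm_mul, mul_assoc, mul_assoc, mul_assoc]
  mul_le a b := by
    set A : List (Fin n) → ℝ≥0∞ := fun w => ‖a w‖ₑ * (ρ : ℝ≥0∞) ^ w.length * (τ : ℝ≥0∞) ^ blocks w
    set B : List (Fin n) → ℝ≥0∞ := fun w => ‖b w‖ₑ * (ρ : ℝ≥0∞) ^ w.length * (τ : ℝ≥0∞) ^ blocks w
    calc ∑' w : List (Fin n), ‖(a * b) w‖ₑ * (ρ : ℝ≥0∞) ^ w.length * (τ : ℝ≥0∞) ^ blocks w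
        ≤ ∑' w : List (Fin n), ∑ i ∈ Finset.range (w.length + 1), A (w.take i) * B (w.drop i) := by
          refine ENNReal.tsum_le_tsum fun w => ?_
          rw [FreeSeries.mul_apply]
          calc _ ≤ (∑ i ∈ Finset.range (w.length + 1), ‖a (w.take i) * b (w.drop i)‖ₑ) *
                (ρ : ℝ≥0∞) ^ w.length * (τ : ℝ≥0∞) ^ blocks w := by
                  gcongr
                  exact enorm_sum_le _ _
            _ ≤ _ := by
                  rw [Finset.sum_mul, Finset.sum_mul]
                  refine Finset.sum_le_sum fun i _ => ?_
                  have hl : w.length = (w.take i).length + (w.drop i).length := by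
                    rw [← List.length_append, List.take_append_drop]
                  have hb : blocks w ≤ blocks (w.take i) + blocks (w.drop i) := by
                    simpa using blocks_append_le (w.take i) (w.drop i)
                  have ht : (τ : ℝ≥0∞) ^ blocks w ≤
                      (τ : ℝ≥0∞) ^ (blocks (w.take i) + blocks (w.drop i)) :=
                    pow_le_pow_right₀ (by exact_mod_cast hτ) hb
                  calc _ ≤ ‖a (w.take i) * b (w.drop i)‖ₑ *
                        (ρ : ℝ≥0∞) ^ ((w.take i).length + (w.drop i).length) *
                        (τ : ℝ≥0∞) ^ (blocks (w.take i) + blocks (w.drop i)) := by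
                          rw [← hl]; gcongr
                    _ = _ := by
                          simp only [A, B]
                          rw [enorm_mul, pow_add, pow_add]; ring
      _ ≤ ∑' u, ∑' v, A u * B v := tsum_splits_le fun u v => A u * B v
      _ = _ := by
          simp_rw [ENNReal.tsum_mul_left, ENNReal.tsum_mul_right]
  one_ne_top := by
    rw [tsum_eq_single []]
    · simp [blocks, FreeSeries.one_nil]
    · intro w hw
      obtain ⟨x, w, rfl⟩ := List.exists_cons_of_ne_nil hw
      simp [FreeSeries.one_cons]

/-- The parameters `(ρ, τ)` with `0 < ρ < r` and `τ ≥ 1`. -/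
def DiskIndex (r : ℝ≥0∞) : Type := {p : ℝ≥0 × ℝ≥0 // 0 < p.1 ∧ (p.1 : ℝ≥0∞) < r ∧ 1 ≤ p.2}

/-- The norms `∑_α |c_α| ρ^{|α|} τ^{blocks α}` with `0 < ρ < r` and `τ ≥ 1`. -/
def diskNorms (n : ℕ) (r : ℝ≥0∞) (i : DiskIndex r) : ExtNorm (FreeSeries n) :=
  diskNorm n i.1.1 i.1.2 i.2.2.2

/-- The Fréchet algebra of holomorphic functions on the free `n`-dimensional polydisk of radius
`r`: the free series with `∑_α |c_α| ρ^{|α|} τ^{blocks α} < ∞` for all `0 < ρ < r` and `τ ≥ 1`.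
This is the concrete form of the `n`-fold coproduct, among Arens-Michael algebras, of the algebra
of holomorphic functions on the open disk of radius `r`. -/
abbrev FreePolydisk (n : ℕ) (r : ℝ≥0∞) : Type := finitePart (diskNorms n r)

/-- The coordinate `ζ_i` of the free polydisk. -/
def FreePolydisk.ζ {n : ℕ} {r : ℝ≥0∞} (i : Fin n) : FreePolydisk n r :=
  ⟨FreeSeries.X i, fun j => by
    change ∑' w : List (Fin n), _ ≠ ∞
    rw [tsum_eq_single [i]]
    · simp [blocks, FreeSeries.X, ENNReal.mul_eq_top]
    · intro w hw
      simp [FreeSeries.X, hw]⟩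

/-! ## The free ball -/

/-- The homogeneous part of degree `d`: the vector `(c_α)_{|α| = d}` with its `ℓ²`-norm. -/
def homPart {n : ℕ} (d : ℕ) (a : FreeSeries n) : EuclideanSpace ℂ (Fin d → Fin n) :=
  WithLp.toLp 2 fun v => a (List.ofFn v)

theorem homPart_add {n : ℕ} (d : ℕ) (a b : FreeSeries n) :
    homPart d (a + b) = homPart d a + homPart d b := rfl

theorem homPart_smul {n : ℕ} (d : ℕ) (c : ℂ) (a : FreeSeries n) :
    homPart d (c • a) = c • homPart d a := rfl

/-- The concatenation of a vector of degree `i` with one of degree `j`, in degree `i + j = d`. -/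
def concat {n d i j : ℕ} (h : i + j = d) (x : EuclideanSpace ℂ (Fin i → Fin n))
    (y : EuclideanSpace ℂ (Fin j → Fin n)) : EuclideanSpace ℂ (Fin d → Fin n) :=
  WithLp.toLp 2 fun v =>
    x (fun k => v (Fin.cast h (Fin.castAdd j k))) * y (fun k => v (Fin.cast h (Fin.natAdd i k)))

theorem norm_concat {n d i j : ℕ} (h : i + j = d) (x : EuclideanSpace ℂ (Fin i → Fin n))
    (y : EuclideanSpace ℂ (Fin j → Fin n)) : ‖concat h x y‖ = ‖x‖ * ‖y‖ := by
  subst h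
  rw [EuclideanSpace.norm_eq, EuclideanSpace.norm_eq, EuclideanSpace.norm_eq,
    ← Real.sqrt_mul (by positivity), Finset.sum_mul_sum, ← Finset.sum_product']
  congr 1
  rw [← (Fin.appendEquiv i j).sum_comp, Finset.univ_product_univ]
  refine Finset.sum_congr rfl fun q _ => ?_
  simp [concat, Fin.appendEquiv, mul_pow]

theorem homPart_mul {n : ℕ} (d : ℕ) (a b : FreeSeries n) :
    homPart d (a * b) = ∑ q : {q : ℕ × ℕ // q ∈ Finset.HasAntidiagonal.antidiagonal d},
      concat (Finset.HasAntidiagonal.mem_antidiagonal.1 q.2) (homPart q.1.1 a) (homPart q.1.2 b) := by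
  ext v
  rw [WithLp.ofLp_sum, Finset.sum_apply]
  have h1 : (homPart d (a * b)).ofLp v = ∑ q ∈ Finset.HasAntidiagonal.antidiagonal d,
      a ((List.ofFn v).take q.1) * b ((List.ofFn v).drop q.1) := by
    rw [Finset.Nat.sum_antidiagonal_eq_sum_range_succ_mk]
    change (a * b) (List.ofFn v) = _
    rw [FreeSeries.mul_apply, List.length_ofFn]
  rw [h1, ← Finset.sum_coe_sort]
  refine Finset.sum_congr rfl fun q _ => ?_
  obtain ⟨⟨i, j⟩, hq⟩ := q
  have h : i + j = d := Finset.HasAntidiagonal.mem_antidiagonal.1 hq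
  subst h
  have hv : List.ofFn v = List.ofFn (fun k => v (Fin.castAdd j k)) ++
      List.ofFn (fun k => v (Fin.natAdd i k)) := by
    rw [← List.ofFn_fin_append, Fin.append_castAdd_natAdd]
  have h2 : (List.ofFn v).take i = List.ofFn (fun k => v (Fin.castAdd j k)) := by
    rw [hv, List.take_left' (by simp)]
  have h3 : (List.ofFn v).drop i = List.ofFn (fun k => v (Fin.natAdd i k)) := by
    rw [hv, List.drop_left' (by simp)]
  simp only [h2, h3]
  rfl

theorem tsum_antidiagonal_mul (A B : ℕ → ℝ≥0∞) :
    ∑' d, ∑ q ∈ Finset.HasAntidiagonal.antidiagonal d, A q.1 * B q.2 = (∑' i, A i) * ∑' j, B j := by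
  calc ∑' d, ∑ q ∈ Finset.HasAntidiagonal.antidiagonal d, A q.1 * B q.2
      = ∑' d, ∑' q : Finset.HasAntidiagonal.antidiagonal d, A q.1.1 * B q.1.2 := by
        refine tsum_congr fun d => ?_
        rw [tsum_fintype, Finset.sum_coe_sort _ (fun q : ℕ × ℕ => A q.1 * B q.2)]
    _ = ∑' s : (Σ d : ℕ, Finset.HasAntidiagonal.antidiagonal d), A s.2.1.1 * B s.2.1.2 :=
        (ENNReal.tsum_sigma' fun s : (Σ d : ℕ, Finset.HasAntidiagonal.antidiagonal d) =>
          A s.2.1.1 * B s.2.1.2).symm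
    _ = ∑' q : ℕ × ℕ, A q.1 * B q.2 :=
        Finset.HasAntidiagonal.sigmaAntidiagonalEquivProd.tsum_eq fun q : ℕ × ℕ => A q.1 * B q.2
    _ = _ := by
        rw [ENNReal.tsum_prod (f := fun i j => A i * B j)]
        simp_rw [ENNReal.tsum_mul_left, ENNReal.tsum_mul_right]

/-- The norm `∑_d (∑_{|α| = d} |c_α|²)^{1/2} ρ^d`. -/
def ballNorm (n : ℕ) (ρ : ℝ≥0) : ExtNorm (FreeSeries n) where
  toFun a := ∑' d : ℕ, ‖homPart d a‖ₑ * (ρ : ℝ≥0∞) ^ d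
  add_le a b := by
    rw [← ENNReal.tsum_add]
    refine ENNReal.tsum_le_tsum fun d => ?_
    rw [← add_mul, homPart_add]
    gcongr
    exact enorm_add_le _ _
  smul_eq c a := by
    rw [← ENNReal.tsum_mul_left]
    refine tsum_congr fun d => ?_
    rw [homPart_smul, enorm_smul, mul_assoc]
  mul_le a b := by
    rw [← tsum_antidiagonal_mul]
    refine ENNReal.tsum_le_tsum fun d => ?_
    rw [homPart_mul, ← Finset.sum_coe_sort (Finset.HasAntidiagonal.antidiagonal d)]
    calc _ ≤ (∑ q : {q : ℕ × ℕ // q ∈ Finset.HasAntidiagonal.antidiagonal d},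
          ‖concat (Finset.HasAntidiagonal.mem_antidiagonal.1 q.2) (homPart q.1.1 a)
            (homPart q.1.2 b)‖ₑ) *
          (ρ : ℝ≥0∞) ^ d := by
            gcongr
            exact enorm_sum_le _ _
      _ ≤ _ := by
            rw [Finset.sum_mul]
            refine Finset.sum_le_sum fun q _ => le_of_eq ?_
            have hc : ‖concat (Finset.HasAntidiagonal.mem_antidiagonal.1 q.2) (homPart q.1.1 a)
                (homPart q.1.2 b)‖ₑ = ‖homPart q.1.1 a‖ₑ * ‖homPart q.1.2 b‖ₑ := by
              rw [← ofReal_norm, norm_concat, ENNReal.ofReal_mul (norm_nonneg _), ofReal_norm,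
                ofReal_norm]
            have hd : (ρ : ℝ≥0∞) ^ d = (ρ : ℝ≥0∞) ^ q.1.1 * (ρ : ℝ≥0∞) ^ q.1.2 := by
              rw [← pow_add, Finset.HasAntidiagonal.mem_antidiagonal.1 q.2]
            rw [hc, hd]
            ring
  one_ne_top := by
    rw [tsum_eq_single 0]
    · simp
    · intro d hd
      obtain ⟨d, rfl⟩ := Nat.exists_eq_succ_of_ne_zero hd
      have : homPart (d + 1) (1 : FreeSeries n) = 0 := by
        ext v
        change (1 : FreeSeries n) (List.ofFn v) = 0
        rw [List.ofFn_succ, FreeSeries.one_cons]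
      simp [this]

/-- The parameters `ρ` with `0 < ρ < r`. -/
def BallIndex (r : ℝ≥0∞) : Type := {ρ : ℝ≥0 // 0 < ρ ∧ (ρ : ℝ≥0∞) < r}

/-- The norms `∑_d (∑_{|α| = d} |c_α|²)^{1/2} ρ^d` with `0 < ρ < r`. -/
def ballNorms (n : ℕ) (r : ℝ≥0∞) (i : BallIndex r) : ExtNorm (FreeSeries n) := ballNorm n i.1

/-- The Fréchet algebra of holomorphic functions on the free `n`-dimensional ball of radius `r`:
the free series with `∑_d (∑_{|α| = d} |c_α|²)^{1/2} ρ^d < ∞` for all `0 < ρ < r`. -/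
abbrev FreeBall (n : ℕ) (r : ℝ≥0∞) : Type := finitePart (ballNorms n r)

/-- The coordinate `ζ_i` of the free ball. -/
def FreeBall.ζ {n : ℕ} {r : ℝ≥0∞} (i : Fin n) : FreeBall n r :=
  ⟨FreeSeries.X i, fun j => by
    change ∑' d : ℕ, _ ≠ ∞
    rw [tsum_eq_single 1]
    · simp [ENNReal.mul_eq_top]
    · intro d hd
      have : homPart d (FreeSeries.X i) = 0 := by
        ext v
        change (if List.ofFn v = [i] then (1 : ℂ) else 0) = 0
        rw [if_neg]
        intro h
        have := congrArg List.length h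
        simp at this
        exact hd this
      simp [this]⟩

/-! ## Algebras of holomorphic vector-valued functions -/

section Holomorphic

variable (U : Set ℂ) (F : Type) [Ring F] [Algebra ℂ F] [TopologicalSpace F]
  [IsTopologicalRing F] [ContinuousSMul ℂ F]

/-- `f : U → F` is holomorphic if it has a complex derivative in `F` at every point of the open
set `U`. -/
def IsHolomorphic {U : Set ℂ} {F : Type} [AddCommGroup F] [Module ℂ F] [TopologicalSpace F]
    (f : U → F) : Prop :=
  ∀ z : U, ∃ f' : F,
    Tendsto (fun w : U => ((w : ℂ) - (z : ℂ))⁻¹ • (f w - f z)) (𝓝[≠] z) (𝓝 f')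

/-- The algebra `𝒪(U, F)` of holomorphic `F`-valued functions, a subalgebra of the algebra
of continuous functions. It carries the compact-open topology. -/
def holo : Subalgebra ℂ C(U, F) where
  carrier := {f | IsHolomorphic f}
  mul_mem' {f g} hf hg z := by
    obtain ⟨f', hf'⟩ := hf z
    obtain ⟨g', hg'⟩ := hg z
    refine ⟨f' * g z + f z * g', ?_⟩
    have hgz : Tendsto (fun w : U => g w) (𝓝[≠] z) (𝓝 (g z)) :=
      (g.continuous.tendsto z).mono_left nhdsWithin_le_nhds
    refine ((hf'.mul hgz).add (hg'.const_mul (f z))).congr fun w => ?_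
    simp only [ContinuousMap.mul_apply]
    rw [smul_mul_assoc, mul_smul_comm, ← smul_add]
    congr 1
    noncomm_ring
  add_mem' {f g} hf hg z := by
    obtain ⟨f', hf'⟩ := hf z
    obtain ⟨g', hg'⟩ := hg z
    refine ⟨f' + g', (hf'.add hg').congr fun w => ?_⟩
    simp only [ContinuousMap.add_apply]
    rw [← smul_add]
    congr 1
    abel
  algebraMap_mem' c z := by
    refine ⟨0, tendsto_const_nhds.congr fun w => ?_⟩
    simp

variable {U F}

/-- The constant function with value `a`. -/
def holoConst (a : F) : holo U F :=
  ⟨ContinuousMap.const U a, fun z => ⟨0, tendsto_const_nhds.congr fun w => by simp⟩⟩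

instance holoCommRing : CommRing (holo U ℂ) :=
  { (inferInstance : Ring (holo U ℂ)) with
    mul_comm := fun _ _ => Subtype.ext (ContinuousMap.ext fun _ => mul_comm _ _) }

/-- A scalar holomorphic function `f`, viewed as the `F`-valued function `z ↦ f z • 1`. -/
def holoScalar : holo U ℂ →+* holo U F where
  toFun f := ⟨⟨fun z => algebraMap ℂ F (f.1 z), by
      simp only [Algebra.algebraMap_eq_smul_one]
      exact f.1.continuous.smul continuous_const⟩, fun z => by
      obtain ⟨f', hf'⟩ := f.2 z
      refine ⟨f' • 1, (hf'.smul_const (1 : F)).congr fun w => ?_⟩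
      change _ = _ • (algebraMap ℂ F (f.1 w) - algebraMap ℂ F (f.1 z))
      rw [← map_sub (algebraMap ℂ F), Algebra.algebraMap_eq_smul_one, smul_assoc]⟩
  map_one' := Subtype.ext (ContinuousMap.ext fun _ => map_one (algebraMap ℂ F))
  map_mul' _ _ := Subtype.ext (ContinuousMap.ext fun _ => map_mul (algebraMap ℂ F) _ _)
  map_zero' := Subtype.ext (ContinuousMap.ext fun _ => map_zero (algebraMap ℂ F))
  map_add' _ _ := Subtype.ext (ContinuousMap.ext fun _ => map_add (algebraMap ℂ F) _ _)

theorem holoScalar_apply (f : holo U ℂ) (z : U) :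
    (holoScalar f : holo U F).1 z = algebraMap ℂ F (f.1 z) := rfl

/-- `𝒪(U, F)` as an algebra over `𝒪(U)`. -/
instance holoAlgebra : Algebra (holo U ℂ) (holo U F) :=
  (holoScalar (U := U) (F := F)).toAlgebra' fun _ _ =>
    Subtype.ext (ContinuousMap.ext fun _ => Algebra.commutes _ _)

/-- The complex coordinate `z ∈ 𝒪(U)`. -/
def coord : holo U ℂ :=
  ⟨⟨fun z => (z : ℂ), continuous_subtype_val⟩, fun z => by
    refine ⟨1, tendsto_const_nhds.congr' ?_⟩
    filter_upwards [self_mem_nhdsWithin] with w hw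
    have : (w : ℂ) - z ≠ 0 := sub_ne_zero.2 fun h => hw (Subtype.ext h)
    simp [this]⟩

instance [LocallyCompactSpace U] : IsTopologicalRing (holo U F) := by
  have h : IsTopologicalRing C(U, F) := { }
  exact
    { continuous_add := continuous_add
      continuous_neg := (continuous_subtype_val.neg).subtype_mk _
      continuous_mul :=
        ((continuous_subtype_val.comp continuous_fst).mul
          (continuous_subtype_val.comp continuous_snd)).subtype_mk _ }

end Holomorphic

/-! ## Closed two-sided ideals and quotients -/

section Ideals

variable {R : Type} [Ring R] [TopologicalSpace R]

/-- The closed two-sided ideal generated by `S`: the smallest closed two-sided ideal that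
contains `S`. -/
def closedIdeal (S : Set R) : Ideal R :=
  sInf {J : Ideal R | J.IsTwoSided ∧ IsClosed (J : Set R) ∧ S ⊆ J}

instance (S : Set R) : (closedIdeal S).IsTwoSided :=
  ⟨fun b ha => by
    simp only [closedIdeal, Submodule.mem_sInf, Set.mem_ofPred_eq] at ha ⊢
    intro J hJ
    have : Ideal.IsTwoSided J := hJ.1
    exact Ideal.mul_mem_right b J (ha J hJ)⟩

variable [IsTopologicalRing R]

instance (I : Ideal R) [I.IsTwoSided] : IsTopologicalRing (R ⧸ I) :=
  { (inferInstance : IsTopologicalAddGroup (R ⧸ I)) with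
    continuous_mul := by
      have hq : IsOpenQuotientMap (Ideal.Quotient.mk I) := QuotientAddGroup.isOpenQuotientMap_mk
      refine ((hq.prodMap hq).isQuotientMap.continuous_iff).2 ?_
      exact hq.continuous.comp continuous_mul }

end Ideals

/-! ## Bundles of locally convex spaces -/

/-- The total space of a family of vector spaces. -/
abbrev Tot {X : Type} (E : X → Type) : Type := Bundle.TotalSpace Unit E

/-- A family of complex algebras over `X` together with a topology on the total space and a
collection of subsets of the total space. The axioms of a bundle are stated separately below. -/
structure AlgBundle (X : Type) where
  Fib : X → Type
  [ring : ∀ x, Ring (Fib x)]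
  [alg : ∀ x, Algebra ℂ (Fib x)]
  top : TopologicalSpace (Tot Fib)
  unif : Set (Set (Tot Fib))

attribute [instance] AlgBundle.ring AlgBundle.alg AlgBundle.top

/-- A Fréchet algebra: a complete metrizable locally convex topological algebra. -/
structure IsFrechetAlgebra (A : Type) [Ring A] [Algebra ℂ A] [TopologicalSpace A] : Prop where
  topologicalRing : IsTopologicalRing A
  continuousSMul : ContinuousSMul ℂ A
  locallyConvex : LocallyConvexSpace ℝ A
  metrizable : TopologicalSpace.MetrizableSpace A
  complete : @CompleteSpace A (IsTopologicalAddGroup.rightUniformSpace A)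

/-- A seminorm on a family of vector spaces: a seminorm on each fiber. -/
abbrev FibSeminorm {X : Type} (E : X → Type) [∀ x, AddCommGroup (E x)] [∀ x, Module ℂ (E x)] :
    Type :=
  ∀ x, Seminorm ℂ (E x)

section Families

variable {X : Type} {E : X → Type} [∀ x, AddCommGroup (E x)] [∀ x, Module ℂ (E x)]

/-- The function on the total space given by a seminorm. -/
def FibSeminorm.fn (N : FibSeminorm E) (v : Tot E) : ℝ := N v.proj v.snd

/-- `S ∩ E_x` as a subset of `E_x`. -/
def slice (S : Set (Tot E)) (x : X) : Set (E x) := {v | (⟨x, v⟩ : Tot E) ∈ S}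

/-- `S` is absolutely convex in each fiber. -/
def IsAbsConvex (S : Set (Tot E)) : Prop :=
  ∀ x, Balanced ℂ (slice S x) ∧ Convex ℝ (slice S x)

/-- `S` is absorbing in each fiber. -/
def IsAbsorbing (S : Set (Tot E)) : Prop := ∀ x, Absorbent ℂ (slice S x)

/-- A locally convex uniform vector structure on the family. -/
structure IsUniformVectorStructure (𝒰 : Set (Set (Tot E))) : Prop where
  nonempty : 𝒰.Nonempty
  absorbing : ∀ S ∈ 𝒰, IsAbsorbing S
  absConvex : ∀ S ∈ 𝒰, IsAbsConvex S
  smul_mem : ∀ S ∈ 𝒰, ∀ c : ℂ, c ≠ 0 → (fun v : Tot E => (⟨v.proj, c • v.snd⟩ : Tot E)) '' S ∈ 𝒰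
  inter_mem : ∀ S ∈ 𝒰, ∀ T ∈ 𝒰, S ∩ T ∈ 𝒰
  mem_of_superset : ∀ S ∈ 𝒰, ∀ T, S ⊆ T → IsAbsConvex T → T ∈ 𝒰

/-- The family `𝒩` of seminorms is directed. -/
def IsDirectedFamily (𝒩 : Set (FibSeminorm E)) : Prop :=
  ∀ N₁ ∈ 𝒩, ∀ N₂ ∈ 𝒩, ∃ N ∈ 𝒩, ∃ C : ℝ, 0 < C ∧
    ∀ v : Tot E, N₁.fn v ≤ C * N.fn v ∧ N₂.fn v ≤ C * N.fn v

/-- The locally convex uniform vector structure with base `{v | ‖v‖_N < ε}`, `N ∈ 𝒩`,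
`ε > 0`. -/
def uniformStructureOf (𝒩 : Set (FibSeminorm E)) : Set (Set (Tot E)) :=
  {S | IsAbsConvex S ∧ ∃ N ∈ 𝒩, ∃ ε : ℝ, 0 < ε ∧ {v : Tot E | N.fn v < ε} ⊆ S}

/-- The `ε`-tube around a section `s` over `V`. -/
def tube (V : Set X) (s : ∀ x, E x) (N : FibSeminorm E) (ε : ℝ) : Set (Tot E) :=
  {v | v.proj ∈ V ∧ N v.proj (v.snd - s v.proj) < ε}

/-- The set `s(V) + S` of all `s_x + u` with `x ∈ V` and `u ∈ S ∩ E_x`. -/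
def translate (V : Set X) (s : ∀ x, E x) (S : Set (Tot E)) : Set (Tot E) :=
  {v | ∃ x ∈ V, ∃ u ∈ slice S x, v = ⟨x, s x + u⟩}

/-- The topology of the fibered product `E ×_X E`, as a subspace of `E × E`. -/
@[reducible]
def fibProdTopology (E : X → Type) [t : TopologicalSpace (Tot E)] :
    TopologicalSpace (Tot fun x => E x × E x) :=
  TopologicalSpace.induced
    (fun q => ((⟨q.proj, q.snd.1⟩, ⟨q.proj, q.snd.2⟩) : Tot E × Tot E)) inferInstance

variable [TopologicalSpace X] [TopologicalSpace (Tot E)]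

/-- `s` restricts to a continuous section over `V`. -/
def IsContSection (V : Set X) (s : ∀ x, E x) : Prop :=
  ContinuousOn (fun x => (⟨x, s x⟩ : Tot E)) V

variable (E) in
/-- A prebundle of topological vector spaces. -/
structure IsPrebundle : Prop where
  continuous_proj : Continuous fun v : Tot E => v.proj
  isOpenMap_proj : IsOpenMap fun v : Tot E => v.proj
  continuous_zero : Continuous fun x : X => (⟨x, 0⟩ : Tot E)
  continuous_add : @Continuous _ _ (fibProdTopology E) inferInstance
    fun q : Tot (fun x => E x × E x) => (⟨q.proj, q.snd.1 + q.snd.2⟩ : Tot E)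
  continuous_smul : Continuous fun q : ℂ × Tot E => (⟨q.2.proj, q.1 • q.2.snd⟩ : Tot E)

/-- A bundle of locally convex spaces. -/
structure IsLocallyConvexBundle (𝒰 : Set (Set (Tot E))) : Prop where
  prebundle : IsPrebundle E
  uniform : IsUniformVectorStructure 𝒰
  exists_open : ∀ S ∈ 𝒰, ∃ T ∈ 𝒰, T ⊆ S ∧ IsOpen T
  basis : TopologicalSpace.IsTopologicalBasis
    {W : Set (Tot E) | ∃ (V : Set X) (s : ∀ x, E x) (S : Set (Tot E)), IsOpen V ∧
      IsContSection V s ∧ S ∈ 𝒰 ∧ IsOpen S ∧ W = translate V s S}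
  dense : ∀ x : X,
    @Dense (E x) (TopologicalSpace.induced (fun v => (⟨x, v⟩ : Tot E)) inferInstance)
      {v | ∃ (V : Set X) (s : ∀ x, E x), IsOpen V ∧ x ∈ V ∧ IsContSection V s ∧ s x = v}

/-- A directed family `𝒩` of seminorms is admissible if the tubes around continuous sections are a
base of the topology, and the values at `x` of continuous local sections are dense in `E_x` for the
topology of the seminorms in `𝒩` (a directed family, so its balls are a base of that topology). -/
structure IsAdmissible (𝒩 : Set (FibSeminorm E)) : Prop where
  basis : TopologicalSpace.IsTopologicalBasis
    {W : Set (Tot E) | ∃ (V : Set X) (s : ∀ x, E x) (N : FibSeminorm E) (ε : ℝ), IsOpen V ∧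
      IsContSection V s ∧ N ∈ 𝒩 ∧ 0 < ε ∧ W = tube V s N ε}
  dense : ∀ (x : X) (v : E x), ∀ N ∈ 𝒩, ∀ ε : ℝ, 0 < ε →
    ∃ (V : Set X) (s : ∀ x, E x), IsOpen V ∧ x ∈ V ∧ IsContSection V s ∧ N x (s x - v) < ε

end Families

namespace AlgBundle

variable {X : Type} [TopologicalSpace X] (B : AlgBundle X)

/-- A Fréchet algebra bundle: a locally convex bundle with jointly continuous and uniformly
continuous (at zero) fiberwise multiplication, whose fibers are Fréchet algebras in the topology
inherited from the total space. -/
structure IsFrechetAlgebraBundle : Prop where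
  locallyConvexBundle : IsLocallyConvexBundle B.unif
  continuous_mul : @Continuous _ _ (fibProdTopology B.Fib) inferInstance
    fun q : Tot (fun x => B.Fib x × B.Fib x) => (⟨q.proj, q.snd.1 * q.snd.2⟩ : Tot B.Fib)
  mul_subset : ∀ S ∈ B.unif, ∃ T ∈ B.unif, ∀ (x : X), ∀ u ∈ slice T x, ∀ v ∈ slice T x,
    u * v ∈ slice S x
  frechet : ∀ x : X, @IsFrechetAlgebra (B.Fib x) _ _
    (TopologicalSpace.induced (fun v => (⟨x, v⟩ : Tot B.Fib)) inferInstance)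

/-- The bundle is continuous: its uniform vector structure is given by an admissible directed
family of seminorms that are continuous functions on the total space. -/
def IsContinuous : Prop :=
  ∃ 𝒩 : Set (FibSeminorm B.Fib), IsDirectedFamily 𝒩 ∧ IsAdmissible 𝒩 ∧
    (∀ N ∈ 𝒩, Continuous N.fn) ∧ B.unif = uniformStructureOf 𝒩

end AlgBundle

/-! ## The bundle of a locally convex algebra over an algebra of functions -/

/-- The quotient seminorm `v ↦ inf {p a : a + J = v}` on `A ⧸ J`. -/
def quotSeminorm {A : Type} [Ring A] [Algebra ℂ A] (J : Ideal A) [J.IsTwoSided]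
    (p : Seminorm ℂ A) : Seminorm ℂ (A ⧸ J) :=
  Seminorm.ofSMulLE (fun v => ⨅ a : {a : A // Ideal.Quotient.mk J a = v}, p a)
    (by
      refine le_antisymm ?_ (Real.iInf_nonneg fun a => apply_nonneg p _)
      refine (ciInf_le ⟨0, ?_⟩ (⟨0, map_zero _⟩ : {a : A // Ideal.Quotient.mk J a = 0})).trans
        (map_zero p).le
      rintro _ ⟨a, rfl⟩
      exact apply_nonneg p _)
    (fun v w => by
      have hne : ∀ u : A ⧸ J, Nonempty {a : A // Ideal.Quotient.mk J a = u} := fun u =>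
        let ⟨a, ha⟩ := Ideal.Quotient.mk_surjective u
        ⟨⟨a, ha⟩⟩
      have := hne v
      have := hne w
      refine le_ciInf_add_ciInf fun a b => ?_
      refine (ciInf_le ⟨0, ?_⟩ (⟨a.1 + b.1, by rw [map_add, a.2, b.2]⟩ :
        {a : A // Ideal.Quotient.mk J a = v + w})).trans (map_add_le_add p _ _)
      rintro _ ⟨c, rfl⟩
      exact apply_nonneg p _)
    (fun c v => by
      have hne : Nonempty {a : A // Ideal.Quotient.mk J a = v} :=
        let ⟨a, ha⟩ := Ideal.Quotient.mk_surjective v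
        ⟨⟨a, ha⟩⟩
      rw [Real.mul_iInf_of_nonneg (norm_nonneg c)]
      refine le_ciInf fun a => ?_
      refine (ciInf_le ⟨0, ?_⟩ (⟨c • a.1, congrArg (c • ·) a.2⟩ :
        {a : A // Ideal.Quotient.mk J a = c • v})).trans (map_smul_eq_mul p c a.1).le
      rintro _ ⟨c, rfl⟩
      exact apply_nonneg p _)

section BundleOf

variable {X : Type} [TopologicalSpace X] {K : Type} [CommRing K] [Algebra ℂ K]
  (γ : K →ₐ[ℂ] C(X, ℂ)) (A : Type) [Ring A] [Algebra ℂ A] [Algebra K A] [TopologicalSpace A]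
  [IsTopologicalRing A]

/-- The ideal `𝔪_x` of all `k ∈ K` with `k(x) = 0`. -/
def pointIdeal (x : X) : Ideal K where
  carrier := {k | γ k x = 0}
  zero_mem' := by simp
  add_mem' {a b} ha hb := by
    simp only [Set.mem_ofPred_eq] at ha hb ⊢
    simp [ha, hb]
  smul_mem' c k hk := by
    simp only [Set.mem_ofPred_eq] at hk ⊢
    simp [hk]

/-- The closure of `𝔪_x A`. -/
def fiberIdeal (x : X) : Ideal A := ((pointIdeal γ x).map (algebraMap K A)).closure

instance (x : X) : (fiberIdeal γ A x).IsTwoSided := by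
  refine ⟨fun {a} b ha => ?_⟩
  have key : ∀ a ∈ (pointIdeal γ x).map (algebraMap K A),
      a * b ∈ (pointIdeal γ x).map (algebraMap K A) := by
    intro a ha
    refine Submodule.span_induction ?_ ?_ ?_ ?_ ha
    · rintro _ ⟨k, hk, rfl⟩
      rw [Algebra.commutes]
      exact Ideal.mul_mem_left _ _ (Ideal.mem_map_of_mem _ hk)
    · rw [zero_mul]
      exact Ideal.zero_mem _
    · intro u v _ _ hu hv
      rw [add_mul]
      exact Ideal.add_mem _ hu hv
    · intro c u _ hu
      rw [smul_eq_mul, mul_assoc]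
      exact Ideal.mul_mem_left _ _ hu
  exact map_mem_closure (f := fun y => y * b) (continuous_mul_const b) ha key

/-- The fiber `A_x` of `A` over `x`: the quotient of `A` by the closure of `𝔪_x A`. -/
abbrev Fiber (x : X) : Type := A ⧸ fiberIdeal γ A x

/-- The image `u_x` in the fiber over `x` of an element `u` of `A`. -/
def germ (u : A) (x : X) : Fiber γ A x := Ideal.Quotient.mk (fiberIdeal γ A x) u

/-- The seminorm on the family of all fibers given by the quotient seminorms of `p`. -/
def fiberSeminorm (p : Seminorm ℂ A) : FibSeminorm (Fiber γ A) := fun x =>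
  quotSeminorm (fiberIdeal γ A x) p

/-- The bundle `E(A)` of a locally convex `K`-algebra `A`: its fibers are the algebras `A_x`, its
topology has as a base the tubes `T(V, ũ, p, ε)` around the sections `ũ : x ↦ u_x`, `u ∈ A`, and its
uniform vector structure is given by the quotient seminorms of all continuous seminorms `p`
on `A`. -/
def bundleOf : AlgBundle X where
  Fib := Fiber γ A
  top := TopologicalSpace.generateFrom
    {W | ∃ (V : Set X) (u : A) (p : Seminorm ℂ A) (ε : ℝ), IsOpen V ∧ Continuous p ∧ 0 < ε ∧
      W = tube V (germ γ A u) (fiberSeminorm γ A p) ε}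
  unif := uniformStructureOf {N | ∃ p : Seminorm ℂ A, Continuous p ∧ N = fiberSeminorm γ A p}

end BundleOf

/-! ## The deformation algebras and their bundles -/

/-- The punctured plane. -/
def Cx : Set ℂ := {0}ᶜ

instance : LocallyCompactSpace Cx := isOpen_compl_singleton.locallyCompactSpace

section Deformation

variable {F : Type} [Ring F] [Algebra ℂ F] [TopologicalSpace F] [IsTopologicalRing F]
  [ContinuousSMul ℂ F] {n : ℕ} (ζ : Fin n → F)

/-- The closed two-sided ideal of `𝒪(ℂˣ, F)` generated by `ζ_i ζ_j - z ζ_j ζ_i`, `i < j`. -/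
def defIdeal : Ideal (holo Cx F) :=
  closedIdeal {g | ∃ i j : Fin n, i < j ∧
    g = holoConst (ζ i) * holoConst (ζ j) -
      holoScalar coord * (holoConst (ζ j) * holoConst (ζ i))}

instance : (defIdeal ζ).IsTwoSided := by unfold defIdeal; infer_instance

/-- The `𝒪(ℂˣ)`-algebra `𝒪(ℂˣ, F) / I`, where `I` is the closed two-sided ideal generated by
`ζ_i ζ_j - z ζ_j ζ_i`, `i < j`. -/
abbrev DefAlgebra : Type := holo Cx F ⧸ defIdeal ζ

/-- The bundle over `ℂˣ` of the algebra `𝒪(ℂˣ, F) / I`; here `𝒪(ℂˣ)` acts on `ℂˣ` by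
evaluation. -/
def defBundle : AlgBundle Cx := bundleOf (holo Cx ℂ).val (DefAlgebra ζ)

end Deformation

/-- The bundle `E(𝔻_r^n)`. -/
def diskBundle (n : ℕ) (r : ℝ≥0∞) : AlgBundle Cx :=
  defBundle (FreePolydisk.ζ : Fin n → FreePolydisk n r)

/-- The bundle `E(𝔹_r^n)`. -/
def ballBundle (n : ℕ) (r : ℝ≥0∞) : AlgBundle Cx :=
  defBundle (FreeBall.ζ : Fin n → FreeBall n r)

end

end QDef

/-! Let F be the algebra of free series cut out by the norms `p i`, and let R(q) ⊆ F be the span of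
the elements ζ_u (ζ_i ζ_j - q ζ_j ζ_i) ζ_v with i < j. For holomorphic f one has f - f(q) = (z - q)
g with g holomorphic (`holo_exists_factor`), so in the fiber over q every f equals the constant
f(q). The kernel of the projection onto the fiber consists of the f with f(q) in the closure of
R(q). Thus the fiber is F modulo that closure, a Fréchet algebra because F is one, and the quotient
norm of the class of f is the distance of f(q) to R(q) (`iInf_fiberKernel_eq_relDist`).

The heart of the matter is that this distance is continuous in q. The diagonal operator ζ_w ↦
μ^inv(w) ζ_w carries R(q) into R(qμ), because exchanging adjacent letters i < j creates exactly one
inversion. Relations are homogeneous, so one may work in degree at most D, where the operator is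
close to the identity for μ near 1; the norms depend monotonically on the moduli of the
coefficients, so closeness of the diagonal entries to 1 is enough (`relDist_twist_le`). Taking μ =
q'/q and μ = q/q' compares the distances at q and q' for polynomials. Polynomials are dense and the
distance is 1-Lipschitz in its argument uniformly in q, which gives all of F.

On the side of bundles, quotient seminorms are always upper semicontinuous along the sections x ↦
u_x, since an element of 𝔪_x A becomes small in fibers near x. This yields the axioms of a locally
convex bundle (`IsTubeTopology.isLocallyConvexBundle`). For continuity of the bundle, the defining
seminorms are replaced by products φ · `norm i` with φ compactly supported (`cutoffNorms`). Both
families dominate each other: a continuous seminorm is controlled by some `p i` on an annulus, and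
its fiber seminorm vanishes off the annulus, as one sees from powers of a holomorphic function equal
to 1 at the given point and of modulus at most θ < 1 on the annulus.

The disk and the ball enter only through `IsSolidFamily`. -/

namespace QDef

noncomputable section

/-! ## Bundles given by sections and seminorms -/

section TubeTopology

variable {X : Type} {E : X → Type} [∀ x, AddCommGroup (E x)] [∀ x, Module ℂ (E x)]

/-- Every member of `𝒩₁` is bounded by a constant multiple of a member of `𝒩₂`. -/
def IsDominatedBy (𝒩₁ 𝒩₂ : Set (FibSeminorm E)) : Prop :=
  ∀ N₁ ∈ 𝒩₁, ∃ N₂ ∈ 𝒩₂, ∃ C : ℝ, 0 < C ∧ ∀ v : Tot E, N₁.fn v ≤ C * N₂.fn v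

theorem uniformStructureOf_mono {𝒩₁ 𝒩₂ : Set (FibSeminorm E)} (h : IsDominatedBy 𝒩₁ 𝒩₂) :
    uniformStructureOf 𝒩₁ ⊆ uniformStructureOf 𝒩₂ := by
  rintro S ⟨hS, N, hN, ε, hε, hsub⟩
  obtain ⟨N', hN', C, hC, hle⟩ := h N hN
  refine ⟨hS, N', hN', ε / C, div_pos hε hC, fun v hv => hsub ?_⟩
  have hv' : N'.fn v < ε / C := hv
  exact (hle v).trans_lt (by rwa [lt_div_iff₀' hC] at hv')

theorem isAbsConvex_ball (N : FibSeminorm E) (ε : ℝ) : IsAbsConvex {v : Tot E | N.fn v < ε} := by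
  intro x
  have h : slice {v : Tot E | N.fn v < ε} x = (N x).ball 0 ε := by
    ext v
    simp [slice, FibSeminorm.fn, Seminorm.mem_ball]
  rw [h]
  exact ⟨(N x).balanced_ball_zero ε, (N x).convex_ball 0 ε⟩

open scoped Pointwise in
theorem isUniformVectorStructure_uniformStructureOf {𝒩 : Set (FibSeminorm E)}
    (hne : 𝒩.Nonempty) (hdir : IsDirectedFamily 𝒩) :
    IsUniformVectorStructure (uniformStructureOf 𝒩) where
  nonempty := by
    obtain ⟨N, hN⟩ := hne
    exact ⟨_, isAbsConvex_ball N 1, N, hN, 1, one_pos, subset_rfl⟩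
  absorbing := by
    rintro S ⟨-, N, hN, ε, hε, hsub⟩ x
    refine ((N x).absorbent_ball_zero hε).mono fun v hv => hsub ?_
    simpa [FibSeminorm.fn, Seminorm.mem_ball] using hv
  absConvex S hS := hS.1
  smul_mem := by
    rintro S ⟨hS, N, hN, ε, hε, hsub⟩ c hc
    refine ⟨fun x => ?_, N, hN, ‖c‖ * ε, by positivity, fun v hv => ?_⟩
    · have h : slice ((fun v : Tot E => (⟨v.proj, c • v.snd⟩ : Tot E)) '' S) x =
          c • slice S x := by
        ext v
        simp only [slice, Set.mem_image, Set.mem_ofPred_eq, Set.mem_smul_set]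
        constructor
        · rintro ⟨⟨y, w⟩, hw, h⟩
          cases h
          exact ⟨w, hw, rfl⟩
        · rintro ⟨w, hw, rfl⟩
          exact ⟨⟨x, w⟩, hw, rfl⟩
      rw [h]
      refine ⟨(hS x).1.smul c, ?_⟩
      rw [← Set.image_smul]
      exact (hS x).2.is_linear_image ⟨fun a b => smul_add c a b, fun a b => smul_comm c a b⟩
    · refine ⟨⟨v.proj, c⁻¹ • v.snd⟩, hsub ?_, ?_⟩
      · have hv' : N v.proj v.snd < ‖c‖ * ε := hv
        change N v.proj (c⁻¹ • v.snd) < ε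
        rw [map_smul_eq_mul, norm_inv, inv_mul_lt_iff₀ (norm_pos_iff.2 hc)]
        exact hv'
      · simp [smul_smul, hc]
  inter_mem := by
    rintro S ⟨hS, N₁, hN₁, ε₁, hε₁, hsub₁⟩ T ⟨hT, N₂, hN₂, ε₂, hε₂, hsub₂⟩
    obtain ⟨N, hN, C, hC, hle⟩ := hdir N₁ hN₁ N₂ hN₂
    refine ⟨fun x => ⟨(hS x).1.inter (hT x).1, (hS x).2.inter (hT x).2⟩, N, hN,
      min ε₁ ε₂ / C, div_pos (lt_min hε₁ hε₂) hC, fun v hv => ?_⟩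
    have hv' : N.fn v < min ε₁ ε₂ / C := hv
    rw [lt_div_iff₀' hC] at hv'
    exact ⟨hsub₁ ((hle v).1.trans_lt (hv'.trans_le (min_le_left _ _))),
      hsub₂ ((hle v).2.trans_lt (hv'.trans_le (min_le_right _ _)))⟩
  mem_of_superset := by
    rintro S ⟨hS, N, hN, ε, hε, hsub⟩ T hST hT
    exact ⟨hT, N, hN, ε, hε, hsub.trans hST⟩

theorem mul_subset_of_seminorms {E : X → Type} [∀ x, Ring (E x)] [∀ x, Algebra ℂ (E x)]
    {𝒩 : Set (FibSeminorm E)}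
    (hmul : ∀ N ∈ 𝒩, ∃ N' ∈ 𝒩, ∀ (x : X) (a b : E x), N x (a * b) ≤ N' x a * N' x b) :
    ∀ S ∈ uniformStructureOf 𝒩, ∃ T ∈ uniformStructureOf 𝒩, ∀ (x : X), ∀ u ∈ slice T x,
      ∀ v ∈ slice T x, u * v ∈ slice S x := by
  rintro S ⟨-, N, hN, ε, hε, hsub⟩
  obtain ⟨N', hN', hle⟩ := hmul N hN
  -- With this radius one factor has size below 1 and the other below ε.
  have hδ : 0 < min 1 ε := lt_min one_pos hε
  refine ⟨_, ⟨isAbsConvex_ball N' (min 1 ε), N', hN', _, hδ, subset_rfl⟩, fun x u hu v hv =>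
    hsub ((hle x u v).trans_lt ?_)⟩
  change N' x u < min 1 ε at hu
  change N' x v < min 1 ε at hv
  calc N' x u * N' x v ≤ 1 * N' x v := by
        gcongr
        exact (hu.trans_le (min_le_left _ _)).le
    _ < ε := by
        rw [one_mul]
        exact hv.trans_le (min_le_right _ _)

omit [∀ x, Module ℂ (E x)] in
theorem translate_eq_setOf {V : Set X} {s : ∀ x, E x} {S : Set (Tot E)} :
    translate V s S = {v : Tot E | v.proj ∈ V ∧ (⟨v.proj, v.snd - s v.proj⟩ : Tot E) ∈ S} := by
  ext ⟨x, v⟩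
  constructor
  · rintro ⟨y, hy, u, hu, heq⟩
    cases heq
    refine ⟨hy, ?_⟩
    change (⟨x, s x + u - s x⟩ : Tot E) ∈ S
    rwa [add_sub_cancel_left]
  · rintro ⟨hx, hv⟩
    exact ⟨x, hx, v - s x, hv, by simp⟩

variable [TopologicalSpace X] [tE : TopologicalSpace (Tot E)]

/-- The topology of the total space is generated by the tubes around the sections in `Γ`, where
`Γ` has a section through every point and `𝒩` is a directed family of seminorms that are upper
semicontinuous along the sections in `Γ`. -/
structure IsTubeTopology (Γ : Submodule ℂ (∀ x, E x)) (𝒩 : Set (FibSeminorm E)) : Prop where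
  exists_section : ∀ x (v : E x), ∃ s ∈ Γ, s x = v
  nonempty : 𝒩.Nonempty
  directed : IsDirectedFamily 𝒩
  usc : ∀ N ∈ 𝒩, ∀ s ∈ Γ, UpperSemicontinuous fun x => N x (s x)
  eq_generateFrom : tE = TopologicalSpace.generateFrom
    {W | ∃ (V : Set X) (s : ∀ x, E x) (N : FibSeminorm E) (ε : ℝ), IsOpen V ∧ s ∈ Γ ∧ N ∈ 𝒩 ∧
      0 < ε ∧ W = tube V s N ε}

namespace IsTubeTopology

variable {Γ : Submodule ℂ (∀ x, E x)} {𝒩 : Set (FibSeminorm E)} (h : IsTubeTopology Γ 𝒩)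
include h

theorem isOpen_tube {V : Set X} {s : ∀ x, E x} {N : FibSeminorm E} {ε : ℝ} (hV : IsOpen V)
    (hs : s ∈ Γ) (hN : N ∈ 𝒩) (hε : 0 < ε) : IsOpen (tube V s N ε) := by
  rw [h.eq_generateFrom]
  exact TopologicalSpace.isOpen_generateFrom_of_mem ⟨V, s, N, ε, hV, hs, hN, hε, rfl⟩

/-- Upper semicontinuity keeps N(s - s') below an intermediate value c near x, so an s-tube of
radius ε - c stays inside the s'-tube. Hence the tubes around any one section through a point
suffice to describe its neighborhoods. -/
theorem exists_tube_subset {x : X} {s s' : ∀ x, E x} (hs : s ∈ Γ) (hs' : s' ∈ Γ)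
    {N : FibSeminorm E} (hN : N ∈ 𝒩) {V : Set X} (hV : IsOpen V) {ε : ℝ}
    (hx : (⟨x, s x⟩ : Tot E) ∈ tube V s' N ε) :
    ∃ V', IsOpen V' ∧ x ∈ V' ∧ ∃ δ : ℝ, 0 < δ ∧ tube V' s N δ ⊆ tube V s' N ε := by
  obtain ⟨hxV, hlt⟩ := hx
  change N x (s x - s' x) < ε at hlt
  obtain ⟨c, hc, hcε⟩ := exists_between hlt
  have husc := h.usc N hN (s - s') (Γ.sub_mem hs hs')
  refine ⟨V ∩ {y | N y ((s - s') y) < c}, hV.inter (husc.isOpen_preimage c), ⟨hxV, hc⟩, ε - c,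
    sub_pos.2 hcε, ?_⟩
  rintro ⟨y, v⟩ ⟨⟨hyV, hy⟩, hv⟩
  refine ⟨hyV, ?_⟩
  change N y (v - s y) < _ at hv
  change N y (s y - s' y) < c at hy
  change N y (v - s' y) < ε
  calc N y (v - s' y) = N y ((v - s y) + (s y - s' y)) := by rw [sub_add_sub_cancel]
    _ ≤ N y (v - s y) + N y (s y - s' y) := map_add_le_add _ _ _
    _ < ε := by linarith

theorem isTopologicalBasis : TopologicalSpace.IsTopologicalBasis
    {W : Set (Tot E) | ∃ (V : Set X) (s : ∀ x, E x) (N : FibSeminorm E) (ε : ℝ), IsOpen V ∧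
      s ∈ Γ ∧ N ∈ 𝒩 ∧ 0 < ε ∧ W = tube V s N ε} where
  eq_generateFrom := h.eq_generateFrom
  sUnion_eq := by
    obtain ⟨N, hN⟩ := h.nonempty
    refine Set.eq_univ_of_forall fun v => ?_
    obtain ⟨s, hs, hsv⟩ := h.exists_section v.proj v.snd
    refine ⟨_, ⟨Set.univ, s, N, 1, isOpen_univ, hs, hN, one_pos, rfl⟩, trivial, ?_⟩
    simp [hsv]
  exists_subset_inter := by
    rintro _ ⟨V₁, s₁, N₁, ε₁, hV₁, hs₁, hN₁, hε₁, rfl⟩ _ ⟨V₂, s₂, N₂, ε₂, hV₂, hs₂, hN₂, hε₂, rfl⟩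
      ⟨x, v⟩ ⟨hv₁, hv₂⟩
    obtain ⟨s, hs, rfl⟩ := h.exists_section x v
    obtain ⟨W₁, hW₁, hxW₁, δ₁, hδ₁, hsub₁⟩ := h.exists_tube_subset hs hs₁ hN₁ hV₁ hv₁
    obtain ⟨W₂, hW₂, hxW₂, δ₂, hδ₂, hsub₂⟩ := h.exists_tube_subset hs hs₂ hN₂ hV₂ hv₂
    obtain ⟨N, hN, C, hC, hle⟩ := h.directed N₁ hN₁ N₂ hN₂
    have hpos : 0 < min δ₁ δ₂ / C := div_pos (lt_min hδ₁ hδ₂) hC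
    refine ⟨_, ⟨W₁ ∩ W₂, s, N, min δ₁ δ₂ / C, hW₁.inter hW₂, hs, hN, hpos, rfl⟩,
      ⟨⟨hxW₁, hxW₂⟩, by simpa using hpos⟩, ?_⟩
    rintro ⟨y, w⟩ ⟨⟨hy₁, hy₂⟩, hw⟩
    rw [lt_div_iff₀' hC] at hw
    have hle' := hle ⟨y, w - s y⟩
    exact ⟨hsub₁ ⟨hy₁, hle'.1.trans_lt (hw.trans_le (min_le_left _ _))⟩,
      hsub₂ ⟨hy₂, hle'.2.trans_lt (hw.trans_le (min_le_right _ _))⟩⟩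

theorem mem_nhds_iff {x : X} {s : ∀ x, E x} (hs : s ∈ Γ) {W : Set (Tot E)} :
    W ∈ 𝓝 (⟨x, s x⟩ : Tot E) ↔ ∃ V, IsOpen V ∧ x ∈ V ∧ ∃ N ∈ 𝒩, ∃ ε : ℝ, 0 < ε ∧
      tube V s N ε ⊆ W := by
  rw [h.isTopologicalBasis.mem_nhds_iff]
  constructor
  · rintro ⟨_, ⟨V, s', N, ε, hV, hs', hN, hε, rfl⟩, hx, hsub⟩
    obtain ⟨V', hV', hxV', δ, hδ, hsub'⟩ := h.exists_tube_subset hs hs' hN hV hx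
    exact ⟨V', hV', hxV', N, hN, δ, hδ, hsub'.trans hsub⟩
  · rintro ⟨V, hV, hxV, N, hN, ε, hε, hsub⟩
    exact ⟨_, ⟨V, s, N, ε, hV, hs, hN, hε, rfl⟩, ⟨hxV, by simpa using hε⟩, hsub⟩

theorem tube_mem_nhds {x : X} {s : ∀ x, E x} (hs : s ∈ Γ) {V : Set X} (hV : IsOpen V)
    (hx : x ∈ V) {N : FibSeminorm E} (hN : N ∈ 𝒩) {ε : ℝ} (hε : 0 < ε) :
    tube V s N ε ∈ 𝓝 (⟨x, s x⟩ : Tot E) :=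
  (h.mem_nhds_iff hs).2 ⟨V, hV, hx, N, hN, ε, hε, subset_rfl⟩

theorem continuous_section {s : ∀ x, E x} (hs : s ∈ Γ) :
    Continuous fun x => (⟨x, s x⟩ : Tot E) := by
  refine continuous_iff_continuousAt.2 fun x W hW => ?_
  obtain ⟨V, hV, hxV, N, hN, ε, hε, hsub⟩ := (h.mem_nhds_iff hs).1 hW
  refine mem_map.2 ?_
  filter_upwards [hV.mem_nhds hxV] with y hy
  exact hsub ⟨hy, by simpa using hε⟩

theorem continuous_proj : Continuous fun v : Tot E => v.proj := by
  refine continuous_iff_continuousAt.2 fun ⟨x, v⟩ W hW => ?_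
  obtain ⟨s, hs, rfl⟩ := h.exists_section x v
  obtain ⟨V, hVW, hV, hxV⟩ := _root_.mem_nhds_iff.1 hW
  obtain ⟨N, hN⟩ := h.nonempty
  refine mem_map.2 ?_
  filter_upwards [h.tube_mem_nhds hs hV hxV hN one_pos] with w hw
  exact hVW hw.1

theorem isOpenMap_proj : IsOpenMap fun v : Tot E => v.proj := by
  refine h.isTopologicalBasis.isOpenMap_iff.2 ?_
  rintro _ ⟨V, s, N, ε, hV, hs, hN, hε, rfl⟩
  convert hV
  ext x
  constructor
  · rintro ⟨v, hv, rfl⟩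
    exact hv.1
  · intro hx
    exact ⟨⟨x, s x⟩, ⟨hx, by simpa using hε⟩, rfl⟩

/-- Needed to subtract a continuous local section in `isOpen_setOf_sub_mem`. -/
theorem continuous_sub : @Continuous _ _ (fibProdTopology E) inferInstance
    fun q : Tot (fun x => E x × E x) => (⟨q.proj, q.snd.1 - q.snd.2⟩ : Tot E) := by
  let _ := fibProdTopology E
  refine continuous_iff_continuousAt.2 fun ⟨x, v, w⟩ W hW => ?_
  obtain ⟨s, hs, rfl⟩ := h.exists_section x v
  obtain ⟨t, ht, rfl⟩ := h.exists_section x w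
  obtain ⟨V, hV, hxV, N, hN, ε, hε, hsub⟩ := (h.mem_nhds_iff (Γ.sub_mem hs ht)).1 hW
  change _ ∈ 𝓝 _
  rw [nhds_induced]
  refine ⟨_, prod_mem_nhds (h.tube_mem_nhds hs hV hxV hN (half_pos hε))
    (h.tube_mem_nhds ht hV hxV hN (half_pos hε)), ?_⟩
  rintro ⟨y, a, b⟩ ⟨⟨hy, ha⟩, -, hb⟩
  refine hsub ⟨hy, ?_⟩
  change N y (a - s y) < ε / 2 at ha
  change N y (b - t y) < ε / 2 at hb
  change N y (a - b - (s y - t y)) < ε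
  rw [sub_sub_sub_comm]
  exact (map_sub_le_add _ _ _).trans_lt (by linarith)

theorem continuous_add : @Continuous _ _ (fibProdTopology E) inferInstance
    fun q : Tot (fun x => E x × E x) => (⟨q.proj, q.snd.1 + q.snd.2⟩ : Tot E) := by
  let _ := fibProdTopology E
  refine continuous_iff_continuousAt.2 fun ⟨x, v, w⟩ W hW => ?_
  obtain ⟨s, hs, rfl⟩ := h.exists_section x v
  obtain ⟨t, ht, rfl⟩ := h.exists_section x w
  obtain ⟨V, hV, hxV, N, hN, ε, hε, hsub⟩ := (h.mem_nhds_iff (Γ.add_mem hs ht)).1 hW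
  change _ ∈ 𝓝 _
  rw [nhds_induced]
  refine ⟨_, prod_mem_nhds (h.tube_mem_nhds hs hV hxV hN (half_pos hε))
    (h.tube_mem_nhds ht hV hxV hN (half_pos hε)), ?_⟩
  rintro ⟨y, a, b⟩ ⟨⟨hy, ha⟩, -, hb⟩
  refine hsub ⟨hy, ?_⟩
  change N y (a - s y) < ε / 2 at ha
  change N y (b - t y) < ε / 2 at hb
  change N y (a + b - (s y + t y)) < ε
  rw [add_sub_add_comm]
  exact (map_add_le_add _ _ _).trans_lt (by linarith)

theorem continuous_smul :
    Continuous fun q : ℂ × Tot E => (⟨q.2.proj, q.1 • q.2.snd⟩ : Tot E) := by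
  refine continuous_iff_continuousAt.2 fun ⟨c, x, v⟩ W hW => ?_
  obtain ⟨s, hs, rfl⟩ := h.exists_section x v
  obtain ⟨V, hV, hxV, N, hN, ε, hε, hsub⟩ := (h.mem_nhds_iff (Γ.smul_mem c hs)).1 hW
  -- By upper semicontinuity M bounds N(s) near x. It controls the second term of d•a - c•s = d•(a -
  -- s) + (d - c)•s.
  set M := N x (s x) + 1 with hM
  have hMpos : 0 < M := add_pos_of_nonneg_of_pos (apply_nonneg _ _) one_pos
  have hc1 : 0 < ‖c‖ + 1 := add_pos_of_nonneg_of_pos (norm_nonneg _) one_pos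
  have hopen := (h.usc N hN s hs).isOpen_preimage M
  have hxM : x ∈ (fun x => N x (s x)) ⁻¹' Set.Iio M := by simp [hM]
  have hball : Metric.ball c (min 1 (ε / 2 / M)) ∈ 𝓝 c :=
    Metric.ball_mem_nhds _ (lt_min one_pos (by positivity))
  change _ ∈ 𝓝 _
  refine mem_of_superset (prod_mem_nhds hball (h.tube_mem_nhds hs (hV.inter hopen)
    ⟨hxV, hxM⟩ hN (ε := ε / 2 / (‖c‖ + 1)) (by positivity))) ?_
  rintro ⟨d, y, a⟩ ⟨hd, ⟨hy, hyM⟩, ha⟩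
  refine hsub ⟨hy, ?_⟩
  rw [Metric.mem_ball, dist_eq_norm, lt_min_iff] at hd
  change N y (a - s y) < _ at ha
  change N y (s y) < M at hyM
  change N y (d • a - c • s y) < ε
  have hd' : ‖d‖ ≤ ‖c‖ + 1 := by
    have := norm_le_norm_add_norm_sub' d c
    linarith [hd.1]
  calc N y (d • a - c • s y) = N y (d • (a - s y) + (d - c) • s y) := by
        rw [smul_sub, sub_smul]; congr 1; abel
    _ ≤ N y (d • (a - s y)) + N y ((d - c) • s y) := map_add_le_add _ _ _
    _ = ‖d‖ * N y (a - s y) + ‖d - c‖ * N y (s y) := by rw [map_smul_eq_mul, map_smul_eq_mul]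
    _ < ε / 2 + ε / 2 := by
        refine add_lt_add_of_lt_of_le ?_ ?_
        · rw [lt_div_iff₀' hc1] at ha
          exact (mul_le_mul_of_nonneg_right hd' (apply_nonneg _ _)).trans_lt ha
        · have := hd.2.le
          rw [le_div_iff₀ hMpos] at this
          exact (mul_le_mul_of_nonneg_left hyM.le (norm_nonneg _)).trans this
    _ = ε := add_halves ε

theorem isPrebundle : IsPrebundle E where
  continuous_proj := h.continuous_proj
  isOpenMap_proj := h.isOpenMap_proj
  continuous_zero := h.continuous_section Γ.zero_mem
  continuous_add := h.continuous_add
  continuous_smul := h.continuous_smul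

theorem isOpen_ball {N : FibSeminorm E} (hN : N ∈ 𝒩) {ε : ℝ} (hε : 0 < ε) :
    IsOpen {v : Tot E | N.fn v < ε} := by
  convert h.isOpen_tube isOpen_univ Γ.zero_mem hN hε using 1
  ext v
  simp [tube, FibSeminorm.fn]

/-- Translates of open sets by continuous local sections are open. -/
theorem isOpen_setOf_sub_mem {V : Set X} {s : ∀ x, E x} (hV : IsOpen V) (hs : IsContSection V s)
    {S : Set (Tot E)} (hS : IsOpen S) :
    IsOpen {v : Tot E | v.proj ∈ V ∧ (⟨v.proj, v.snd - s v.proj⟩ : Tot E) ∈ S} := by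
  let _ := fibProdTopology E
  have hVo : IsOpen ((fun v : Tot E => v.proj) ⁻¹' V) := hV.preimage h.continuous_proj
  -- The set in question is the preimage of S under v ↦ v - s(p v), which is continuous over V.
  have hg : ContinuousOn (fun v : Tot E =>
      (⟨v.proj, v.snd, s v.proj⟩ : Tot fun x => E x × E x)) ((fun v : Tot E => v.proj) ⁻¹' V) := by
    refine (Topology.IsInducing.mk rfl :
      IsInducing (fun q : Tot (fun x => E x × E x) =>
        ((⟨q.proj, q.snd.1⟩, ⟨q.proj, q.snd.2⟩) : Tot E × Tot E))).continuousOn_iff.2 ?_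
    exact continuousOn_id.prodMk (hs.comp h.continuous_proj.continuousOn fun v hv => hv)
  exact (h.continuous_sub.comp_continuousOn hg).isOpen_inter_preimage hVo hS

theorem isLocallyConvexBundle : IsLocallyConvexBundle (uniformStructureOf 𝒩) where
  prebundle := h.isPrebundle
  uniform := isUniformVectorStructure_uniformStructureOf h.nonempty h.directed
  exists_open := by
    rintro S ⟨hS, N, hN, ε, hε, hsub⟩
    exact ⟨_, ⟨isAbsConvex_ball N ε, N, hN, ε, hε, subset_rfl⟩, hsub, h.isOpen_ball hN hε⟩
  basis := by
    refine TopologicalSpace.isTopologicalBasis_of_isOpen_of_nhds ?_ ?_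
    · rintro _ ⟨V, s, S, hV, hs, -, hSo, rfl⟩
      rw [translate_eq_setOf]
      exact h.isOpen_setOf_sub_mem hV hs hSo
    · rintro ⟨x, v⟩ W hx hW
      obtain ⟨s, hs, rfl⟩ := h.exists_section x v
      obtain ⟨V, hV, hxV, N, hN, ε, hε, hsub⟩ := (h.mem_nhds_iff hs).1 (hW.mem_nhds hx)
      refine ⟨_, ⟨V, s, {v | N.fn v < ε}, hV, (h.continuous_section hs).continuousOn,
        ⟨isAbsConvex_ball N ε, N, hN, ε, hε, subset_rfl⟩, h.isOpen_ball hN hε, rfl⟩, ?_, ?_⟩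
      · rw [translate_eq_setOf]
        exact ⟨hxV, by simpa [FibSeminorm.fn] using hε⟩
      · rw [translate_eq_setOf]
        exact hsub
  dense x := by
    let _ := TopologicalSpace.induced (fun v => (⟨x, v⟩ : Tot E)) inferInstance
    refine dense_iff_closure_eq.2 (Set.eq_univ_of_forall fun v => subset_closure ?_)
    obtain ⟨s, hs, hsv⟩ := h.exists_section x v
    exact ⟨Set.univ, s, isOpen_univ, trivial, (h.continuous_section hs).continuousOn, hsv⟩

/-- A seminorm dominated by a member of `𝒩` and continuous along the sections in `Γ` is a
continuous function on the total space. -/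
theorem continuous_fn {N N' : FibSeminorm E} (hN : N ∈ 𝒩) {C : ℝ} (hC : 0 < C)
    (hle : ∀ v : Tot E, N'.fn v ≤ C * N.fn v)
    (hcont : ∀ s ∈ Γ, Continuous fun x => N' x (s x)) : Continuous N'.fn := by
  refine continuous_iff_continuousAt.2 fun ⟨x, v⟩ => ?_
  obtain ⟨s, hs, rfl⟩ := h.exists_section x v
  refine Metric.tendsto_nhds.2 fun ε hε => ?_
  -- The difference is split at N'(s y): moving along the section is covered by `hcont`, moving
  -- inside the fiber costs at most N'(w - s y) ≤ C N(w - s y).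
  have h1 : ∀ᶠ y in 𝓝 x, dist (N' y (s y)) (N' x (s x)) < ε / 2 :=
    Metric.tendsto_nhds.1 ((hcont s hs).tendsto x) _ (half_pos hε)
  obtain ⟨V, hV, hVo, hxV⟩ := eventually_nhds_iff.1 h1
  filter_upwards [h.tube_mem_nhds hs hVo hxV hN (ε := ε / 2 / C) (by positivity)]
  rintro ⟨y, w⟩ ⟨hy, hw⟩
  rw [lt_div_iff₀' hC] at hw
  have h2 := (hle ⟨y, w - s y⟩).trans_lt hw
  change N' y (w - s y) < _ at h2
  have h3 : |N' y w - N' y (s y)| ≤ N' y (w - s y) := abs_sub_map_le_sub _ _ _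
  calc dist (N' y w) (N' x (s x)) ≤ dist (N' y w) (N' y (s y)) + dist (N' y (s y)) (N' x (s x)) :=
        dist_triangle _ _ _
    _ < ε / 2 + ε / 2 := add_lt_add (h3.trans_lt h2) (hV y hy)
    _ = ε := add_halves ε

/-- Tubes of `𝒩'` around any continuous section are open because the seminorms are continuous
functions. They are fine enough because `𝒩'` dominates `𝒩`. -/
theorem isAdmissible {𝒩' : Set (FibSeminorm E)} (h₁ : IsDominatedBy 𝒩 𝒩')
    (hcont : ∀ N ∈ 𝒩', Continuous N.fn) : IsAdmissible 𝒩' where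
  basis := by
    refine TopologicalSpace.isTopologicalBasis_of_isOpen_of_nhds ?_ ?_
    · rintro _ ⟨V, s, N, ε, hV, hs, hN, -, rfl⟩
      exact h.isOpen_setOf_sub_mem hV hs ((isOpen_Iio (a := ε)).preimage (hcont N hN))
    · rintro ⟨x, v⟩ W hx hW
      obtain ⟨s, hs, rfl⟩ := h.exists_section x v
      obtain ⟨V, hV, hxV, N, hN, ε, hε, hsub⟩ := (h.mem_nhds_iff hs).1 (hW.mem_nhds hx)
      obtain ⟨N', hN', C, hC, hle⟩ := h₁ N hN
      have hpos : 0 < ε / C := div_pos hε hC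
      refine ⟨_, ⟨V, s, N', ε / C, hV, (h.continuous_section hs).continuousOn, hN', hpos, rfl⟩,
        ⟨hxV, by simpa using hpos⟩, ?_⟩
      rintro ⟨y, w⟩ ⟨hy, hw⟩
      rw [lt_div_iff₀' hC] at hw
      exact hsub ⟨hy, (hle ⟨y, w - s y⟩).trans_lt hw⟩
  dense := by
    intro x v N hN ε hε
    obtain ⟨s, hs, hsv⟩ := h.exists_section x v
    refine ⟨Set.univ, s, isOpen_univ, trivial, (h.continuous_section hs).continuousOn, ?_⟩
    rwa [hsv, sub_self, map_zero]

theorem mem_nhds_induced_iff {x : X} {v : E x} {W : Set (E x)} :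
    W ∈ @nhds _ (TopologicalSpace.induced (fun v => (⟨x, v⟩ : Tot E)) inferInstance) v ↔
      ∃ N ∈ 𝒩, ∃ ε : ℝ, 0 < ε ∧ (N x).ball v ε ⊆ W := by
  obtain ⟨s, hs, rfl⟩ := h.exists_section x v
  rw [nhds_induced, mem_comap]
  constructor
  · rintro ⟨T, hT, hTW⟩
    obtain ⟨V, hV, hxV, N, hN, ε, hε, hsub⟩ := (h.mem_nhds_iff hs).1 hT
    exact ⟨N, hN, ε, hε, fun w hw => hTW (hsub ⟨hxV, (N x).mem_ball.1 hw⟩)⟩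
  · rintro ⟨N, hN, ε, hε, hsub⟩
    exact ⟨_, h.tube_mem_nhds hs isOpen_univ trivial hN hε,
      fun w hw => hsub ((N x).mem_ball.2 hw.2)⟩

end IsTubeTopology

theorem IsTubeTopology.continuous_mul {E : X → Type} [∀ x, Ring (E x)] [∀ x, Algebra ℂ (E x)]
    [TopologicalSpace (Tot E)] {Γ : Submodule ℂ (∀ x, E x)} {𝒩 : Set (FibSeminorm E)}
    (h : IsTubeTopology Γ 𝒩) (hΓ : ∀ s ∈ Γ, ∀ t ∈ Γ, s * t ∈ Γ)
    (hmul : ∀ N ∈ 𝒩, ∃ N' ∈ 𝒩, ∀ (x : X) (a b : E x), N x (a * b) ≤ N' x a * N' x b) :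
    @Continuous _ _ (fibProdTopology E) inferInstance
      fun q : Tot (fun x => E x × E x) => (⟨q.proj, q.snd.1 * q.snd.2⟩ : Tot E) := by
  let _ := fibProdTopology E
  refine continuous_iff_continuousAt.2 fun ⟨x, v, w⟩ W hW => ?_
  obtain ⟨s, hs, rfl⟩ := h.exists_section x v
  obtain ⟨t, ht, rfl⟩ := h.exists_section x w
  obtain ⟨V, hV, hxV, N, hN, ε, hε, hsub⟩ := (h.mem_nhds_iff (hΓ s hs t ht)).1 hW
  obtain ⟨N', hN', hle⟩ := hmul N hN
  -- M bounds both sections near x, and then N'(b) ≤ M + 1 on the tube. These are the bounds needed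
  -- in ab - st = (a - s)b + s(b - t).
  set M := max (N' x (s x)) (N' x (t x)) + 1 with hM
  have hMpos : 0 < M := add_pos_of_nonneg_of_pos (le_max_of_le_left (apply_nonneg _ _)) one_pos
  have hos := (h.usc N' hN' s hs).isOpen_preimage M
  have hot := (h.usc N' hN' t ht).isOpen_preimage M
  have hxs : x ∈ (fun x => N' x (s x)) ⁻¹' Set.Iio M :=
    show N' x (s x) < M by linarith [le_max_left (N' x (s x)) (N' x (t x))]
  have hxt : x ∈ (fun x => N' x (t x)) ⁻¹' Set.Iio M :=
    show N' x (t x) < M by linarith [le_max_right (N' x (s x)) (N' x (t x))]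
  have hδ : 0 < min 1 (ε / 2 / (M + 1)) := lt_min one_pos (by positivity)
  change _ ∈ 𝓝 _
  rw [nhds_induced]
  refine ⟨_, prod_mem_nhds
    (h.tube_mem_nhds hs (hV.inter (hos.inter hot)) ⟨hxV, hxs, hxt⟩ hN' hδ)
    (h.tube_mem_nhds ht (hV.inter (hos.inter hot)) ⟨hxV, hxs, hxt⟩ hN' hδ), ?_⟩
  rintro ⟨y, a, b⟩ ⟨⟨⟨hy, hys, hyt⟩, ha⟩, -, hb⟩
  refine hsub ⟨hy, ?_⟩
  change N' y (a - s y) < _ at ha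
  change N' y (b - t y) < _ at hb
  change N' y (s y) < M at hys
  change N' y (t y) < M at hyt
  change N y (a * b - s y * t y) < ε
  rw [lt_min_iff] at ha hb
  rw [lt_div_iff₀ (by positivity)] at ha hb
  have hb' : N' y b ≤ M + 1 := by
    calc N' y b = N' y ((b - t y) + t y) := by rw [sub_add_cancel]
      _ ≤ _ := map_add_le_add _ _ _
      _ ≤ M + 1 := by linarith [hb.1]
  have e : a * b - s y * t y = (a - s y) * b + s y * (b - t y) := by
    rw [sub_mul, mul_sub]; abel
  calc N y (a * b - s y * t y) ≤ N y ((a - s y) * b) + N y (s y * (b - t y)) := by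
        rw [e]; exact map_add_le_add _ _ _
    _ ≤ N' y (a - s y) * N' y b + N' y (s y) * N' y (b - t y) := add_le_add (hle _ _ _) (hle _ _ _)
    _ ≤ N' y (a - s y) * (M + 1) + (M + 1) * N' y (b - t y) := by
        gcongr
        linarith
    _ < ε := by linarith [ha.2, hb.2]

end TubeTopology

/-! ## Monomials, truncation and twisting -/

namespace FreeSeries

variable {n : ℕ}

/-- The monomial `ζ_w`. -/
def monomial (w : List (Fin n)) : FreeSeries n := fun v => if v = w then 1 else 0

theorem monomial_apply (w v : List (Fin n)) :
    monomial w v = if v = w then (1 : ℂ) else 0 := rfl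

theorem monomial_nil : monomial ([] : List (Fin n)) = 1 := rfl

theorem monomial_singleton (i : Fin n) : monomial [i] = X i := rfl

theorem sub_apply (a b : FreeSeries n) (w : List (Fin n)) : (a - b) w = a w - b w := rfl

theorem X_mul_monomial (i : Fin n) (w : List (Fin n)) : X i * monomial w = monomial (i :: w) := by
  refine ext fun v => ?_
  cases v with
  | nil => simp [mul_nil, X, monomial_apply]
  | cons x v =>
    have h : shift x (X i) = if x = i then (1 : FreeSeries n) else 0 := by
      refine ext fun v => ?_
      split_ifs with hx
      · subst hx
        cases v <;> simp [shift, X, one_nil, one_cons]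
      · simp [shift, X, zero_apply, hx]
    rw [mul_cons, h]
    split_ifs with hx
    · subst hx
      simp [X, monomial_apply]
    · simp [X, monomial_apply, zero_apply, hx]

theorem monomial_mul (u v : List (Fin n)) : monomial u * monomial v = monomial (u ++ v) := by
  induction u with
  | nil => rw [monomial_nil, one_mul, List.nil_append]
  | cons x u ih =>
    rw [← X_mul_monomial, mul_assoc, ih, X_mul_monomial, List.cons_append]

/-- The part of degree at most `D`. -/
def trunc (D : ℕ) : FreeSeries n →ₗ[ℂ] FreeSeries n where
  toFun a w := if w.length ≤ D then a w else 0
  map_add' a b := ext fun w => by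
    change (if _ then a w + b w else 0) = (if _ then a w else 0) + (if _ then b w else 0)
    split_ifs <;> simp
  map_smul' c a := ext fun w => by
    change (if _ then c * a w else 0) = c * (if _ then a w else 0)
    split_ifs <;> simp

theorem trunc_apply (D : ℕ) (a : FreeSeries n) (w : List (Fin n)) :
    trunc D a w = if w.length ≤ D then a w else 0 := rfl

theorem trunc_trunc (D : ℕ) (a : FreeSeries n) : trunc D (trunc D a) = trunc D a :=
  ext fun w => by simp only [trunc_apply]; split_ifs <;> rfl

theorem trunc_monomial (D : ℕ) (w : List (Fin n)) :
    trunc D (monomial w) = if w.length ≤ D then monomial w else 0 := by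
  refine ext fun v => ?_
  rw [trunc_apply]
  by_cases h : v = w
  · subst h; split_ifs <;> rfl
  · have : monomial w v = 0 := if_neg h
    split_ifs <;> simp [this, zero_apply]

/-- The words of length at most `D`. -/
def wordsLE (n D : ℕ) : Finset (List (Fin n)) := (List.finite_length_le (Fin n) D).toFinset

theorem mem_wordsLE {D : ℕ} {w : List (Fin n)} : w ∈ wordsLE n D ↔ w.length ≤ D := by
  simp [wordsLE]

theorem sum_apply {α : Type} (s : Finset α) (f : α → FreeSeries n) (w : List (Fin n)) :
    (∑ x ∈ s, f x) w = ∑ x ∈ s, f x w := Finset.sum_apply (M := fun _ : List (Fin n) => ℂ) w s f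

theorem trunc_eq_sum (D : ℕ) (a : FreeSeries n) :
    trunc D a = ∑ w ∈ wordsLE n D, a w • monomial w := by
  refine ext fun v => ?_
  rw [trunc_apply, sum_apply]
  simp_rw [smul_apply, monomial_apply, mul_ite, mul_one, mul_zero]
  refine Eq.trans ?_ (Finset.sum_ite_eq (wordsLE n D) v fun x => (a x : ℂ)).symm
  simp only [mem_wordsLE]

/-- The number of pairs of positions `s < t` in a word with `w_s > w_t`. -/
def inversions : List (Fin n) → ℕ
  | [] => 0
  | x :: w => w.countP (· < x) + inversions w

/-- The exchange does not change the order of i and j relative to any other position, so only the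
pair (j, i) itself is new. -/
theorem inversions_swap (u v : List (Fin n)) {i j : Fin n} (hij : i < j) :
    inversions (u ++ j :: i :: v) = inversions (u ++ i :: j :: v) + 1 := by
  induction u with
  | nil =>
    simp only [List.nil_append, inversions, List.countP_cons, hij, not_lt.2 hij.le, decide_true,
      decide_false, if_true, Bool.false_eq_true, if_false]
    ring
  | cons x u ih =>
    simp only [List.cons_append, inversions, ih, List.countP_append, List.countP_cons]
    ring

/-- The diagonal operator `ζ_w ↦ μ ^ inversions w • ζ_w`. -/
def twist (μ : ℂ) : FreeSeries n →ₗ[ℂ] FreeSeries n where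
  toFun a w := μ ^ inversions w * a w
  map_add' a b := ext fun w => mul_add (μ ^ inversions w) (a w) (b w)
  map_smul' c a := ext fun w => mul_left_comm (μ ^ inversions w) c (a w)

theorem twist_apply (μ : ℂ) (a : FreeSeries n) (w : List (Fin n)) :
    twist μ a w = μ ^ inversions w * a w := rfl

theorem twist_monomial (μ : ℂ) (w : List (Fin n)) :
    twist μ (monomial w) = μ ^ inversions w • monomial w := by
  refine ext fun v => ?_
  rw [twist_apply, smul_apply, monomial_apply]
  split_ifs with h
  · rw [h]
  · simp

/-- The elements `ζ_u (ζ_i ζ_j - q ζ_j ζ_i) ζ_v` with `i < j`. -/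
def relators (n : ℕ) (q : ℂ) : Set (FreeSeries n) :=
  {g | ∃ (u v : List (Fin n)) (i j : Fin n), i < j ∧
    g = monomial (u ++ i :: j :: v) - q • monomial (u ++ j :: i :: v)}

/-- The ideal of the free algebra generated by the elements `ζ_i ζ_j - q ζ_j ζ_i` with `i < j`,
as a linear subspace. -/
def relSpan (n : ℕ) (q : ℂ) : Submodule ℂ (FreeSeries n) := Submodule.span ℂ (relators n q)

/-- The two words of a relator have equal length, so truncation keeps or kills the relator as a
whole. -/
theorem trunc_mem_relSpan (D : ℕ) {q : ℂ} {h : FreeSeries n} (hh : h ∈ relSpan n q) :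
    trunc D h ∈ relSpan n q := by
  suffices relSpan n q ≤ (relSpan n q).comap (trunc D) from this hh
  refine Submodule.span_le.2 ?_
  rintro _ ⟨u, v, i, j, hij, rfl⟩
  have hl : (u ++ j :: i :: v).length = (u ++ i :: j :: v).length := by simp
  simp only [SetLike.mem_coe, Submodule.mem_comap, map_sub, map_smul, trunc_monomial, hl]
  split_ifs
  · exact Submodule.subset_span ⟨u, v, i, j, hij, rfl⟩
  · simp

/-- The word with exchanged letters picks up one more factor μ than the other word, which turns the
parameter q into qμ. -/
theorem twist_mem_relSpan (μ : ℂ) {q : ℂ} {h : FreeSeries n} (hh : h ∈ relSpan n q) :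
    twist μ h ∈ relSpan n (q * μ) := by
  suffices relSpan n q ≤ (relSpan n (q * μ)).comap (twist μ) from this hh
  refine Submodule.span_le.2 ?_
  rintro _ ⟨u, v, i, j, hij, rfl⟩
  simp only [SetLike.mem_coe, Submodule.mem_comap, map_sub, map_smul, twist_monomial,
    inversions_swap u v hij]
  have : μ ^ inversions (u ++ i :: j :: v) • monomial (u ++ i :: j :: v) -
      q • μ ^ (inversions (u ++ i :: j :: v) + 1) • monomial (u ++ j :: i :: v) =
      μ ^ inversions (u ++ i :: j :: v) •
        (monomial (u ++ i :: j :: v) - (q * μ) • monomial (u ++ j :: i :: v)) := by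
    rw [smul_sub, smul_smul, smul_smul]
    congr 2
    ring
  rw [this]
  exact Submodule.smul_mem _ _ (Submodule.subset_span ⟨u, v, i, j, hij, rfl⟩)

theorem monomial_mul_mem_relSpan (w : List (Fin n)) {q : ℂ} {h : FreeSeries n}
    (hh : h ∈ relSpan n q) : monomial w * h ∈ relSpan n q := by
  suffices relSpan n q ≤ (relSpan n q).comap (LinearMap.mulLeft ℂ (monomial w)) from this hh
  refine Submodule.span_le.2 ?_
  rintro _ ⟨u, v, i, j, hij, rfl⟩
  simp only [SetLike.mem_coe, Submodule.mem_comap, LinearMap.mulLeft_apply, mul_sub,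
    mul_smul_comm, monomial_mul, ← List.append_assoc]
  exact Submodule.subset_span ⟨w ++ u, v, i, j, hij, rfl⟩

theorem mul_monomial_mem_relSpan (w : List (Fin n)) {q : ℂ} {h : FreeSeries n}
    (hh : h ∈ relSpan n q) : h * monomial w ∈ relSpan n q := by
  suffices relSpan n q ≤ (relSpan n q).comap (LinearMap.mulRight ℂ (monomial w)) from this hh
  refine Submodule.span_le.2 ?_
  rintro _ ⟨u, v, i, j, hij, rfl⟩
  simp only [SetLike.mem_coe, Submodule.mem_comap, LinearMap.mulRight_apply, sub_mul,
    smul_mul_assoc, monomial_mul, List.append_assoc, List.cons_append]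
  exact Submodule.subset_span ⟨u, v ++ w, i, j, hij, rfl⟩

theorem trunc_mul_mem_relSpan (D : ℕ) (a : FreeSeries n) {q : ℂ} {h : FreeSeries n}
    (hh : h ∈ relSpan n q) : trunc D a * h ∈ relSpan n q := by
  rw [trunc_eq_sum, Finset.sum_mul]
  refine Submodule.sum_mem _ fun w _ => ?_
  rw [smul_mul_assoc]
  exact Submodule.smul_mem _ _ (monomial_mul_mem_relSpan w hh)

theorem mul_trunc_mem_relSpan (D : ℕ) (a : FreeSeries n) {q : ℂ} {h : FreeSeries n}
    (hh : h ∈ relSpan n q) : h * trunc D a ∈ relSpan n q := by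
  rw [trunc_eq_sum, Finset.mul_sum]
  refine Submodule.sum_mem _ fun w _ => ?_
  rw [mul_smul_comm]
  exact Submodule.smul_mem _ _ (mul_monomial_mem_relSpan w hh)

end FreeSeries

open FreeSeries

/-! ## Solid families of norms on free series -/

/-- Conditions under which the finite part of a family of norms on the free series is a Fréchet
algebra of series that contains the polynomials as a dense subalgebra. -/
structure IsSolidFamily {n : ℕ} {ι : Type} (p : ι → ExtNorm (FreeSeries n)) : Prop where
  solid : ∀ i a b, (∀ w, ‖a w‖ ≤ ‖b w‖) → (p i).toFun a ≤ (p i).toFun b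
  coeff_le : ∀ i w, ∃ C : ℝ≥0, ∀ a, ‖a w‖ₑ ≤ C * (p i).toFun a
  -- With respect to coefficientwise convergence; this takes the place of Fatou's lemma in the proof
  -- of completeness.
  lsc : ∀ i, LowerSemicontinuous (α := List (Fin n) → ℂ) fun a => (p i).toFun a
  tail : ∀ i a, (p i).toFun a ≠ ∞ → Tendsto (fun D => (p i).toFun (a - trunc D a)) atTop (𝓝 0)
  X_ne_top : ∀ i j, (p i).toFun (X j) ≠ ∞
  -- Countably many norms suffice, whence first countability and metrizability.
  cofinal : ∃ s : ℕ → ι, (∀ l m, l ≤ m → ∀ a, (p (s l)).toFun a ≤ (p (s m)).toFun a) ∧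
    ∀ i, ∃ m, ∀ a, (p i).toFun a ≤ (p (s m)).toFun a

theorem withSeminorms_finitePart {R : Type} [Ring R] [Algebra ℂ R] {ι : Type}
    (p : ι → ExtNorm R) : WithSeminorms (finiteSeminorm p) :=
  (SeminormFamily.withSeminorms_iff_topologicalSpace_eq_iInf _).2 rfl

namespace IsSolidFamily

variable {n : ℕ} {ι : Type} {p : ι → ExtNorm (FreeSeries n)} (hp : IsSolidFamily p)
include hp

theorem monomial_mem (w : List (Fin n)) : monomial w ∈ finitePart p := by
  induction w with
  | nil => exact (finitePart p).one_mem
  | cons x w ih =>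
    rw [← X_mul_monomial]
    exact (finitePart p).mul_mem (fun i => hp.X_ne_top i x) ih

theorem trunc_mem (D : ℕ) (a : FreeSeries n) : trunc D a ∈ finitePart p := by
  rw [trunc_eq_sum]
  exact Subalgebra.sum_mem _ fun w _ => Subalgebra.smul_mem _ (hp.monomial_mem w) _

theorem relSpan_le (q : ℂ) : relSpan n q ≤ Subalgebra.toSubmodule (finitePart p) := by
  refine Submodule.span_le.2 ?_
  rintro _ ⟨u, v, i, j, -, rfl⟩
  exact Submodule.sub_mem _ (hp.monomial_mem _) (Submodule.smul_mem _ _ (hp.monomial_mem _))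

theorem seminorm_mono (i : ι) {a b : finitePart p} (h : ∀ w, ‖a.1 w‖ ≤ ‖b.1 w‖) :
    finiteSeminorm p i a ≤ finiteSeminorm p i b :=
  ENNReal.toReal_mono (b.2 i) (hp.solid i _ _ h)

/-- The truncations of an element of the finite part converge to it. -/
theorem tendsto_trunc (a : finitePart p) :
    Tendsto (fun D => (⟨trunc D a.1, hp.trunc_mem D a.1⟩ : finitePart p)) atTop (𝓝 a) := by
  refine ((withSeminorms_finitePart p).tendsto_nhds _ _).2 fun i ε hε => ?_
  have h := (ENNReal.tendsto_toReal ENNReal.zero_ne_top).comp (hp.tail i a.1 (a.2 i))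
  filter_upwards [h.eventually (gt_mem_nhds (by simpa using hε))] with D hD
  rw [map_sub_rev]
  exact hD

end IsSolidFamily

/-! ### The relations at q and the distance to them as a function of q -/

section RelationSpace

variable {n : ℕ} {ι : Type} (p : ι → ExtNorm (FreeSeries n))

/-- The linear span of the elements `ζ_u (ζ_i ζ_j - q ζ_j ζ_i) ζ_v` in the finite part. -/
def relSubmodule (q : ℂ) : Submodule ℂ (finitePart p) :=
  (relSpan n q).comap (finitePart p).val.toLinearMap

/-- The distance of `a` to the space of relations, for the `i`-th seminorm. -/
def relDist (i : ι) (q : ℂ) (a : finitePart p) : ℝ :=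
  ⨅ h : relSubmodule p q, finiteSeminorm p i (a + h)

theorem bddBelow_relDist (i : ι) (q : ℂ) (a : finitePart p) :
    BddBelow (Set.range fun h : relSubmodule p q => finiteSeminorm p i (a + h)) :=
  ⟨0, by rintro _ ⟨h, rfl⟩; exact apply_nonneg _ _⟩

theorem relDist_le {i : ι} {q : ℂ} (a : finitePart p) {h : finitePart p}
    (hh : h ∈ relSubmodule p q) : relDist p i q a ≤ finiteSeminorm p i (a + h) :=
  ciInf_le (bddBelow_relDist p i q a) ⟨h, hh⟩

theorem relDist_le_self (i : ι) (q : ℂ) (a : finitePart p) :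
    relDist p i q a ≤ finiteSeminorm p i a := by
  simpa using relDist_le p (i := i) (q := q) a (Submodule.zero_mem _)

/-- The Lipschitz constant 1 does not depend on q, so continuity in q passes from polynomials to
their limits. -/
theorem relDist_le_add (i : ι) (q : ℂ) (a b : finitePart p) :
    relDist p i q a ≤ relDist p i q b + finiteSeminorm p i (a - b) := by
  rw [← sub_le_iff_le_add]
  refine le_ciInf fun h => ?_
  rw [sub_le_iff_le_add]
  refine (relDist_le p a h.2).trans ?_
  have : a + h.1 = (b + h.1) + (a - b) := by abel
  rw [this]
  exact map_add_le_add _ _ _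

/-- Fibers are quotients by closed ideals; passing from the span to its closure does not change the
infimum. -/
theorem relDist_le_of_mem_closure {i : ι} {q : ℂ} (a : finitePart p) {h : finitePart p}
    (hh : h ∈ (relSubmodule p q).topologicalClosure) :
    relDist p i q a ≤ finiteSeminorm p i (a + h) := by
  have hc : Continuous fun h : finitePart p => finiteSeminorm p i (a + h) :=
    ((withSeminorms_finitePart p).continuous_seminorm i).comp (continuous_const.add continuous_id)
  exact (isClosed_le continuous_const hc).closure_subset_iff.2
    (fun h hh => relDist_le p a hh) hh

variable {p} (hp : IsSolidFamily p)
include hp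

/-- A polynomial factor preserves the span itself. A general factor is the limit of its truncations,
so the product lies only in the closure. -/
theorem mul_mem_closure_relSubmodule {q : ℂ} (a : finitePart p) {h : finitePart p}
    (hh : h ∈ (relSubmodule p q).topologicalClosure) :
    a * h ∈ (relSubmodule p q).topologicalClosure := by
  have key : ∀ h ∈ relSubmodule p q, a * h ∈ (relSubmodule p q).topologicalClosure := fun h hh =>
    mem_closure_of_tendsto ((hp.tendsto_trunc a).mul_const h)
      (Eventually.of_forall fun D => trunc_mul_mem_relSpan D a.1 hh)
  have := map_mem_closure (continuous_const_mul a) hh key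
  rwa [(Submodule.isClosed_topologicalClosure _).closure_eq] at this

theorem closure_relSubmodule_mul_mem {q : ℂ} (a : finitePart p) {h : finitePart p}
    (hh : h ∈ (relSubmodule p q).topologicalClosure) :
    h * a ∈ (relSubmodule p q).topologicalClosure := by
  have key : ∀ h ∈ relSubmodule p q, h * a ∈ (relSubmodule p q).topologicalClosure := fun h hh =>
    mem_closure_of_tendsto ((hp.tendsto_trunc a).const_mul h)
      (Eventually.of_forall fun D => mul_trunc_mem_relSpan D a.1 hh)
  have := map_mem_closure (continuous_mul_const a) hh key
  rwa [(Submodule.isClosed_topologicalClosure _).closure_eq] at this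

/-- If h is a relation at q, then k = twist(trunc h) is a relation at qμ, and a + k = twist(trunc(a
+ h)) + (a - twist a). Solidity of the norm bounds the first term by (1 + ε) times the norm of a + h
and the second by ε times the norm of a. -/
theorem relDist_twist_le (i : ι) {q μ : ℂ} {D : ℕ} {ε : ℝ} (hε : 0 ≤ ε)
    (hμ : ∀ w ∈ wordsLE n D, ‖μ ^ inversions w - 1‖ ≤ ε) {a : finitePart p}
    (ha : trunc D a.1 = a.1) :
    relDist p i (q * μ) a ≤ (1 + ε) * relDist p i q a + ε * finiteSeminorm p i a := by
  have h1 : 0 < 1 + ε := by linarith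
  rw [← sub_le_iff_le_add, ← div_le_iff₀' h1]
  refine le_ciInf fun h => ?_
  rw [div_le_iff₀' h1, sub_le_iff_le_add]
  have hmem := twist_mem_relSpan μ (trunc_mem_relSpan D h.2)
  set k : finitePart p := ⟨twist μ (trunc D h.1.1), hp.relSpan_le _ hmem⟩ with hk
  have hμ' : ∀ w : List (Fin n), w.length ≤ D → ‖μ ^ inversions w‖ ≤ 1 + ε := fun w hw => by
    have := norm_le_norm_add_norm_sub' (μ ^ inversions w) 1
    rw [norm_one] at this
    linarith [hμ w (mem_wordsLE.2 hw)]
  set T : finitePart p := ⟨trunc D (a + h : finitePart p).1, hp.trunc_mem _ _⟩ with hT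
  have hTmem : twist μ T.1 ∈ finitePart p := by
    have : twist μ T.1 = trunc D (twist μ T.1) := ext fun w => by
      simp only [hT, twist_apply, trunc_apply]; split_ifs <;> simp
    rw [this]
    exact hp.trunc_mem _ _
  have hamem : twist μ a.1 ∈ finitePart p := by
    have : twist μ a.1 = trunc D (twist μ a.1) := ext fun w => by
      rw [twist_apply, trunc_apply, twist_apply]
      conv_lhs => rw [← ha, trunc_apply]
      split_ifs <;> simp
    rw [this]
    exact hp.trunc_mem _ _
  have hsum : a + k = ⟨twist μ T.1, hTmem⟩ + (a - ⟨twist μ a.1, hamem⟩) := by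
    refine Subtype.ext ?_
    change a.1 + twist μ (trunc D h.1.1) = twist μ (trunc D (a.1 + h.1.1)) + (a.1 - twist μ a.1)
    rw [map_add, map_add, ha]
    abel
  have e1 : finiteSeminorm p i ⟨twist μ T.1, hTmem⟩ ≤ (1 + ε) * finiteSeminorm p i (a + h) := by
    have := hp.seminorm_mono i (a := ⟨twist μ T.1, hTmem⟩) (b := ((1 + ε : ℝ) : ℂ) • (a + h.1))
      fun w => by
        change ‖μ ^ inversions w * (if w.length ≤ D then (a + h : finitePart p).1 w else 0)‖ ≤
          ‖((1 + ε : ℝ) : ℂ) * (a + h : finitePart p).1 w‖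
        rw [norm_mul, norm_mul, Complex.norm_real, Real.norm_of_nonneg h1.le]
        split_ifs with hw
        · exact mul_le_mul_of_nonneg_right (hμ' w hw) (norm_nonneg _)
        · simp only [norm_zero, mul_zero]; positivity
    rwa [map_smul_eq_mul, Complex.norm_real, Real.norm_of_nonneg h1.le] at this
  have e2 : finiteSeminorm p i (a - ⟨twist μ a.1, hamem⟩) ≤ ε * finiteSeminorm p i a := by
    have := hp.seminorm_mono i (a := a - ⟨twist μ a.1, hamem⟩) (b := (ε : ℂ) • a)
      fun w => by
        change ‖a.1 w - μ ^ inversions w * a.1 w‖ ≤ ‖(ε : ℂ) * a.1 w‖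
        rw [← ha, trunc_apply]
        split_ifs with hw
        · rw [← one_sub_mul, norm_mul, norm_mul, norm_sub_rev, Complex.norm_real,
            Real.norm_of_nonneg hε]
          exact mul_le_mul_of_nonneg_right (hμ w (mem_wordsLE.2 hw)) (norm_nonneg _)
        · simp
    rwa [map_smul_eq_mul, Complex.norm_real, Real.norm_of_nonneg hε] at this
  calc relDist p i (q * μ) a ≤ finiteSeminorm p i (a + k) := relDist_le p a hmem
    _ ≤ _ := by rw [hsum]; exact map_add_le_add _ _ _
    _ ≤ _ := add_le_add e1 e2

theorem continuousAt_relDist_of_trunc (i : ι) {q : ℂ} (hq : q ≠ 0) {D : ℕ} {a : finitePart p}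
    (ha : trunc D a.1 = a.1) : ContinuousAt (fun q => relDist p i q a) q := by
  refine Metric.tendsto_nhds.2 fun ε hε => ?_
  set P := finiteSeminorm p i a with hP
  have hP0 : 0 ≤ P := apply_nonneg _ _
  -- Since the distances are at most P, the comparison gives a difference of at most 2δP < ε. The
  -- summand 1 covers P = 0.
  set δ := ε / (2 * P + 1) with hδ
  have hδ0 : 0 < δ := by positivity
  have hev : ∀ g : ℂ → ℂ, ContinuousAt g q → g q = 1 →
      ∀ᶠ q' in 𝓝 q, ∀ w ∈ wordsLE n D, ‖g q' ^ inversions w - 1‖ ≤ δ := by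
    intro g hg hg1
    refine (Finset.eventually_all _).2 fun w _ => ?_
    have hc : ContinuousAt (fun q' => ‖g q' ^ inversions w - 1‖) q :=
      ((hg.pow _).sub continuousAt_const).norm
    have h0 : ‖g q ^ inversions w - 1‖ < δ := by simpa [hg1] using hδ0
    exact (hc.eventually (gt_mem_nhds h0)).mono fun _ h => h.le
  -- The factor q'/q carries relations from q to q', the factor q/q' carries them back; this gives
  -- the upper and the lower bound.
  have h1 := hev (fun q' => q⁻¹ * q') (by fun_prop) (inv_mul_cancel₀ hq)
  have h2 := hev (fun q' => q'⁻¹ * q) (by fun_prop (disch := exact hq)) (inv_mul_cancel₀ hq)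
  filter_upwards [h1, h2, isOpen_ne.mem_nhds hq] with q' hq1 hq2 hq'
  have b1 := relDist_twist_le hp i (q := q) hδ0.le hq1 ha
  have b2 := relDist_twist_le hp i (q := q') hδ0.le hq2 ha
  rw [mul_inv_cancel_left₀ hq] at b1
  rw [mul_inv_cancel_left₀ hq'] at b2
  have c1 := relDist_le_self p i q a
  have c2 := relDist_le_self p i q' a
  have hlt : δ * (2 * P) < ε := by
    rw [hδ, div_mul_eq_mul_div, div_lt_iff₀ (by positivity)]
    nlinarith
  have d1 := mul_le_mul_of_nonneg_left c1 hδ0.le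
  have d2 := mul_le_mul_of_nonneg_left c2 hδ0.le
  rw [Real.dist_eq, abs_lt]
  constructor <;> nlinarith

/-- The distance to the space of relations depends continuously on `q ≠ 0`. -/
theorem continuousAt_relDist (i : ι) {q : ℂ} (hq : q ≠ 0) (a : finitePart p) :
    ContinuousAt (fun q => relDist p i q a) q := by
  refine Metric.tendsto_nhds.2 fun ε hε => ?_
  have h3 : 0 < ε / 3 := by positivity
  obtain ⟨D, hD⟩ := (((withSeminorms_finitePart p).tendsto_nhds _ _).1
    (hp.tendsto_trunc a) i _ h3).exists
  set b : finitePart p := ⟨trunc D a.1, hp.trunc_mem D a.1⟩ with hb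
  have hcont := continuousAt_relDist_of_trunc hp i hq (a := b) (trunc_trunc D a.1)
  filter_upwards [Metric.tendsto_nhds.1 hcont _ h3] with q' hq'
  have hD' : finiteSeminorm p i (a - b) < ε / 3 := by rwa [map_sub_rev]
  have e1 := relDist_le_add p i q a b
  have e2 := relDist_le_add p i q b a
  have e3 := relDist_le_add p i q' a b
  have e4 := relDist_le_add p i q' b a
  rw [Real.dist_eq, abs_lt] at hq' ⊢
  constructor <;> linarith

end RelationSpace

/-! ## Completeness -/

section Completeness

variable {E : Type} [AddCommGroup E] [Module ℂ E] [TopologicalSpace E] [IsTopologicalAddGroup E]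
  {ι : Type} {p : SeminormFamily ℂ E ι}

theorem exists_mem_seminorm_sub_lt_of_cauchy {l : Filter E} {P : Seminorm ℂ E} (hP : Continuous P)
    (hl : @Cauchy E (IsTopologicalAddGroup.rightUniformSpace E) l) {ε : ℝ} (hε : 0 < ε) :
    ∃ T ∈ l, ∀ x ∈ T, ∀ y ∈ T, P (x - y) < ε := by
  let _ := IsTopologicalAddGroup.rightUniformSpace E
  have hU : {x : E | P x < ε} ∈ 𝓝 (0 : E) :=
    (isOpen_Iio.preimage hP).mem_nhds (by simpa using hε)
  obtain ⟨T, hT, hsub⟩ := (cauchy_iff.1 hl).2 _ (preimage_mem_comap hU)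
  refine ⟨T, hT, fun x hx y hy => ?_⟩
  -- The entourage measures `q.2 + -q.1`, hence the exchanged order.
  have := hsub (Set.mk_mem_prod hy hx)
  rwa [sub_eq_add_neg]

theorem cauchy_of_forall_exists_seminorm_sub_lt (hp : WithSeminorms p) {l : Filter E} [l.NeBot]
    (h : ∀ i, ∀ ε : ℝ, 0 < ε → ∃ T ∈ l, ∀ x ∈ T, ∀ y ∈ T, p i (x - y) < ε) :
    @Cauchy E (IsTopologicalAddGroup.rightUniformSpace E) l := by
  let _ := IsTopologicalAddGroup.rightUniformSpace E
  refine ⟨inferInstance, ?_⟩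
  change Tendsto id (l ×ˢ l) (comap (fun q : E × E => q.2 + -q.1) (𝓝 0))
  rw [tendsto_comap_iff, hp.tendsto_nhds]
  intro i ε hε
  obtain ⟨T, hT, hlt⟩ := h i ε hε
  filter_upwards [prod_mem_prod hT hT] with q hq
  have := hlt q.2 hq.2 q.1 hq.1
  simpa [sub_eq_add_neg] using this

/-- As for ℓ¹: coefficients converge because they are bounded by the norms, and semicontinuity of
the norms under coefficientwise convergence turns the Cauchy estimate into an estimate for the
limit. -/
theorem IsSolidFamily.completeSpace {n : ℕ} {ι : Type} {p : ι → ExtNorm (FreeSeries n)}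
    (hp : IsSolidFamily p) :
    @CompleteSpace (finitePart p) (IsTopologicalAddGroup.rightUniformSpace (finitePart p)) := by
  have hws := withSeminorms_finitePart p
  let _ := IsTopologicalAddGroup.rightUniformSpace (finitePart p)
  refine ⟨fun {l} hl => ?_⟩
  have hne := hl.1
  have hsmall : ∀ i, ∀ ε : ℝ, 0 < ε → ∃ T ∈ l, ∀ x ∈ T, ∀ y ∈ T, finiteSeminorm p i (x - y) < ε :=
    fun i ε hε => exists_mem_seminorm_sub_lt_of_cauchy (hws.continuous_seminorm i) hl hε
  obtain ⟨s, -, -⟩ := hp.cofinal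
  have hlim : ∀ w : List (Fin n), ∃ c : ℂ, Tendsto (fun a : finitePart p => (a.1 w : ℂ)) l (𝓝 c) := by
    intro w
    obtain ⟨C, hC⟩ := hp.coeff_le (s 0) w
    -- C may be 0; C + 1 can be divided by.
    have hC' : ∀ a : finitePart p, ‖a.1 w‖ ≤ (C + 1) * finiteSeminorm p (s 0) a := fun a => by
      have h1 := ENNReal.toReal_mono (ENNReal.mul_ne_top ENNReal.coe_ne_top (a.2 (s 0))) (hC a.1)
      rw [toReal_enorm, ENNReal.toReal_mul, ENNReal.coe_toReal] at h1
      have h0 : 0 ≤ finiteSeminorm p (s 0) a := apply_nonneg _ _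
      have h2 : (C : ℝ) * finiteSeminorm p (s 0) a ≤ (C + 1) * finiteSeminorm p (s 0) a := by
        nlinarith
      exact h1.trans h2
    refine cauchy_map_iff_exists_tendsto.1 (Metric.cauchy_iff.2 ⟨inferInstance, fun ε hε => ?_⟩)
    have hC1 : (0 : ℝ) < C + 1 := by positivity
    obtain ⟨T, hT, hlt⟩ := hsmall (s 0) (ε / (C + 1)) (by positivity)
    refine ⟨_, image_mem_map hT, ?_⟩
    rintro _ ⟨x, hx, rfl⟩ _ ⟨y, hy, rfl⟩
    rw [dist_eq_norm]
    have := hlt x hx y hy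
    rw [lt_div_iff₀' hC1] at this
    exact (hC' (x - y)).trans_lt this
  choose c hc using hlim
  have hpi : Tendsto (fun (a : finitePart p) (w : List (Fin n)) => (a.1 w : ℂ)) l (𝓝 c) :=
    tendsto_pi_nhds.2 hc
  set c' : FreeSeries n := c with hc'
  have hle : ∀ i, ∀ ε : ℝ≥0, 0 < ε → ∃ T ∈ l, ∀ b ∈ T,
      (p i).toFun (c' - b.1) ≤ ε := by
    intro i ε hε
    obtain ⟨T, hT, hlt⟩ := hsmall i ε (by exact_mod_cast hε)
    refine ⟨T, hT, fun b hb => ?_⟩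
    have hcont : Continuous fun x : List (Fin n) → ℂ => fun w => x w - b.1 w := by fun_prop
    -- The ball around b is closed for coefficientwise convergence, so the bound survives the limit.
    have hclosed : IsClosed {x : List (Fin n) → ℂ |
        (p i).toFun (show FreeSeries n from fun w => x w - b.1 w) ≤ (ε : ℝ≥0∞)} :=
      ((hp.lsc i).isClosed_preimage (ε : ℝ≥0∞)).preimage hcont
    refine hclosed.mem_of_tendsto hpi ?_
    filter_upwards [hT] with x hx
    have h1 : finiteSeminorm p i (x - b) ≤ ε := (hlt x hx b hb).le
    rw [finiteSeminorm_apply] at h1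
    refine (ENNReal.toReal_le_toReal ((x - b).2 i) ENNReal.coe_ne_top).1 ?_
    rwa [ENNReal.coe_toReal]
  have hmem : ∀ i, (p i).toFun c' ≠ ∞ := by
    intro i
    obtain ⟨T, hT, hT'⟩ := hle i 1 one_pos
    obtain ⟨b, hb⟩ := hne.nonempty_of_mem hT
    have := (p i).add_le (c' - b.1) b.1
    rw [sub_add_cancel] at this
    exact ne_top_of_le_ne_top (ENNReal.add_ne_top.2
      ⟨ne_top_of_le_ne_top ENNReal.coe_ne_top (hT' b hb), b.2 i⟩) this
  refine ⟨⟨c', hmem⟩, ?_⟩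
  refine (hws.tendsto_nhds id (⟨c', hmem⟩ : finitePart p)).2 fun i ε hε => ?_
  obtain ⟨T, hT, hT'⟩ := hle i (Real.toNNReal (ε / 2)) (by simpa using hε)
  filter_upwards [hT] with b hb
  rw [id, map_sub_rev, finiteSeminorm_apply]
  refine (ENNReal.toReal_mono ENNReal.coe_ne_top (hT' b hb)).trans_lt ?_
  rw [ENNReal.coe_toReal, Real.coe_toNNReal _ (by positivity)]
  linarith

end Completeness

/-! ## Holomorphic functions with values in a complete locally convex space -/

/-- Complex analysis is done after composition with such maps, one for each seminorm. The completion
also identifies vectors at P-distance 0. -/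
theorem Seminorm.exists_banach_map {E : Type} [AddCommGroup E] [Module ℂ E] (P : Seminorm ℂ E) :
    ∃ (B : Type) (_ : NormedAddCommGroup B) (_ : NormedSpace ℂ B) (_ : CompleteSpace B)
      (j : E →ₗ[ℂ] B), ∀ x, ‖j x‖ = P x := by
  let _ : SeminormedAddCommGroup E := P.toSeminormedAddCommGroup
  let _ : NormedSpace ℂ E := ⟨fun c a => (map_smul_eq_mul P c a).le⟩
  exact ⟨UniformSpace.Completion E, inferInstance, inferInstance, inferInstance,
    (UniformSpace.Completion.toComplₗᵢ (𝕜 := ℂ) (E := E)).toLinearMap,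
    fun x => UniformSpace.Completion.norm_coe x⟩

section Holomorphic

variable {U : Set ℂ}

/-- Extension by zero of a function on `U`. -/
def extendZero {B : Type} [Zero B] (f : U → B) : ℂ → B := Function.extend Subtype.val f 0

theorem extendZero_apply {B : Type} [Zero B] (f : U → B) (z : U) : extendZero f z = f z :=
  Subtype.val_injective.extend_apply f 0 z

theorem map_val_nhdsNE (hU : IsOpen U) (z : U) : map Subtype.val (𝓝[≠] z) = 𝓝[≠] (z : ℂ) := by
  rw [IsEmbedding.subtypeVal.map_nhdsWithin_eq]
  have : Subtype.val '' ({z}ᶜ : Set U) = U ∩ {(z : ℂ)}ᶜ := by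
    ext w
    constructor
    · rintro ⟨y, hy, rfl⟩
      exact ⟨y.2, fun h => hy (Subtype.ext h)⟩
    · rintro ⟨hw, hne⟩
      exact ⟨⟨w, hw⟩, fun h => hne (congrArg Subtype.val h), rfl⟩
  rw [this, nhdsWithin_inter_of_mem (mem_nhdsWithin_of_mem_nhds (hU.mem_nhds z.2))]

variable {E : Type} [AddCommGroup E] [Module ℂ E] [TopologicalSpace E]
  {B : Type} [NormedAddCommGroup B] [NormedSpace ℂ B]

theorem hasDerivAt_extendZero (hU : IsOpen U) {j : E →ₗ[ℂ] B} (hj : Continuous j) {f : U → E}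
    {z : U} {f' : E}
    (h : Tendsto (fun w : U => ((w : ℂ) - (z : ℂ))⁻¹ • (f w - f z)) (𝓝[≠] z) (𝓝 f')) :
    HasDerivAt (extendZero fun w => j (f w)) (j f') z := by
  rw [hasDerivAt_iff_tendsto_slope, ← map_val_nhdsNE hU, tendsto_map'_iff]
  refine ((hj.tendsto f').comp h).congr fun w => ?_
  simp [slope, extendZero_apply]

theorem IsHolomorphic.differentiableOn (hU : IsOpen U) {j : E →ₗ[ℂ] B} (hj : Continuous j)
    {f : U → E} (hf : IsHolomorphic f) : DifferentiableOn ℂ (extendZero fun w => j (f w)) U := by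
  intro z hz
  obtain ⟨f', hf'⟩ := hf ⟨z, hz⟩
  exact (hasDerivAt_extendZero hU hj hf').differentiableAt.differentiableWithinAt

variable {ι : Type} {p : SeminormFamily ℂ E ι}

/-- A function is continuous and holomorphic as soon as it is so in the Banach spaces given by the
seminorms. -/
theorem continuous_of_differentiableOn (hp : WithSeminorms p) {f : U → E}
    (hf : ∀ i, ∃ (B : Type) (_ : NormedAddCommGroup B) (_ : NormedSpace ℂ B) (j : E →ₗ[ℂ] B)
      (g : ℂ → B), (∀ x, ‖j x‖ = p i x) ∧ DifferentiableOn ℂ g U ∧ ∀ z : U, g z = j (f z)) :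
    Continuous f := by
  refine continuous_iff_continuousAt.2 fun z => (hp.tendsto_nhds _ _).2 fun i ε hε => ?_
  obtain ⟨B, _, _, j, g, hj, hg, hgf⟩ := hf i
  have hc : Continuous fun w : U => g w := hg.continuousOn.comp_continuous
    continuous_subtype_val fun w => w.2
  filter_upwards [Metric.tendsto_nhds.1 (hc.tendsto z) ε hε] with w hw
  rwa [dist_eq_norm, hgf, hgf, ← map_sub, hj] at hw

/-- The difference quotients converge in each of the Banach spaces, hence form a Cauchy filter in E;
completeness supplies the derivative in E itself. -/
theorem isHolomorphic_of_differentiableOn [IsTopologicalAddGroup E] (hp : WithSeminorms p)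
    (hc : @CompleteSpace E (IsTopologicalAddGroup.rightUniformSpace E)) (hU : IsOpen U) {f : U → E}
    (hf : ∀ i, ∃ (B : Type) (_ : NormedAddCommGroup B) (_ : NormedSpace ℂ B) (j : E →ₗ[ℂ] B)
      (g : ℂ → B), (∀ x, ‖j x‖ = p i x) ∧ DifferentiableOn ℂ g U ∧ ∀ z : U, g z = j (f z)) :
    IsHolomorphic f := by
  intro z
  have hne : (𝓝[≠] z).NeBot := by
    rw [← map_neBot_iff (Subtype.val : U → ℂ), map_val_nhdsNE hU]
    infer_instance
  have hcauchy : @Cauchy E (IsTopologicalAddGroup.rightUniformSpace E)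
      (map (fun w : U => ((w : ℂ) - (z : ℂ))⁻¹ • (f w - f z)) (𝓝[≠] z)) := by
    refine cauchy_of_forall_exists_seminorm_sub_lt hp fun i ε hε => ?_
    obtain ⟨B, _, _, j, g, hj, hg, hgf⟩ := hf i
    have hd := (hg.differentiableAt (hU.mem_nhds z.2)).hasDerivAt
    rw [hasDerivAt_iff_tendsto_slope, ← map_val_nhdsNE hU, tendsto_map'_iff] at hd
    refine ⟨_, image_mem_map (Metric.tendsto_nhds.1 hd (ε / 2) (half_pos hε)), ?_⟩
    have key : ∀ w : U, slope g z w = j (((w : ℂ) - (z : ℂ))⁻¹ • (f w - f z)) := fun w => by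
      simp [slope, hgf]
    rintro _ ⟨v, hv, rfl⟩ _ ⟨w, hw, rfl⟩
    rw [← hj, map_sub, ← key, ← key, ← dist_eq_norm]
    have hv' : dist (slope g z v) (deriv g z) < ε / 2 := hv
    have hw' : dist (slope g z w) (deriv g z) < ε / 2 := hw
    have := dist_triangle_right (slope g z v) (slope g z w) (deriv g z)
    linarith
  obtain ⟨f', hf'⟩ := @CompleteSpace.complete E (IsTopologicalAddGroup.rightUniformSpace E) hc _
    hcauchy
  exact ⟨f', hf'⟩

end Holomorphic

/-- A holomorphic function `f` differs from the constant `f q` by a multiple of `z - q`. -/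
theorem holo_exists_factor {U : Set ℂ} (hU : IsOpen U) {F : Type} [Ring F] [Algebra ℂ F]
    [TopologicalSpace F] [IsTopologicalRing F] [ContinuousSMul ℂ F] {ι : Type}
    {p : SeminormFamily ℂ F ι} (hp : WithSeminorms p)
    (hc : @CompleteSpace F (IsTopologicalAddGroup.rightUniformSpace F)) (f : holo U F) (q : U) :
    ∃ g : holo U F, ∀ z : U, f.1 z - f.1 q = ((z : ℂ) - (q : ℂ)) • g.1 z := by
  obtain ⟨f', hf'⟩ := f.2 q
  classical
  -- The difference quotient, completed by the derivative at q. In each Banach space it becomes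
  -- `dslope`, which is differentiable by the removable singularity theorem.
  set g : U → F := fun z => if z = q then f' else ((z : ℂ) - (q : ℂ))⁻¹ • (f.1 z - f.1 q) with hg
  have key : ∀ i, ∃ (B : Type) (_ : NormedAddCommGroup B) (_ : NormedSpace ℂ B) (j : F →ₗ[ℂ] B)
      (k : ℂ → B), (∀ x, ‖j x‖ = p i x) ∧ DifferentiableOn ℂ k U ∧ ∀ z : U, k z = j (g z) := by
    intro i
    obtain ⟨B, _, _, _, j, hj⟩ := Seminorm.exists_banach_map (p i)
    have hjc : Continuous j := by
      refine continuous_of_continuousAt_zero j ?_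
      refine tendsto_zero_iff_norm_tendsto_zero.2 ?_ |>.trans (by rw [map_zero])
      simp_rw [hj]
      simpa using (hp.continuous_seminorm i).tendsto 0
    refine ⟨B, _, _, j, dslope (extendZero fun w => j (f.1 w)) q, hj,
      (Complex.differentiableOn_dslope (hU.mem_nhds q.2)).2
        (IsHolomorphic.differentiableOn hU hjc f.2), fun z => ?_⟩
    by_cases hz : z = q
    · subst hz
      rw [dslope_same, (hasDerivAt_extendZero hU hjc hf').deriv, hg]
      simp
    · have hz' : (z : ℂ) ≠ q := fun h => hz (Subtype.ext h)
      rw [dslope_of_ne _ hz', slope_def_module, extendZero_apply, extendZero_apply, hg]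
      simp [hz]
  refine ⟨⟨⟨g, continuous_of_differentiableOn hp key⟩,
    isHolomorphic_of_differentiableOn hp hc hU key⟩, fun z => ?_⟩
  change _ = _ • g z
  by_cases hz : z = q
  · subst hz; simp
  · have hz' : (z : ℂ) - q ≠ 0 := sub_ne_zero.2 fun h => hz (Subtype.ext h)
    simp only [hg, hz, if_false]
    rw [smul_inv_smul₀ hz']

/-! ## Directed families of seminorms -/

theorem mem_nhds_iff_of_directed {E ι : Type} [AddCommGroup E] [Module ℂ E] [TopologicalSpace E]
    [Nonempty ι] {p : SeminormFamily ℂ E ι} (hp : WithSeminorms p)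
    (hd : ∀ i j, ∃ k, p i ≤ p k ∧ p j ≤ p k) {x : E} {W : Set E} :
    W ∈ 𝓝 x ↔ ∃ i, ∃ ε : ℝ, 0 < ε ∧ (p i).ball x ε ⊆ W := by
  rw [hp.hasBasis_ball.mem_iff]
  constructor
  · rintro ⟨⟨s, ε⟩, hε, hsub⟩
    obtain ⟨k, hk⟩ := Directed.finset_le (r := (· ≤ ·)) (f := p) hd s
    refine ⟨k, ε, hε, fun y hy => hsub ?_⟩
    rw [Seminorm.mem_ball] at hy ⊢
    exact ((Finset.sup_le hk : s.sup p ≤ p k) _).trans_lt hy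
  · rintro ⟨i, ε, hε, hsub⟩
    exact ⟨({i}, ε), hε, by simpa using hsub⟩

theorem withSeminorms_of_mem_nhds_iff {E ι : Type} [AddCommGroup E] [Module ℂ E]
    [t : TopologicalSpace E] [Nonempty ι] {p : SeminormFamily ℂ E ι}
    (hd : ∀ i j, ∃ k, p i ≤ p k ∧ p j ≤ p k)
    (h : ∀ (x : E) (W : Set E), W ∈ 𝓝 x ↔ ∃ i, ∃ ε : ℝ, 0 < ε ∧ (p i).ball x ε ⊆ W) :
    WithSeminorms p := by
  refine ⟨TopologicalSpace.ext_nhds fun x => Filter.ext fun W => ?_⟩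
  rw [h, @mem_nhds_iff_of_directed _ _ _ _ p.moduleFilterBasis.topology _ p
    (@WithSeminorms.mk _ _ _ _ _ _ _ p.moduleFilterBasis.topology rfl) hd]

/-- A Hausdorff-free argument: G / ker f is complete because G is complete and first countable, and
f induces an isomorphism of topological groups from it onto H. -/
theorem completeSpace_of_isOpenQuotientMap {G H : Type} [AddCommGroup G] [TopologicalSpace G]
    [IsTopologicalAddGroup G] [FirstCountableTopology G] [AddCommGroup H] [TopologicalSpace H]
    [IsTopologicalAddGroup H] (f : G →+ H) (hf : IsOpenQuotientMap f)
    (hG : @CompleteSpace G (IsTopologicalAddGroup.rightUniformSpace G)) :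
    @CompleteSpace H (IsTopologicalAddGroup.rightUniformSpace H) := by
  let e := QuotientAddGroup.quotientKerEquivOfSurjective f hf.surjective
  have he : ∀ x, e (QuotientAddGroup.mk x) = f x := fun x => rfl
  have hq : IsOpenQuotientMap (QuotientAddGroup.mk : G → G ⧸ f.ker) :=
    QuotientAddGroup.isOpenQuotientMap_mk
  have hc : Continuous e := hq.isQuotientMap.continuous_iff.2 hf.continuous
  have hs : Continuous e.symm := by
    refine hf.isQuotientMap.continuous_iff.2 (hq.continuous.congr fun x => ?_)
    rw [Function.comp_apply, ← he, AddEquiv.symm_apply_apply]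
  have hquot : @CompleteSpace (G ⧸ f.ker) (IsTopologicalAddGroup.rightUniformSpace _) :=
    inferInstance
  let _ := IsTopologicalAddGroup.rightUniformSpace (G ⧸ f.ker)
  let _ := IsTopologicalAddGroup.rightUniformSpace H
  have : IsUniformAddGroup (G ⧸ f.ker) := isUniformAddGroup_of_addCommGroup
  have : IsUniformAddGroup H := isUniformAddGroup_of_addCommGroup
  exact (UniformEquiv.completeSpace_iff (α := G ⧸ f.ker) (β := H)
    ⟨e.toEquiv, uniformContinuous_addMonoidHom_of_continuous (f := e) hc,
      uniformContinuous_addMonoidHom_of_continuous (f := e.symm) hs⟩).1 hquot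

theorem isFrechetAlgebra_of_seminorms {A : Type} [Ring A] [Algebra ℂ A] [TopologicalSpace A]
    {p : SeminormFamily ℂ A ℕ} (hp : WithSeminorms p) (hmul : Continuous fun q : A × A => q.1 * q.2)
    (hsep : ∀ x, (∀ m, p m x = 0) → x = 0) {G : Type} [AddCommGroup G] [TopologicalSpace G]
    [IsTopologicalAddGroup G] [FirstCountableTopology G] (f : G →+ A) (hf : IsOpenQuotientMap f)
    (hG : @CompleteSpace G (IsTopologicalAddGroup.rightUniformSpace G)) : IsFrechetAlgebra A := by
  have hadd := hp.topologicalAddGroup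
  have : T1Space A := hp.T1_of_separating fun x hx => by
    by_contra! h
    exact hx (hsep x h)
  have hfc := hp.firstCountableTopology
  refine ⟨{ hadd with continuous_mul := hmul }, hp.continuousSMul, hp.toLocallyConvexSpace, ?_,
    completeSpace_of_isOpenQuotientMap f hf hG⟩
  let _ : UniformSpace A := IsTopologicalAddGroup.rightUniformSpace A
  have : IsUniformAddGroup A := isUniformAddGroup_of_addCommGroup
  have : (uniformity A).IsCountablyGenerated := IsUniformAddGroup.uniformity_countably_generated
  exact UniformSpace.metrizableSpace

/-! ## Quotient seminorms -/

section QuotSeminorm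

variable {A : Type} [Ring A] [Algebra ℂ A] (J : Ideal A) [J.IsTwoSided]

theorem quotSeminorm_mk_le (P : Seminorm ℂ A) (a : A) :
    quotSeminorm J P (Ideal.Quotient.mk J a) ≤ P a :=
  ciInf_le ⟨0, by rintro _ ⟨c, rfl⟩; exact apply_nonneg P _⟩
    (⟨a, rfl⟩ : {b : A // Ideal.Quotient.mk J b = Ideal.Quotient.mk J a})

variable {J}

theorem le_quotSeminorm {P : Seminorm ℂ A} {v : A ⧸ J} {c : ℝ}
    (h : ∀ a, Ideal.Quotient.mk J a = v → c ≤ P a) : c ≤ quotSeminorm J P v := by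
  have : Nonempty {a : A // Ideal.Quotient.mk J a = v} :=
    let ⟨a, ha⟩ := Ideal.Quotient.mk_surjective v
    ⟨⟨a, ha⟩⟩
  exact le_ciInf fun a => h a.1 a.2

theorem exists_of_quotSeminorm_lt {P : Seminorm ℂ A} {v : A ⧸ J} {c : ℝ}
    (h : quotSeminorm J P v < c) : ∃ a, Ideal.Quotient.mk J a = v ∧ P a < c := by
  by_contra! hcon
  exact absurd h (not_lt.2 (le_quotSeminorm hcon))

theorem quotSeminorm_le_of_le {P Q : Seminorm ℂ A} {C : ℝ} (hC : 0 < C) (h : ∀ a, P a ≤ C * Q a)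
    (v : A ⧸ J) : quotSeminorm J P v ≤ C * quotSeminorm J Q v := by
  rw [← div_le_iff₀' hC]
  refine le_quotSeminorm fun a ha => ?_
  rw [div_le_iff₀' hC]
  subst ha
  exact (quotSeminorm_mk_le J P a).trans (h a)

theorem quotSeminorm_mul_le {P Q : Seminorm ℂ A} (h : ∀ a b, P (a * b) ≤ Q a * Q b)
    (v w : A ⧸ J) : quotSeminorm J P (v * w) ≤ quotSeminorm J Q v * quotSeminorm J Q w := by
  refine le_of_forall_gt_imp_ge_of_dense fun c hc => ?_
  have h0 : 0 ≤ quotSeminorm J Q v := apply_nonneg _ _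
  have h0' : 0 ≤ quotSeminorm J Q w := apply_nonneg _ _
  -- Some t > 0 satisfies (Q v + t)(Q w + t) < c; both factors are then lifted with error less than
  -- t.
  have hcont : ContinuousAt (fun t : ℝ => (quotSeminorm J Q v + t) * (quotSeminorm J Q w + t)) 0 := by
    fun_prop
  have hlt := hcont.eventually (gt_mem_nhds
    (show (quotSeminorm J Q v + 0) * (quotSeminorm J Q w + 0) < c by simpa using hc))
  obtain ⟨t, ht, ht0⟩ := ((hlt.filter_mono nhdsWithin_le_nhds).and
    (self_mem_nhdsWithin (s := Set.Ioi (0 : ℝ)))).exists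
  obtain ⟨a, rfl, ha⟩ := exists_of_quotSeminorm_lt (lt_add_of_pos_right _ ht0 :
    quotSeminorm J Q v < quotSeminorm J Q v + t)
  obtain ⟨b, rfl, hb⟩ := exists_of_quotSeminorm_lt (lt_add_of_pos_right _ ht0 :
    quotSeminorm J Q w < quotSeminorm J Q w + t)
  rw [← map_mul]
  refine ((quotSeminorm_mk_le J P _).trans ((h a b).trans ?_)).trans ht.le
  exact mul_le_mul ha.le hb.le (apply_nonneg _ _) ((apply_nonneg Q a).trans ha.le)

theorem continuous_quotSeminorm [TopologicalSpace A] [IsTopologicalRing A] {P : Seminorm ℂ A}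
    (hP : Continuous P) : Continuous (quotSeminorm J P) := by
  have hq : IsOpenQuotientMap (Ideal.Quotient.mk J) := QuotientAddGroup.isOpenQuotientMap_mk
  refine hq.isQuotientMap.continuous_iff.2 ?_
  exact Seminorm.continuous_of_le
    (p := (quotSeminorm J P).comp (Ideal.Quotient.mkₐ ℂ J).toLinearMap) hP
    fun a => quotSeminorm_mk_le J P a

end QuotSeminorm

/-! ## The tube topology of the bundle of an algebra -/

section BundleOf

variable {X : Type} [TopologicalSpace X] {K : Type} [CommRing K] [Algebra ℂ K]
  (γ : K →ₐ[ℂ] C(X, ℂ)) (A : Type) [Ring A] [Algebra ℂ A] [Algebra K A] [IsScalarTower ℂ K A]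
  [TopologicalSpace A] [IsTopologicalRing A]

/-- The topology of the bundle of an algebra, as a topology on the total space of its fibers. -/
abbrev fiberTopology : TopologicalSpace (Tot (Fiber γ A)) := (bundleOf γ A).top

/-- The sections `x ↦ u_x`, `u ∈ A`. -/
def germSections : Submodule ℂ (∀ x, Fiber γ A x) :=
  LinearMap.range (LinearMap.pi fun x => (Ideal.Quotient.mkₐ ℂ (fiberIdeal γ A x)).toLinearMap)

/-- The quotient seminorms of the continuous seminorms on `A`. -/
def fiberSeminorms : Set (FibSeminorm (Fiber γ A)) :=
  {N | ∃ p : Seminorm ℂ A, Continuous p ∧ N = fiberSeminorm γ A p}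

variable {A}

omit [IsScalarTower ℂ K A] in
theorem fiberSeminorm_germ_le (P : Seminorm ℂ A) (u : A) (x : X) :
    fiberSeminorm γ A P x (germ γ A u x) ≤ P u := quotSeminorm_mk_le _ P u

/-- Since k - k(x) lies in 𝔪_x, scalar functions act on the fiber over x by their value at x. -/
theorem germ_algebraMap (k : K) (x : X) :
    germ γ A (algebraMap K A k) x = γ k x • germ γ A 1 x := by
  have h : algebraMap K A k - γ k x • (1 : A) =
      algebraMap K A (k - algebraMap ℂ K (γ k x)) := by
    rw [map_sub, ← IsScalarTower.algebraMap_apply ℂ K A,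
      Algebra.algebraMap_eq_smul_one (R := ℂ) (A := A)]
  have hmem : algebraMap K A k - γ k x • (1 : A) ∈ fiberIdeal γ A x := by
    rw [h]
    refine subset_closure (Ideal.mem_map_of_mem _ ?_)
    change γ (k - algebraMap ℂ K (γ k x)) x = 0
    simp
  exact Ideal.Quotient.eq.2 hmem

/-- Elements of 𝔪_x A are finite sums of products a k with k(x) = 0, and in the fiber over y such a
product has size at most |k(y)| P(a). The seminorm is quantified inside the induction because
multiplication by a replaces P by P(a ·). -/
theorem tendsto_fiberSeminorm_germ {x : X} {m : A}
    (hm : m ∈ (pointIdeal γ x).map (algebraMap K A)) :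
    ∀ P : Seminorm ℂ A, Continuous P →
      Tendsto (fun y => fiberSeminorm γ A P y (germ γ A m y)) (𝓝 x) (𝓝 0) := by
  refine Submodule.span_induction ?_ ?_ ?_ ?_ hm
  · rintro _ ⟨k, hk, rfl⟩ P -
    have hk' : γ k x = 0 := hk
    have hlim : Tendsto (fun y => ‖γ k y‖ * P 1) (𝓝 x) (𝓝 0) := by
      have := (((γ k).continuous.norm).tendsto x).mul_const (P 1)
      simpa [hk'] using this
    refine squeeze_zero (fun y => apply_nonneg _ _) (fun y => ?_) hlim
    rw [germ_algebraMap, map_smul_eq_mul]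
    exact mul_le_mul_of_nonneg_left (fiberSeminorm_germ_le γ P 1 y) (norm_nonneg _)
  · intro P _
    refine tendsto_const_nhds.congr fun y => ?_
    rw [show germ γ A 0 y = 0 from map_zero _, map_zero]
  · intro u v _ _ hu hv P hP
    refine squeeze_zero (fun y => apply_nonneg _ _) (fun y => ?_)
      (by simpa using (hu P hP).add (hv P hP))
    rw [show germ γ A (u + v) y = germ γ A u y + germ γ A v y from map_add _ _ _]
    exact map_add_le_add _ _ _
  · intro a u _ hu P hP
    refine squeeze_zero (fun y => apply_nonneg _ _) (fun y => ?_)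
      (hu (P.comp (LinearMap.mulLeft ℂ a)) (hP.comp (continuous_const_mul a)))
    refine le_quotSeminorm fun b hb => ?_
    have : germ γ A (a • u) y = Ideal.Quotient.mk _ (a * b) := by
      rw [map_mul, hb, smul_eq_mul]
      exact map_mul _ _ _
    rw [this]
    exact quotSeminorm_mk_le _ P (a * b)

/-- A representative of u_x with P < c differs from u by a limit of elements of 𝔪_x A, so P(u + m) <
c for some m in 𝔪_x A. Then u_y = (u + m)_y - m_y, and m_y becomes small as y tends to x. -/
theorem upperSemicontinuous_fiberSeminorm {P : Seminorm ℂ A} (hP : Continuous P) (u : A) :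
    UpperSemicontinuous fun x => fiberSeminorm γ A P x (germ γ A u x) := by
  intro x c hc
  obtain ⟨a, ha, hac⟩ := exists_of_quotSeminorm_lt hc
  have hmem : a - u ∈ fiberIdeal γ A x := Ideal.Quotient.eq.1 ha
  have hopen : IsOpen {b | P (u + b) < c} :=
    isOpen_Iio.preimage (hP.comp (continuous_const.add continuous_id))
  obtain ⟨m, hm, hmmem⟩ := mem_closure_iff.1 hmem _ hopen (by simpa using hac)
  have ht := tendsto_fiberSeminorm_germ γ hmmem P hP
  filter_upwards [ht.eventually (gt_mem_nhds (sub_pos.2 (show P (u + m) < c from hm)))] with y hy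
  have : germ γ A u y = germ γ A (u + m) y - germ γ A m y := by
    rw [eq_sub_iff_add_eq]
    exact (map_add (Ideal.Quotient.mk (fiberIdeal γ A y)) u m).symm
  rw [this]
  have h1 := fiberSeminorm_germ_le γ P (u + m) y
  have h2 := map_sub_le_add (fiberSeminorm γ A P y) (germ γ A (u + m) y) (germ γ A m y)
  linarith

theorem isTubeTopology_bundleOf :
    @IsTubeTopology X (Fiber γ A) _ _ _ (fiberTopology γ A) (germSections γ A)
      (fiberSeminorms γ A) := by
  let _ := fiberTopology γ A
  refine ⟨fun x v => ?_, ⟨_, 0, continuous_const, rfl⟩, ?_, ?_, ?_⟩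
  · obtain ⟨u, rfl⟩ := Ideal.Quotient.mk_surjective v
    exact ⟨germ γ A u, ⟨u, rfl⟩, rfl⟩
  · rintro _ ⟨P, hP, rfl⟩ _ ⟨Q, hQ, rfl⟩
    refine ⟨_, ⟨P + Q, hP.add hQ, rfl⟩, 1, one_pos, fun v => ⟨?_, ?_⟩⟩
    · exact quotSeminorm_le_of_le one_pos (fun a => by simp) v.snd
    · exact quotSeminorm_le_of_le one_pos (fun a => by simp) v.snd
  · rintro _ ⟨P, hP, rfl⟩ _ ⟨u, rfl⟩
    exact upperSemicontinuous_fiberSeminorm γ hP u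
  · refine congrArg TopologicalSpace.generateFrom (Set.ext fun W => ?_)
    constructor
    · rintro ⟨V, u, P, ε, hV, hP, hε, rfl⟩
      exact ⟨V, _, _, ε, hV, ⟨u, rfl⟩, ⟨P, hP, rfl⟩, hε, rfl⟩
    · rintro ⟨V, _, _, ε, hV, ⟨u, rfl⟩, ⟨P, hP, rfl⟩, hε, rfl⟩
      exact ⟨V, u, P, ε, hV, hP, hε, rfl⟩

omit [IsScalarTower ℂ K A] in
theorem mul_mem_germSections {s t : ∀ x, Fiber γ A x} (hs : s ∈ germSections γ A)
    (ht : t ∈ germSections γ A) : s * t ∈ germSections γ A := by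
  obtain ⟨u, rfl⟩ := hs
  obtain ⟨v, rfl⟩ := ht
  exact ⟨u * v, funext fun x => map_mul (Ideal.Quotient.mk _) u v⟩

omit [IsScalarTower ℂ K A] in
theorem fiberSeminorms_mul_le
    (hA : ∀ P : Seminorm ℂ A, Continuous P → ∃ Q : Seminorm ℂ A, Continuous Q ∧
      ∀ a b, P (a * b) ≤ Q a * Q b) :
    ∀ N ∈ fiberSeminorms γ A, ∃ N' ∈ fiberSeminorms γ A, ∀ (x : X) (a b : Fiber γ A x),
      N x (a * b) ≤ N' x a * N' x b := by
  rintro _ ⟨P, hP, rfl⟩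
  obtain ⟨Q, hQ, hle⟩ := hA P hP
  exact ⟨_, ⟨Q, hQ, rfl⟩, fun x a b => quotSeminorm_mul_le hle a b⟩

/-- The bundle of an algebra is a Fréchet algebra bundle as soon as its fibers are Fréchet
algebras. -/
theorem isFrechetAlgebraBundle_bundleOf
    (hA : ∀ P : Seminorm ℂ A, Continuous P → ∃ Q : Seminorm ℂ A, Continuous Q ∧
      ∀ a b, P (a * b) ≤ Q a * Q b)
    (hfib : ∀ x, @IsFrechetAlgebra (Fiber γ A x) _ _ (TopologicalSpace.induced
      (fun v => (⟨x, v⟩ : Tot (Fiber γ A))) (fiberTopology γ A))) :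
    (bundleOf γ A).IsFrechetAlgebraBundle :=
  let _ := fiberTopology γ A
  { locallyConvexBundle := (isTubeTopology_bundleOf γ).isLocallyConvexBundle
    continuous_mul := (isTubeTopology_bundleOf γ).continuous_mul
      (fun _ hs _ ht => mul_mem_germSections γ hs ht) (fiberSeminorms_mul_le γ hA)
    mul_subset := mul_subset_of_seminorms (fiberSeminorms_mul_le γ hA)
    frechet := hfib }

/-- The members of `𝒩` need not be quotient seminorms. Mutual domination makes the uniform
structures equal, and continuity along the sections from A gives continuity on the total space. -/
theorem isContinuous_bundleOf {𝒩 : Set (FibSeminorm (Fiber γ A))} (hdir : IsDirectedFamily 𝒩)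
    (h₁ : IsDominatedBy (fiberSeminorms γ A) 𝒩) (h₂ : IsDominatedBy 𝒩 (fiberSeminorms γ A))
    (hcont : ∀ N ∈ 𝒩, ∀ u : A, Continuous fun x => N x (germ γ A u x)) :
    (bundleOf γ A).IsContinuous := by
  let _ := fiberTopology γ A
  have h := isTubeTopology_bundleOf (A := A) γ
  have hc : ∀ N ∈ 𝒩, Continuous N.fn := fun N hN => by
    obtain ⟨N', hN', C, hC, hle⟩ := h₂ N hN
    refine h.continuous_fn hN' hC hle ?_
    rintro _ ⟨u, rfl⟩
    exact hcont N hN u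
  exact ⟨𝒩, hdir, h.isAdmissible h₁ hc, hc,
    (uniformStructureOf_mono h₁).antisymm (uniformStructureOf_mono h₂)⟩

end BundleOf

/-! ## Fibers of quotient algebras -/

section QuotientFibers

variable {X : Type} [TopologicalSpace X] {K : Type} [CommRing K] [Algebra ℂ K]
  (γ : K →ₐ[ℂ] C(X, ℂ)) {R : Type} [Ring R] [Algebra ℂ R] [Algebra K R]
  [TopologicalSpace R] [IsTopologicalRing R] (I : Ideal R) [I.IsTwoSided]

/-- The kernel of the projection of `R` to the fiber of `R ⧸ I` over `x`. -/
def fiberKernel (x : X) : Ideal R :=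
  (fiberIdeal γ (R ⧸ I) x).comap (Ideal.Quotient.mk I)

/-- The projection of `R` to the fiber of `R ⧸ I` over `x`. -/
def toFiber (x : X) : R →ₐ[ℂ] Fiber γ (R ⧸ I) x :=
  (Ideal.Quotient.mkₐ ℂ (fiberIdeal γ (R ⧸ I) x)).comp (Ideal.Quotient.mkₐ ℂ I)

variable {γ I}

theorem toFiber_surjective (x : X) : Function.Surjective (toFiber γ I x) :=
  Ideal.Quotient.mk_surjective.comp Ideal.Quotient.mk_surjective

theorem toFiber_eq_zero_iff {x : X} {f : R} : toFiber γ I x f = 0 ↔ f ∈ fiberKernel γ I x :=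
  Ideal.Quotient.eq_zero_iff_mem

theorem toFiber_eq_iff {x : X} {f g : R} :
    toFiber γ I x f = toFiber γ I x g ↔ f - g ∈ fiberKernel γ I x := by
  rw [← toFiber_eq_zero_iff, map_sub, sub_eq_zero]

omit [Algebra ℂ R] in
theorem isClosed_fiberKernel (x : X) : IsClosed (fiberKernel γ I x : Set R) :=
  (isClosed_closure (s := ((pointIdeal γ x).map (algebraMap K (R ⧸ I)) : Set (R ⧸ I)))).preimage
    continuous_quot_mk

theorem mul_mem_fiberKernel {x : X} {f : R} (hf : f ∈ fiberKernel γ I x) (g : R) :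
    f * g ∈ fiberKernel γ I x := by
  rw [← toFiber_eq_zero_iff] at hf ⊢
  rw [map_mul, hf, zero_mul]

theorem le_fiberKernel (x : X) : I ≤ fiberKernel γ I x := fun f hf => by
  rw [← toFiber_eq_zero_iff]
  change germ γ (R ⧸ I) (Ideal.Quotient.mk I f) x = 0
  rw [Ideal.Quotient.eq_zero_iff_mem.2 hf]
  exact map_zero _

omit [Algebra ℂ R] in
theorem algebraMap_mem_fiberKernel {x : X} {k : K} (hk : γ k x = 0) :
    algebraMap K R k ∈ fiberKernel γ I x :=
  subset_closure (Ideal.mem_map_of_mem (algebraMap K (R ⧸ I)) (I := pointIdeal γ x) hk)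

omit [Algebra ℂ R] in
-- With `le_fiberKernel` and `algebraMap_mem_fiberKernel`, this identifies the kernel as the
-- smallest closed left ideal containing I and the image of 𝔪_x. The image of J in R ⧸ I is closed
-- because its preimage is J again, as I ≤ J.
theorem fiberKernel_le {x : X} {J : Ideal R} (hJ : IsClosed (J : Set R)) (hI : I ≤ J)
    (hm : ∀ k, γ k x = 0 → algebraMap K R k ∈ J) : fiberKernel γ I x ≤ J := by
  have hcomap : ∀ g, Ideal.Quotient.mk I g ∈ J.map (Ideal.Quotient.mk I) → g ∈ J := by
    intro g hg
    obtain ⟨g', hg', h⟩ := (Ideal.mem_map_iff_of_surjective _ Ideal.Quotient.mk_surjective).1 hg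
    have := hI (Ideal.Quotient.eq.1 h.symm)
    simpa using J.add_mem this hg'
  have hclosed : IsClosed (J.map (Ideal.Quotient.mk I) : Set (R ⧸ I)) := by
    have hq : IsOpenQuotientMap (Ideal.Quotient.mk I) := QuotientAddGroup.isOpenQuotientMap_mk
    rw [← hq.isQuotientMap.isClosed_preimage]
    convert hJ using 1
    ext g
    exact ⟨hcomap g, Ideal.mem_map_of_mem _⟩
  have hle : (pointIdeal γ x).map (algebraMap K (R ⧸ I)) ≤ J.map (Ideal.Quotient.mk I) :=
    Ideal.map_le_iff_le_comap.2 fun k hk =>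
      Ideal.mem_map_of_mem (Ideal.Quotient.mk I) (hm k hk)
  exact fun f hf => hcomap f (closure_minimal hle hclosed hf)

variable (γ I) in
/-- The quotient seminorm on a fiber of `R ⧸ I` of a seminorm on `R`. -/
def fiberNorm (P : Seminorm ℂ R) (x : X) : Seminorm ℂ (Fiber γ (R ⧸ I) x) :=
  quotSeminorm (fiberIdeal γ (R ⧸ I) x) (quotSeminorm I P)

theorem fiberNorm_toFiber_le (P : Seminorm ℂ R) (x : X) (f : R) :
    fiberNorm γ I P x (toFiber γ I x f) ≤ P f :=
  (quotSeminorm_mk_le (fiberIdeal γ (R ⧸ I) x) _ _).trans (quotSeminorm_mk_le I P f)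

theorem le_fiberNorm {P : Seminorm ℂ R} {x : X} {v : Fiber γ (R ⧸ I) x} {c : ℝ}
    (h : ∀ f, toFiber γ I x f = v → c ≤ P f) : c ≤ fiberNorm γ I P x v :=
  le_quotSeminorm fun a ha => le_quotSeminorm fun f hf => h f (by subst hf; exact ha)

theorem exists_of_fiberNorm_lt {P : Seminorm ℂ R} {x : X} {v : Fiber γ (R ⧸ I) x} {c : ℝ}
    (h : fiberNorm γ I P x v < c) : ∃ f, toFiber γ I x f = v ∧ P f < c := by
  by_contra! hcon
  exact absurd h (not_lt.2 (le_fiberNorm hcon))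

theorem fiberNorm_mono {P Q : Seminorm ℂ R} (h : P ≤ Q) (x : X) :
    fiberNorm γ I P x ≤ fiberNorm γ I Q x := fun v =>
  le_fiberNorm fun f hf => by subst hf; exact (fiberNorm_toFiber_le P x f).trans (h f)

/-- Two successive quotient seminorms collapse to one infimum over the kernel of the composite
projection. -/
theorem fiberNorm_toFiber (P : Seminorm ℂ R) (x : X) (f : R) :
    fiberNorm γ I P x (toFiber γ I x f) = ⨅ h : fiberKernel γ I x, P (f + h) := by
  refine le_antisymm (le_ciInf fun h => ?_) (le_fiberNorm fun g hg => ?_)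
  · have : toFiber γ I x f = toFiber γ I x (f + h) := by
      rw [map_add, toFiber_eq_zero_iff.2 h.2, add_zero]
    rw [this]
    exact fiberNorm_toFiber_le P x _
  · refine (ciInf_le ⟨0, ?_⟩ (⟨g - f, toFiber_eq_iff.1 hg⟩ : fiberKernel γ I x)).trans ?_
    · rintro _ ⟨h, rfl⟩
      exact apply_nonneg _ _
    · rw [add_sub_cancel]

end QuotientFibers

/-! ## Algebras of functions with values in a Fréchet space -/

section EvaluationModel

variable {X : Type} [TopologicalSpace X] {K : Type} [CommRing K] [Algebra ℂ K]
  {γ : K →ₐ[ℂ] C(X, ℂ)} {R : Type} [Ring R] [Algebra ℂ R] [Algebra K R] [IsScalarTower ℂ K R]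
  [TopologicalSpace R] [IsTopologicalRing R] {I : Ideal R} [I.IsTwoSided]
  {F : Type} [AddCommGroup F] [Module ℂ F] [TopologicalSpace F] [IsTopologicalAddGroup F]

/-- The conditions on an algebra `R` of functions on `X` with values in a Fréchet space `F`, and on
an ideal `I`, under which the bundle of `R ⧸ I` is a continuous Fréchet algebra bundle. -/
structure IsEvaluationModel (γ : K →ₐ[ℂ] C(X, ℂ)) (I : Ideal R) [I.IsTwoSided]
    (p : SeminormFamily ℂ F ℕ) (ev : X → R →ₗ[ℂ] F) (const : F →ₗ[ℂ] R) : Prop where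
  withSeminorms : WithSeminorms p
  mono : Monotone p
  complete : @CompleteSpace F (IsTopologicalAddGroup.rightUniformSpace F)
  ev_const : ∀ x a, ev x (const a) = a
  continuous_const : Continuous const
  ev_algebraMap_mul : ∀ x k f, ev x (algebraMap K R k * f) = γ k x • ev x f
  ev_mul_le : ∀ i x f g, p i (ev x (f * g)) ≤ p i (ev x f) * p i (ev x g)
  sub_const_mem : ∀ x f, f - const (ev x f) ∈ fiberKernel γ I x
  exists_sup : ∀ i (S : Set X), IsCompact S → ∃ Q : Seminorm ℂ R, Continuous Q ∧
    (∀ f, ∀ x ∈ S, p i (ev x f) ≤ Q f) ∧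
    ∀ f M, 0 ≤ M → (∀ x ∈ S, p i (ev x f) ≤ M) → Q f ≤ M
  -- The compact set S must also be convex with respect to the functions in K; this forces fiber
  -- seminorms to vanish outside S.
  exists_bound : ∀ P : Seminorm ℂ R, Continuous P → ∃ S : Set X, IsCompact S ∧
    (∃ i, ∃ C : ℝ, 0 < C ∧ ∀ f M, 0 ≤ M → (∀ x ∈ S, p i (ev x f) ≤ M) → P f ≤ C * M) ∧
    ∀ x ∉ S, ∃ k, γ k x = 1 ∧ ∃ θ : ℝ, 0 ≤ θ ∧ θ < 1 ∧ ∀ z ∈ S, ‖γ k z‖ ≤ θ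
  continuous_iInf : ∀ i f, Continuous fun x => ⨅ h : fiberKernel γ I x, p i (ev x (f + h))

namespace IsEvaluationModel

variable {p : SeminormFamily ℂ F ℕ} {ev : X → R →ₗ[ℂ] F} {const : F →ₗ[ℂ] R}
  (hm : IsEvaluationModel γ I p ev const)

variable (γ I p ev) in
/-- The quotient norm on the fiber over `x` of the seminorm `f ↦ p i (f x)`. -/
def norm (i : ℕ) : FibSeminorm (Fiber γ (R ⧸ I)) := fun x => fiberNorm γ I ((p i).comp (ev x)) x

include hm

omit [IsScalarTower ℂ K R] in
theorem toFiber_const (x : X) (f : R) :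
    toFiber γ I x (const (ev x f)) = toFiber γ I x f :=
  (toFiber_eq_iff.2 (hm.sub_const_mem x f)).symm

omit [IsScalarTower ℂ K R] in
theorem directed (i j : ℕ) : ∃ k, p i ≤ p k ∧ p j ≤ p k :=
  ⟨max i j, hm.mono (le_max_left i j), hm.mono (le_max_right i j)⟩

omit [IsScalarTower ℂ K R] in
theorem norm_mono {i j : ℕ} (hij : i ≤ j) (x : X) : norm γ I p ev i x ≤ norm γ I p ev j x :=
  fiberNorm_mono (fun _ => hm.mono hij _) x

omit [IsScalarTower ℂ K R] in
-- A class over x is represented by the constant with the same value, which gives the bound over S.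
-- For x outside S it is also represented by k^N times that constant, where k(x) = 1 and |k| ≤ θ < 1
-- on S, and these representatives tend to 0 in P.
theorem exists_bound_fiberSeminorm {P : Seminorm ℂ (R ⧸ I)} (hP : Continuous P) :
    ∃ S : Set X, IsCompact S ∧ ∃ i, ∃ C : ℝ, 0 < C ∧ ∀ x (v : Fiber γ (R ⧸ I) x),
      (x ∈ S → fiberSeminorm γ (R ⧸ I) P x v ≤ C * norm γ I p ev i x v) ∧
      (x ∉ S → fiberSeminorm γ (R ⧸ I) P x v = 0) := by
  obtain ⟨S, hS, ⟨i, C, hC, hle⟩, hsep⟩ := hm.exists_bound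
    (P.comp (Ideal.Quotient.mkₐ ℂ I).toLinearMap) (hP.comp continuous_quot_mk)
  have hbound : ∀ x f, fiberSeminorm γ (R ⧸ I) P x (toFiber γ I x f) ≤ P (Ideal.Quotient.mk I f) :=
    fun x f => fiberSeminorm_germ_le γ P _ x
  refine ⟨S, hS, i, C, hC, fun x v => ⟨fun _ => ?_, fun hx => ?_⟩⟩
  · rw [← div_le_iff₀' hC]
    refine le_fiberNorm fun f hf => ?_
    rw [div_le_iff₀' hC, ← hf, ← hm.toFiber_const x f]
    refine (hbound _ _).trans (hle _ _ (apply_nonneg _ _) fun z _ => ?_)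
    rw [hm.ev_const]
    rfl
  · obtain ⟨f, rfl⟩ := toFiber_surjective (γ := γ) (I := I) x v
    obtain ⟨k, hk, θ, hθ0, hθ1, hθ⟩ := hsep x hx
    refine le_antisymm ?_ (apply_nonneg _ _)
    have hlim : Tendsto (fun N : ℕ => C * (θ ^ N * p i (ev x f))) atTop (𝓝 0) := by
      have := ((tendsto_pow_atTop_nhds_zero_of_lt_one hθ0 hθ1).mul_const (p i (ev x f))).const_mul C
      simpa using this
    refine ge_of_tendsto' hlim fun N => ?_
    have hev : ∀ z, ev z (algebraMap K R (k ^ N) * const (ev x f)) = γ k z ^ N • ev x f :=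
      fun z => by rw [hm.ev_algebraMap_mul, hm.ev_const, map_pow, ContinuousMap.pow_apply]
    have heq : toFiber γ I x f = toFiber γ I x (algebraMap K R (k ^ N) * const (ev x f)) := by
      rw [← hm.toFiber_const x (algebraMap K R (k ^ N) * const (ev x f)), hev, hk, one_pow,
        one_smul, hm.toFiber_const]
    rw [heq]
    refine (hbound _ _).trans (hle _ _ (by positivity) fun z hz => ?_)
    rw [hev, map_smul_eq_mul, norm_pow]
    gcongr
    exact hθ z hz

omit [IsScalarTower ℂ K R] in
theorem exists_seminorm_mul_le {P : Seminorm ℂ (R ⧸ I)} (hP : Continuous P) :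
    ∃ Q : Seminorm ℂ (R ⧸ I), Continuous Q ∧ ∀ a b, P (a * b) ≤ Q a * Q b := by
  obtain ⟨S, hS, ⟨i, C, hC, hle⟩, -⟩ := hm.exists_bound
    (P.comp (Ideal.Quotient.mkₐ ℂ I).toLinearMap) (hP.comp continuous_quot_mk)
  obtain ⟨Q, hQ, hQ1, -⟩ := hm.exists_sup i S hS
  -- C ≤ c² for c = C + 1, so the constant can be distributed over the two factors.
  set c : ℝ≥0 := ⟨C, hC.le⟩ + 1 with hc
  have hc' : (c : ℝ) = C + 1 := rfl
  refine ⟨c • quotSeminorm I Q, (continuous_quotSeminorm hQ).const_smul c, fun a b => ?_⟩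
  have key : ∀ f g : R, P (Ideal.Quotient.mk I (f * g)) ≤ (c • Q) f * (c • Q) g := fun f g => by
    have h0 : 0 ≤ Q f * Q g := mul_nonneg (apply_nonneg _ _) (apply_nonneg _ _)
    have h1 := hle (f * g) (Q f * Q g) h0 fun x hx => (hm.ev_mul_le i x f g).trans
      (mul_le_mul (hQ1 f x hx) (hQ1 g x hx) (apply_nonneg _ _) (apply_nonneg _ _))
    refine h1.trans ?_
    change C * (Q f * Q g) ≤ ((c : ℝ) * Q f) * ((c : ℝ) * Q g)
    rw [hc']
    have : C * (Q f * Q g) ≤ ((C + 1) * (C + 1)) * (Q f * Q g) := by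
      apply mul_le_mul_of_nonneg_right _ h0
      nlinarith
    linarith
  have h2 : ∀ v : R ⧸ I, quotSeminorm I (c • Q) v ≤ (c • quotSeminorm I Q) v := fun v =>
    quotSeminorm_le_of_le (C := c) (by rw [hc']; positivity) (fun a => le_rfl) v
  obtain ⟨f, rfl⟩ := Ideal.Quotient.mk_surjective a
  obtain ⟨g, rfl⟩ := Ideal.Quotient.mk_surjective b
  have h3 : P (Ideal.Quotient.mk I f * Ideal.Quotient.mk I g) ≤
      quotSeminorm I (P.comp (Ideal.Quotient.mkₐ ℂ I).toLinearMap)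
        (Ideal.Quotient.mk I f * Ideal.Quotient.mk I g) :=
    le_quotSeminorm fun h hh => by rw [← hh]; rfl
  exact (h3.trans (quotSeminorm_mul_le key _ _)).trans
    (mul_le_mul (h2 _) (h2 _) (apply_nonneg _ _) (apply_nonneg _ _))

/-- The sequence `norm i` alone generates the topology of each fiber. For the converse direction the
supremum seminorm over the compact set {x} is used. -/
theorem mem_nhds_fiber_iff {x : X} {v : Fiber γ (R ⧸ I) x} {W : Set (Fiber γ (R ⧸ I) x)} :
    W ∈ @nhds _ (TopologicalSpace.induced (fun v => (⟨x, v⟩ : Tot (Fiber γ (R ⧸ I))))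
      (fiberTopology γ (R ⧸ I))) v ↔
      ∃ i, ∃ ε : ℝ, 0 < ε ∧ (norm γ I p ev i x).ball v ε ⊆ W := by
  let _ := fiberTopology γ (R ⧸ I)
  rw [(isTubeTopology_bundleOf (A := R ⧸ I) γ).mem_nhds_induced_iff]
  constructor
  · rintro ⟨_, ⟨P, hP, rfl⟩, ε, hε, hsub⟩
    obtain ⟨S, -, i, C, hC, hle⟩ := hm.exists_bound_fiberSeminorm hP
    refine ⟨i, ε / C, div_pos hε hC, fun w hw => hsub ?_⟩
    rw [Seminorm.mem_ball] at hw ⊢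
    by_cases hx : x ∈ S
    · rw [lt_div_iff₀' hC] at hw
      exact ((hle x _).1 hx).trans_lt hw
    · rwa [(hle x _).2 hx]
  · rintro ⟨i, ε, hε, hsub⟩
    obtain ⟨Q, hQ, hQ1, -⟩ := hm.exists_sup i {x} isCompact_singleton
    refine ⟨_, ⟨_, continuous_quotSeminorm hQ, rfl⟩, ε, hε, fun w hw => hsub ?_⟩
    rw [Seminorm.mem_ball] at hw ⊢
    exact (fiberNorm_mono (Q := Q) (fun f => hQ1 f x rfl) x _).trans_lt hw

/-- Constants map F onto the fiber, continuously and openly by the form of the quotient norms, so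
completeness descends from F. -/
theorem isFrechetAlgebra_fiber (x : X) : @IsFrechetAlgebra (Fiber γ (R ⧸ I) x) _ _
    (TopologicalSpace.induced (fun v => (⟨x, v⟩ : Tot (Fiber γ (R ⧸ I))))
      (fiberTopology γ (R ⧸ I))) := by
  let tE := fiberTopology γ (R ⧸ I)
  let t := TopologicalSpace.induced (fun v => (⟨x, v⟩ : Tot (Fiber γ (R ⧸ I)))) tE
  have hdir : ∀ i j, ∃ k, norm γ I p ev i x ≤ norm γ I p ev k x ∧
      norm γ I p ev j x ≤ norm γ I p ev k x := fun i j =>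
    ⟨max i j, hm.norm_mono (le_max_left i j) x, hm.norm_mono (le_max_right i j) x⟩
  have hws : WithSeminorms (fun i => norm γ I p ev i x) :=
    withSeminorms_of_mem_nhds_iff hdir fun v W => hm.mem_nhds_fiber_iff
  have htube := isTubeTopology_bundleOf (A := R ⧸ I) γ
  have hcm := htube.continuous_mul (fun _ hs _ ht => mul_mem_germSections γ hs ht)
    (fiberSeminorms_mul_le γ fun P hP => hm.exists_seminorm_mul_le hP)
  have hmul : Continuous fun q : Fiber γ (R ⧸ I) x × Fiber γ (R ⧸ I) x => q.1 * q.2 := by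
    refine continuous_induced_rng.2 ?_
    let _ := fibProdTopology (Fiber γ (R ⧸ I))
    have hind : Continuous (fun v : Fiber γ (R ⧸ I) x => (⟨x, v⟩ : Tot (Fiber γ (R ⧸ I)))) :=
      continuous_induced_dom
    have : Continuous fun q : Fiber γ (R ⧸ I) x × Fiber γ (R ⧸ I) x =>
        (⟨x, q⟩ : Tot fun x => Fiber γ (R ⧸ I) x × Fiber γ (R ⧸ I) x) :=
      continuous_induced_rng.2 ((hind.comp continuous_fst).prodMk (hind.comp continuous_snd))
    exact hcm.comp this
  have hfc := hm.withSeminorms.firstCountableTopology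
  let c : F →+ Fiber γ (R ⧸ I) x := ((toFiber γ I x).toLinearMap ∘ₗ const).toAddMonoidHom
  have hc : ∀ a, c a = toFiber γ I x (const a) := fun _ => rfl
  have hle : ∀ i a, norm γ I p ev i x (c a) ≤ p i a := fun i a => by
    refine (fiberNorm_toFiber_le _ x (const a)).trans (le_of_eq ?_)
    change p i (ev x (const a)) = p i a
    rw [hm.ev_const]
  have hsurj : Function.Surjective c := fun v => by
    obtain ⟨f, rfl⟩ := toFiber_surjective (γ := γ) (I := I) x v
    exact ⟨ev x f, hm.toFiber_const x f⟩
  have hcont : Continuous c := continuous_iff_continuousAt.2 fun a =>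
    (hws.tendsto_nhds _ _).2 fun i ε hε => by
      filter_upwards [(hm.withSeminorms.tendsto_nhds id a).1 tendsto_id i ε hε] with b hb
      rw [← map_sub]
      exact (hle i _).trans_lt hb
  have hopen : IsOpenMap c := isOpenMap_iff_nhds_le.2 fun a W hW => by
    obtain ⟨i, ε, hε, hsub⟩ :=
      (mem_nhds_iff_of_directed hm.withSeminorms hm.directed).1 (mem_map.1 hW)
    refine hm.mem_nhds_fiber_iff.2 ⟨i, ε, hε, fun v hv => ?_⟩
    obtain ⟨g, hg, hlt⟩ := exists_of_fiberNorm_lt ((Seminorm.mem_ball _).1 hv)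
    have hb : a + ev x g ∈ c ⁻¹' W := hsub (by
      rw [Seminorm.mem_ball, add_sub_cancel_left]
      exact hlt)
    have : c (a + ev x g) = v := by
      rw [map_add, hc (ev x g), hm.toFiber_const, hg, add_sub_cancel]
    exact this ▸ hb
  refine isFrechetAlgebra_of_seminorms hws hmul (fun v hv => ?_) c ⟨hsurj, hcont, hopen⟩
    hm.complete
  obtain ⟨a, rfl⟩ := hsurj v
  -- If all norms of the class of a vanish, then a is a limit of elements a - g(x) whose constants
  -- lie in the kernel, and the kernel is closed.
  have hcl : IsClosed {b : F | const b ∈ fiberKernel γ I x} :=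
    (isClosed_fiberKernel x).preimage hm.continuous_const
  rw [hc, toFiber_eq_zero_iff]
  refine hcl.closure_subset (mem_closure_iff_nhds.2 fun W hW => ?_)
  obtain ⟨i, ε, hε, hsub⟩ := (mem_nhds_iff_of_directed hm.withSeminorms hm.directed).1 hW
  obtain ⟨g, hg, hlt⟩ := exists_of_fiberNorm_lt (show _ < ε from (hv i).trans_lt hε)
  refine ⟨a - ev x g, hsub ?_, ?_⟩
  · rw [Seminorm.mem_ball, sub_sub_cancel_left, map_neg_eq_map]
    exact hlt
  · change const (a - ev x g) ∈ fiberKernel γ I x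
    rw [← toFiber_eq_zero_iff, map_sub, map_sub, hm.toFiber_const, hg, hc, sub_self]

variable (γ I p ev) in
omit hm [IsScalarTower ℂ K R] [IsTopologicalAddGroup F] [TopologicalSpace F] in
/-- The products of the norms `norm i` with compactly supported functions. -/
def cutoffNorms : Set (FibSeminorm (Fiber γ (R ⧸ I))) :=
  {N | ∃ φ : C(X, ℝ≥0), HasCompactSupport φ ∧ ∃ i, N = fun x => φ x • norm γ I p ev i x}

omit [IsScalarTower ℂ K R] in
theorem isDirectedFamily_cutoffNorms : IsDirectedFamily (cutoffNorms γ I p ev) := by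
  rintro _ ⟨φ, hφ, i, rfl⟩ _ ⟨ψ, hψ, j, rfl⟩
  refine ⟨_, ⟨φ + ψ, hφ.add hψ, max i j, rfl⟩, 1, one_pos, fun v => ?_⟩
  have h1 := hm.norm_mono (le_max_left i j) v.proj v.snd
  have h2 := hm.norm_mono (le_max_right i j) v.proj v.snd
  simp only [one_mul]
  constructor
  · change (φ v.proj : ℝ) * norm γ I p ev i v.proj v.snd ≤
      ((φ v.proj + ψ v.proj : ℝ≥0) : ℝ) * norm γ I p ev (max i j) v.proj v.snd
    exact mul_le_mul (by exact_mod_cast le_self_add) h1 (apply_nonneg _ _) NNReal.zero_le_coe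
  · change (ψ v.proj : ℝ) * norm γ I p ev j v.proj v.snd ≤
      ((φ v.proj + ψ v.proj : ℝ≥0) : ℝ) * norm γ I p ev (max i j) v.proj v.snd
    exact mul_le_mul (by exact_mod_cast le_add_self) h2 (apply_nonneg _ _) NNReal.zero_le_coe

omit [IsScalarTower ℂ K R] in
-- The cutoff function equals 1 on S, and off S the seminorm to be dominated is 0.
theorem isDominatedBy_cutoffNorms [T2Space X] [LocallyCompactSpace X] :
    IsDominatedBy (fiberSeminorms γ (R ⧸ I)) (cutoffNorms γ I p ev) := by
  rintro _ ⟨P, hP, rfl⟩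
  obtain ⟨S, hS, i, C, hC, hle⟩ := hm.exists_bound_fiberSeminorm hP
  obtain ⟨φ, hφ1, -, hφc, -⟩ := exists_continuous_one_zero_of_isCompact hS isClosed_empty
    (Set.disjoint_empty S)
  let ψ : C(X, ℝ≥0) := ⟨fun x => Real.toNNReal (φ x), by fun_prop⟩
  have hψc : HasCompactSupport ψ := hφc.comp_left (g := Real.toNNReal) Real.toNNReal_zero
  refine ⟨_, ⟨ψ, hψc, i, rfl⟩, C, hC, fun v => ?_⟩
  by_cases hv : v.proj ∈ S
  · have h1 : ψ v.proj = 1 := by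
      change Real.toNNReal (φ v.proj) = 1
      rw [hφ1 hv, Pi.one_apply, Real.toNNReal_one]
    change _ ≤ C * ((ψ v.proj : ℝ) * norm γ I p ev i v.proj v.snd)
    rw [h1, NNReal.coe_one, one_mul]
    exact (hle _ _).1 hv
  · refine ((hle _ v.snd).2 hv).le.trans (mul_nonneg hC.le (apply_nonneg _ _))

omit [IsScalarTower ℂ K R] in
-- The function φ is bounded, and over its support `norm i` is at most the quotient of the supremum
-- seminorm over that compact set.
theorem cutoffNorms_isDominatedBy :
    IsDominatedBy (cutoffNorms γ I p ev) (fiberSeminorms γ (R ⧸ I)) := by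
  rintro _ ⟨φ, hφ, i, rfl⟩
  obtain ⟨Q, hQ, hQ1, -⟩ := hm.exists_sup i (tsupport φ) hφ
  obtain ⟨C, hC⟩ := hφ.isCompact.bddAbove_image φ.continuous.continuousOn
  refine ⟨_, ⟨_, continuous_quotSeminorm hQ, rfl⟩, C + 1, by positivity, fun v => ?_⟩
  change (φ v.proj : ℝ) * norm γ I p ev i v.proj v.snd ≤
    (C + 1) * fiberNorm γ I Q v.proj v.snd
  by_cases hv : v.proj ∈ tsupport φ
  · have h1 : φ v.proj ≤ C := hC ⟨_, hv, rfl⟩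
    have h2 : (φ v.proj : ℝ) ≤ C + 1 := by
      have : (φ v.proj : ℝ) ≤ C := by exact_mod_cast h1
      linarith
    exact mul_le_mul h2 (fiberNorm_mono (fun f => hQ1 f _ hv) _ _) (apply_nonneg _ _)
      (by positivity)
  · rw [image_eq_zero_of_notMem_tsupport hv, NNReal.coe_zero, zero_mul]
    exact mul_nonneg (by positivity) (apply_nonneg _ _)

omit [IsScalarTower ℂ K R] in
theorem continuous_cutoffNorms {N : FibSeminorm (Fiber γ (R ⧸ I))}
    (hN : N ∈ cutoffNorms γ I p ev) (u : R ⧸ I) :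
    Continuous fun x => N x (germ γ (R ⧸ I) u x) := by
  obtain ⟨φ, -, i, rfl⟩ := hN
  obtain ⟨f, rfl⟩ := Ideal.Quotient.mk_surjective u
  have h : ∀ x, norm γ I p ev i x (germ γ (R ⧸ I) (Ideal.Quotient.mk I f) x) =
      ⨅ h : fiberKernel γ I x, p i (ev x (f + h)) := fun x => fiberNorm_toFiber _ x f
  change Continuous fun x => (φ x : ℝ) *
    norm γ I p ev i x (germ γ (R ⧸ I) (Ideal.Quotient.mk I f) x)
  simp_rw [h]
  exact (NNReal.continuous_coe.comp φ.continuous).mul (hm.continuous_iInf i f)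

theorem isFrechetAlgebraBundle_and_isContinuous [T2Space X] [LocallyCompactSpace X] :
    (bundleOf γ (R ⧸ I)).IsFrechetAlgebraBundle ∧ (bundleOf γ (R ⧸ I)).IsContinuous :=
  ⟨isFrechetAlgebraBundle_bundleOf γ (fun _ hP => hm.exists_seminorm_mul_le hP)
      hm.isFrechetAlgebra_fiber,
    isContinuous_bundleOf γ hm.isDirectedFamily_cutoffNorms hm.isDominatedBy_cutoffNorms
      hm.cutoffNorms_isDominatedBy fun _ hN u => hm.continuous_cutoffNorms hN u⟩

end IsEvaluationModel

end EvaluationModel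

/-! ## Seminorms on algebras of holomorphic functions -/

instance {U : Set ℂ} {F : Type} [Ring F] [Algebra ℂ F] [TopologicalSpace F] [IsTopologicalRing F]
    [ContinuousSMul ℂ F] : IsScalarTower ℂ (holo U ℂ) (holo U F) :=
  IsScalarTower.of_algebraMap_eq fun _ => rfl

/-- The closed annulus `1 / R ≤ |z| ≤ R`. -/
def annulus (R : ℝ) : Set Cx := {z | ‖(z : ℂ)‖ ≤ R ∧ 1 ≤ R * ‖(z : ℂ)‖}

theorem isCompact_annulus (R : ℝ) : IsCompact (annulus R) := by
  rw [IsEmbedding.subtypeVal.isCompact_iff]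
  have h : Subtype.val '' annulus R = Metric.closedBall (0 : ℂ) R ∩ {z | 1 ≤ R * ‖z‖} := by
    ext z
    constructor
    · rintro ⟨w, hw, rfl⟩
      exact ⟨by simpa using hw.1, hw.2⟩
    · rintro ⟨h1, h2⟩
      refine ⟨⟨z, ?_⟩, ⟨by simpa using h1, h2⟩, rfl⟩
      rintro rfl
      rw [Set.mem_ofPred_eq, norm_zero, mul_zero] at h2
      linarith
  rw [h]
  exact (isCompact_closedBall 0 R).inter_right (isClosed_le (by fun_prop) (by fun_prop))

theorem exists_subset_annulus {K : Set Cx} (hK : IsCompact K) : ∃ R, 0 < R ∧ K ⊆ annulus R := by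
  have hne : ∀ z : Cx, (z : ℂ) ≠ 0 := fun z => z.2
  obtain ⟨R₁, h₁⟩ := hK.exists_bound_of_continuousOn (f := fun z : Cx => (z : ℂ)) (by fun_prop)
  obtain ⟨R₂, h₂⟩ := hK.exists_bound_of_continuousOn (f := fun z : Cx => (z : ℂ)⁻¹)
    (continuous_subtype_val.inv₀ hne).continuousOn
  refine ⟨max 1 (max R₁ R₂), by positivity, fun z hz => ⟨(h₁ z hz).trans (by simp), ?_⟩⟩
  have h := h₂ z hz
  have hz0 : 0 < ‖(z : ℂ)‖ := norm_pos_iff.2 (hne z)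
  rw [norm_inv] at h
  have : 1 ≤ R₂ * ‖(z : ℂ)‖ := by rwa [inv_le_iff_one_le_mul₀ hz0] at h
  exact this.trans (mul_le_mul_of_nonneg_right (by simp) hz0.le)

/-- The function `1 / z` on the punctured plane. -/
def coordInv : holo Cx ℂ :=
  ⟨⟨fun z => (z : ℂ)⁻¹, continuous_subtype_val.inv₀ fun z => z.2⟩, fun z => by
    have hz : (z : ℂ) ≠ 0 := z.2
    have hd := (hasDerivAt_inv hz)
    rw [hasDerivAt_iff_tendsto_slope, ← map_val_nhdsNE (U := Cx) isOpen_compl_singleton z,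
      tendsto_map'_iff] at hd
    exact ⟨_, hd.congr fun w => by simp [slope]⟩⟩

/-- Points outside an annulus are separated from it by a holomorphic function. -/
theorem exists_holo_lt_one {R : ℝ} (hR : 0 < R) {q : Cx} (hq : q ∉ annulus R) :
    ∃ g : holo Cx ℂ, g.1 q = 1 ∧ ∃ θ : ℝ, 0 ≤ θ ∧ θ < 1 ∧ ∀ z ∈ annulus R, ‖g.1 z‖ ≤ θ := by
  have hq0 : (q : ℂ) ≠ 0 := q.2
  have hqn : 0 < ‖(q : ℂ)‖ := norm_pos_iff.2 hq0
  -- The separating function is q/z for |q| < 1/R and z/q for |q| > R.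
  by_cases h : ‖(q : ℂ)‖ ≤ R
  · have h' : R * ‖(q : ℂ)‖ < 1 := not_le.1 fun h2 => hq ⟨h, h2⟩
    refine ⟨(q : ℂ) • coordInv, ?_, R * ‖(q : ℂ)‖, by positivity, h', fun z hz => ?_⟩
    · change (q : ℂ) * (q : ℂ)⁻¹ = 1
      exact mul_inv_cancel₀ hq0
    · change ‖(q : ℂ) * (z : ℂ)⁻¹‖ ≤ _
      have hz0 : 0 < ‖(z : ℂ)‖ := norm_pos_iff.2 z.2
      rw [norm_mul, norm_inv, mul_comm]
      refine mul_le_mul_of_nonneg_right ?_ hqn.le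
      rw [inv_le_iff_one_le_mul₀ hz0]
      exact hz.2
  · refine ⟨(q : ℂ)⁻¹ • coord, ?_, R / ‖(q : ℂ)‖, by positivity,
      (div_lt_one hqn).2 (not_le.1 h), fun z hz => ?_⟩
    · change (q : ℂ)⁻¹ * (q : ℂ) = 1
      exact inv_mul_cancel₀ hq0
    · change ‖(q : ℂ)⁻¹ * (z : ℂ)‖ ≤ _
      rw [norm_mul, norm_inv, inv_mul_eq_div]
      exact div_le_div_of_nonneg_right hz.1 hqn.le

section HoloSeminorms

variable {F : Type} [Ring F] [Algebra ℂ F] [TopologicalSpace F] [IsTopologicalRing F]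
  [ContinuousSMul ℂ F]

/-- Evaluation at a point. -/
def evalHolo (q : Cx) : holo Cx F →ₗ[ℂ] F :=
  { toFun := fun f => f.1 q, map_add' := fun _ _ => rfl, map_smul' := fun _ _ => rfl }

variable (F) in
/-- The inclusion of the constant functions. -/
def holoConstₗ : F →ₗ[ℂ] holo Cx F :=
  { toFun := holoConst, map_add' := fun _ _ => rfl, map_smul' := fun _ _ => rfl }

omit [ContinuousSMul ℂ F] in
theorem bddAbove_seminorm_range {K : Set Cx} (hK : IsCompact K) {P : Seminorm ℂ F}
    (hP : Continuous P) (f : holo Cx F) : BddAbove (Set.range fun z : K => P (f.1 z)) := by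
  have := hK.bddAbove_image (f := fun z => P (f.1 z)) (hP.comp f.1.continuous).continuousOn
  rwa [Set.image_eq_range] at this

/-- The seminorm `f ↦ sup_{z ∈ K} P (f z)`. -/
def supSeminorm {K : Set Cx} (hK : IsCompact K) {P : Seminorm ℂ F} (hP : Continuous P) :
    Seminorm ℂ (holo Cx F) :=
  Seminorm.of (fun f => ⨆ z : K, P (f.1 z))
    (fun f g => by
      refine Real.iSup_le (fun z => ?_) (add_nonneg (Real.iSup_nonneg fun _ => apply_nonneg _ _)
        (Real.iSup_nonneg fun _ => apply_nonneg _ _))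
      exact (map_add_le_add P _ _).trans (add_le_add
        (le_ciSup (bddAbove_seminorm_range hK hP f) z)
        (le_ciSup (bddAbove_seminorm_range hK hP g) z)))
    (fun c f => by
      rw [Real.mul_iSup_of_nonneg (norm_nonneg c)]
      exact iSup_congr fun z => map_smul_eq_mul P c _)

omit [ContinuousSMul ℂ F] in
theorem le_supSeminorm {K : Set Cx} (hK : IsCompact K) {P : Seminorm ℂ F} (hP : Continuous P)
    (f : holo Cx F) {z : Cx} (hz : z ∈ K) : P (f.1 z) ≤ supSeminorm hK hP f :=
  le_ciSup (bddAbove_seminorm_range hK hP f) ⟨z, hz⟩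

omit [ContinuousSMul ℂ F] in
theorem supSeminorm_le {K : Set Cx} (hK : IsCompact K) {P : Seminorm ℂ F} (hP : Continuous P)
    {f : holo Cx F} {M : ℝ} (hM : 0 ≤ M) (h : ∀ z ∈ K, P (f.1 z) ≤ M) : supSeminorm hK hP f ≤ M :=
  Real.iSup_le (fun z => h z z.2) hM

theorem continuous_supSeminorm {K : Set Cx} (hK : IsCompact K) {P : Seminorm ℂ F}
    (hP : Continuous P) : Continuous (supSeminorm hK hP) := by
  refine Seminorm.continuous_of_forall' fun r hr => ?_
  have hball : IsOpen {x : F | P x < r} := isOpen_Iio.preimage hP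
  have hT : {f : C(Cx, F) | Set.MapsTo f K {x : F | P x < r}} ∈ 𝓝 ((0 : holo Cx F) : C(Cx, F)) :=
    (ContinuousMap.isOpen_setOfPred_mapsTo hK hball).mem_nhds fun z _ => by
      change P 0 < r
      simpa using hr
  filter_upwards [(continuous_subtype_val.tendsto (0 : holo Cx F)) hT] with f hf
  rw [Seminorm.mem_closedBall, sub_zero]
  exact supSeminorm_le hK hP hr.le fun z hz => (hf hz).le

omit [ContinuousSMul ℂ F] in
theorem continuous_holoConst : Continuous (holoConst : F → holo Cx F) :=
  ContinuousMap.continuous_const'.subtype_mk _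

omit [ContinuousSMul ℂ F] in
/-- A continuous seminorm on `𝒪(ℂˣ, F)` is controlled by a seminorm of `F` on an annulus. -/
theorem exists_bound_of_continuous_seminorm {ι : Type} [Nonempty ι] {p : SeminormFamily ℂ F ι}
    (hp : WithSeminorms p) (hd : ∀ i j, ∃ k, p i ≤ p k ∧ p j ≤ p k) {P : Seminorm ℂ (holo Cx F)}
    (hP : Continuous P) : ∃ R, 0 < R ∧ ∃ i, ∃ C, 0 < C ∧ ∀ (f : holo Cx F) (M : ℝ), 0 ≤ M →
      (∀ z ∈ annulus R, p i (f.1 z) ≤ M) → P f ≤ C * M := by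
  have hU : {f : holo Cx F | P f < 1} ∈ 𝓝 (0 : holo Cx F) :=
    (isOpen_Iio.preimage hP).mem_nhds (by simp)
  rw [nhds_induced] at hU
  obtain ⟨T, hT, hTU⟩ := hU
  have hbasis : (𝓝 (0 : F)).HasBasis (fun iε : ι × ℝ => 0 < iε.2)
      fun iε => (p iε.1).ball 0 iε.2 := ⟨fun W => by
    rw [mem_nhds_iff_of_directed hp hd]
    simp [Prod.exists]⟩
  obtain ⟨⟨K, i, ε⟩, ⟨hK, hε⟩, hsub⟩ := (hbasis.nhds_continuousMapConst (X := Cx)).mem_iff.1 hT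
  obtain ⟨R, hR, hKR⟩ := exists_subset_annulus hK
  have hε' : 0 < ε := hε
  refine ⟨R, hR, i, 2 / ε, by positivity, fun f M hM hf => ?_⟩
  refine le_of_forall_pos_le_add fun t ht => ?_
  -- The term with t keeps s positive when M = 0. Scaling f by c moves it into the neighborhood {P <
  -- 1}, whence P f < 1/c = (2/ε) M + t.
  have hs : 0 < M + t * ε / 2 := by positivity
  set s := M + t * ε / 2
  set c : ℝ := ε / 2 / s
  have hc : 0 < c := by positivity
  have hmem : ((c : ℂ) • f) ∈ {f : holo Cx F | P f < 1} := by
    refine hTU (hsub fun z hz => ?_)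
    rw [Seminorm.mem_ball, sub_zero]
    change p i ((c : ℂ) • f.1 z) < ε
    rw [map_smul_eq_mul, Complex.norm_real, Real.norm_of_nonneg hc.le]
    calc c * p i (f.1 z) ≤ c * s := by
          gcongr
          exact (hf z (hKR hz)).trans (le_add_of_nonneg_right (by positivity))
      _ = ε / 2 := div_mul_cancel₀ _ hs.ne'
      _ < ε := half_lt_self hε'
  rw [Set.mem_ofPred_eq, map_smul_eq_mul, Complex.norm_real, Real.norm_of_nonneg hc.le] at hmem
  have h1 : P f < 1 / c := by rwa [lt_div_iff₀' hc]
  refine h1.le.trans (le_of_eq ?_)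
  simp only [c, s]
  field_simp

end HoloSeminorms

/-! ## The fibers of the deformation algebras -/

section DeformationFibers

variable {n : ℕ} {ι : Type} {p : ι → ExtNorm (FreeSeries n)} {ζ : Fin n → finitePart p}

variable (hp : IsSolidFamily p)
include hp

theorem sub_holoConst_mem_fiberKernel (q : Cx) (f : holo Cx (finitePart p)) :
    f - holoConst (f.1 q) ∈ fiberKernel (holo Cx ℂ).val (defIdeal ζ) q := by
  obtain ⟨g, hg⟩ := holo_exists_factor (U := Cx) isOpen_compl_singleton
    (withSeminorms_finitePart p) hp.completeSpace f q
  have h : f - holoConst (f.1 q) =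
      algebraMap (holo Cx ℂ) (holo Cx (finitePart p)) (coord - algebraMap ℂ (holo Cx ℂ) q) * g := by
    refine Subtype.ext (ContinuousMap.ext fun z => ?_)
    change f.1 z - f.1 q = algebraMap ℂ (finitePart p) ((z : ℂ) - q) * g.1 z
    rw [← Algebra.smul_def, ← hg z]
  rw [h]
  exact mul_mem_fiberKernel (algebraMap_mem_fiberKernel (sub_self (q : ℂ))) g

variable (hζ : ∀ j, (ζ j).1 = X j)

omit hp in
-- The constant relation at q differs from a generator of `defIdeal ζ` by (z - q) ζ_j ζ_i, and z - q
-- vanishes at q.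
theorem holoConst_relation_mem_fiberKernel (q : Cx) {i j : Fin n} (hij : i < j) :
    holoConst (ζ i * ζ j - (q : ℂ) • (ζ j * ζ i)) ∈
      fiberKernel (holo Cx ℂ).val (defIdeal ζ) q := by
  have h1 : holoConst (ζ i) * holoConst (ζ j) -
      holoScalar coord * (holoConst (ζ j) * holoConst (ζ i)) ∈
      fiberKernel (holo Cx ℂ).val (defIdeal ζ) q :=
    le_fiberKernel q (Submodule.mem_sInf.2 fun J hJ => hJ.2.2 ⟨i, j, hij, rfl⟩)
  have h2 : algebraMap (holo Cx ℂ) (holo Cx (finitePart p)) (coord - algebraMap ℂ (holo Cx ℂ) q) *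
      (holoConst (ζ j) * holoConst (ζ i)) ∈ fiberKernel (holo Cx ℂ).val (defIdeal ζ) q :=
    mul_mem_fiberKernel (algebraMap_mem_fiberKernel (sub_self (q : ℂ))) _
  have h3 : holoConst (U := Cx) (ζ i * ζ j - (q : ℂ) • (ζ j * ζ i)) =
      (holoConst (ζ i) * holoConst (ζ j) -
        holoScalar coord * (holoConst (ζ j) * holoConst (ζ i))) +
      algebraMap (holo Cx ℂ) (holo Cx (finitePart p)) (coord - algebraMap ℂ (holo Cx ℂ) q) *
        (holoConst (ζ j) * holoConst (ζ i)) := by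
    refine Subtype.ext (ContinuousMap.ext fun z => ?_)
    change ζ i * ζ j - (q : ℂ) • (ζ j * ζ i) =
      (ζ i * ζ j - algebraMap ℂ (finitePart p) (z : ℂ) * (ζ j * ζ i)) +
        algebraMap ℂ (finitePart p) ((z : ℂ) - q) * (ζ j * ζ i)
    rw [← Algebra.smul_def, ← Algebra.smul_def, sub_smul]
    abel
  rw [h3]
  exact Ideal.add_mem _ h1 h2

include hζ

/-- The a whose constants lie in the kernel form a closed subspace. It contains all ζ_u (ζ_i ζ_j - q
ζ_j ζ_i) ζ_v because the kernel is a two-sided ideal. -/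
theorem holoConst_mem_fiberKernel (q : Cx) {a : finitePart p}
    (ha : a ∈ (relSubmodule p (q : ℂ)).topologicalClosure) :
    holoConst a ∈ fiberKernel (holo Cx ℂ).val (defIdeal ζ) q := by
  let N : Submodule ℂ (finitePart p) :=
    ((fiberKernel (holo Cx ℂ).val (defIdeal ζ) q).restrictScalars ℂ).comap
      (holoConstₗ (finitePart p))
  have hclosed : IsClosed (N : Set (finitePart p)) :=
    (isClosed_fiberKernel (γ := (holo Cx ℂ).val) (I := defIdeal ζ) q).preimage continuous_holoConst
  refine Submodule.topologicalClosure_minimal (t := N) _ (fun h hh => ?_) hclosed ha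
  have hle : relSpan n (q : ℂ) ≤ N.map (finitePart p).val.toLinearMap := by
    refine Submodule.span_le.2 ?_
    rintro _ ⟨u, v, i, j, hij, rfl⟩
    refine ⟨⟨monomial u, hp.monomial_mem u⟩ * (ζ i * ζ j - (q : ℂ) • (ζ j * ζ i)) *
      ⟨monomial v, hp.monomial_mem v⟩, ?_, ?_⟩
    · change holoConst ⟨monomial u, hp.monomial_mem u⟩ *
        holoConst (ζ i * ζ j - (q : ℂ) • (ζ j * ζ i)) *
        holoConst ⟨monomial v, hp.monomial_mem v⟩ ∈ fiberKernel (holo Cx ℂ).val (defIdeal ζ) q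
      exact mul_mem_fiberKernel
        (Ideal.mul_mem_left _ _ (holoConst_relation_mem_fiberKernel q hij)) _
    · change monomial u * ((ζ i).1 * (ζ j).1 - (q : ℂ) • ((ζ j).1 * (ζ i).1)) * monomial v = _
      rw [hζ, hζ, ← monomial_singleton, ← monomial_singleton, mul_sub, sub_mul, mul_smul_comm,
        smul_mul_assoc]
      simp only [monomial_mul, List.append_assoc, List.cons_append, List.nil_append]
  obtain ⟨k, hk, hkh⟩ := hle hh
  have : k = h := Subtype.ext hkh
  exact this ▸ hk

/-- The functions whose value at q lies in the closed relation space form a closed two-sided ideal.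
It contains the generators of `defIdeal ζ` and the scalar functions vanishing at q, so minimality of
the kernel applies. -/
theorem mem_closure_relSubmodule_of_mem_fiberKernel (q : Cx) {f : holo Cx (finitePart p)}
    (hf : f ∈ fiberKernel (holo Cx ℂ).val (defIdeal ζ) q) :
    f.1 q ∈ (relSubmodule p (q : ℂ)).topologicalClosure := by
  let J : Ideal (holo Cx (finitePart p)) :=
    { carrier := {f | f.1 q ∈ (relSubmodule p (q : ℂ)).topologicalClosure}
      add_mem' := fun ha hb => (relSubmodule p (q : ℂ)).topologicalClosure.add_mem ha hb
      zero_mem' := (relSubmodule p (q : ℂ)).topologicalClosure.zero_mem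
      smul_mem' := fun c _ ha => mul_mem_closure_relSubmodule hp (c.1 q) ha }
  have heval : Continuous fun f : holo Cx (finitePart p) => f.1 q :=
    (continuous_eval_const (F := C(Cx, finitePart p)) q).comp continuous_subtype_val
  have hJc : IsClosed (J : Set (holo Cx (finitePart p))) :=
    (Submodule.isClosed_topologicalClosure (relSubmodule p (q : ℂ))).preimage heval
  have hIJ : defIdeal ζ ≤ J := by
    refine sInf_le ⟨⟨fun b ha => closure_relSubmodule_mul_mem hp (b.1 q) ha⟩, hJc, ?_⟩
    rintro _ ⟨i, j, hij, rfl⟩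
    refine subset_closure (Submodule.subset_span ⟨[], [], i, j, hij, ?_⟩)
    change (ζ i).1 * (ζ j).1 - algebraMap ℂ (FreeSeries n) (q : ℂ) * ((ζ j).1 * (ζ i).1) = _
    rw [hζ, hζ, ← monomial_singleton, ← monomial_singleton, monomial_mul, monomial_mul,
      ← Algebra.smul_def]
    rfl
  refine fiberKernel_le hJc hIJ (fun k hk => ?_) hf
  have hk' : k.1 q = 0 := hk
  change (holoScalar k : holo Cx (finitePart p)).1 q ∈ (relSubmodule p (q : ℂ)).topologicalClosure
  rw [holoScalar_apply, hk', map_zero]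
  exact Submodule.zero_mem _

theorem iInf_fiberKernel_eq_relDist (i : ι) (q : Cx) (f : holo Cx (finitePart p)) :
    ⨅ h : fiberKernel (holo Cx ℂ).val (defIdeal ζ) q,
      finiteSeminorm p i (evalHolo q (f + h)) = relDist p i (q : ℂ) (f.1 q) := by
  refine le_antisymm (le_ciInf fun h => ?_) (le_ciInf fun h => ?_)
  · refine ciInf_le ⟨0, ?_⟩ (⟨holoConst h.1, holoConst_mem_fiberKernel hp hζ q
      (subset_closure h.2)⟩ : fiberKernel (holo Cx ℂ).val (defIdeal ζ) q)
    rintro _ ⟨h, rfl⟩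
    exact apply_nonneg _ _
  · exact relDist_le_of_mem_closure p _ (mem_closure_relSubmodule_of_mem_fiberKernel hp hζ q h.2)

omit hζ in
-- Both the relation space and the point f(q) move with q; the second movement is absorbed by the
-- Lipschitz bound uniform in q.
theorem continuous_relDist_comp (i : ι) (f : holo Cx (finitePart p)) :
    Continuous fun q : Cx => relDist p i (q : ℂ) (f.1 q) := by
  refine continuous_iff_continuousAt.2 fun q => Metric.tendsto_nhds.2 fun ε hε => ?_
  have hq : (q : ℂ) ≠ 0 := q.2
  have h1 := ((continuousAt_relDist hp i hq (f.1 q)).comp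
    (continuous_subtype_val (p := (· ∈ Cx))).continuousAt).eventually
      (Metric.ball_mem_nhds _ (half_pos hε))
  have h2 := ((withSeminorms_finitePart p).tendsto_nhds _ _).1 (f.1.continuous.tendsto q) i _
    (half_pos hε)
  filter_upwards [h1, h2] with w hw1 hw2
  have h3 := relDist_le_add p i (w : ℂ) (f.1 w) (f.1 q)
  have h4 := relDist_le_add p i (w : ℂ) (f.1 q) (f.1 w)
  rw [map_sub_rev] at h4
  rw [Real.dist_eq, abs_lt] at hw1
  rw [Real.dist_eq, abs_lt]
  simp only [Function.comp_apply] at hw1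
  constructor <;> linarith [hw1.1, hw1.2]

end DeformationFibers

/-! ### Deformation bundles of solid families of norms -/

section DeformationBundle

variable {n : ℕ} {ι : Type} {p : ι → ExtNorm (FreeSeries n)} {ζ : Fin n → finitePart p}

theorem withSeminorms_cofinal {s : ℕ → ι}
    (hs : ∀ l m, l ≤ m → ∀ a, (p (s l)).toFun a ≤ (p (s m)).toFun a)
    (hc : ∀ i, ∃ m, ∀ a, (p i).toFun a ≤ (p (s m)).toFun a) :
    WithSeminorms fun m => finiteSeminorm p (s m) := by
  have hle : ∀ i m, (∀ a, (p i).toFun a ≤ (p (s m)).toFun a) →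
      finiteSeminorm p i ≤ finiteSeminorm p (s m) := fun i m h a =>
    ENNReal.toReal_mono (a.2 _) (h a.1)
  have hd : ∀ i j, ∃ k, finiteSeminorm p i ≤ finiteSeminorm p k ∧
      finiteSeminorm p j ≤ finiteSeminorm p k := fun i j => by
    obtain ⟨l, hl⟩ := hc i
    obtain ⟨m, hm⟩ := hc j
    exact ⟨s (max l m), hle _ _ fun a => (hl a).trans (hs _ _ (le_max_left l m) a),
      hle _ _ fun a => (hm a).trans (hs _ _ (le_max_right l m) a)⟩
  have : Nonempty ι := ⟨s 0⟩
  refine withSeminorms_of_mem_nhds_iff (fun l m => ⟨max l m, hle _ _ (hs _ _ (le_max_left l m)),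
    hle _ _ (hs _ _ (le_max_right l m))⟩) fun x W => ?_
  rw [mem_nhds_iff_of_directed (withSeminorms_finitePart p) hd]
  constructor
  · rintro ⟨i, ε, hε, hsub⟩
    obtain ⟨m, hm⟩ := hc i
    exact ⟨m, ε, hε, (Seminorm.ball_antitone (hle i m hm)).trans hsub⟩
  · rintro ⟨m, ε, hε, hsub⟩
    exact ⟨s m, ε, hε, hsub⟩

theorem IsSolidFamily.isEvaluationModel (hp : IsSolidFamily p) (hζ : ∀ j, (ζ j).1 = X j)
    {s : ℕ → ι} (hs : ∀ l m, l ≤ m → ∀ a, (p (s l)).toFun a ≤ (p (s m)).toFun a)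
    (hc : ∀ i, ∃ m, ∀ a, (p i).toFun a ≤ (p (s m)).toFun a) :
    IsEvaluationModel (holo Cx ℂ).val (defIdeal ζ) (fun m => finiteSeminorm p (s m)) evalHolo
      (holoConstₗ (finitePart p)) := by
  have hws := withSeminorms_cofinal hs hc
  have hmono : Monotone fun m => finiteSeminorm p (s m) := fun l m hlm a =>
    ENNReal.toReal_mono (a.2 _) (hs l m hlm a.1)
  have hd : ∀ l m, ∃ k, finiteSeminorm p (s l) ≤ finiteSeminorm p (s k) ∧
      finiteSeminorm p (s m) ≤ finiteSeminorm p (s k) := fun l m =>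
    ⟨max l m, hmono (le_max_left l m), hmono (le_max_right l m)⟩
  refine
    { withSeminorms := hws
      mono := hmono
      complete := hp.completeSpace
      ev_const := fun _ _ => rfl
      continuous_const := continuous_holoConst
      ev_algebraMap_mul := fun x k f => (Algebra.smul_def (k.1 x) (f.1 x)).symm
      ev_mul_le := fun i x f g => finiteSeminorm_mul_le p (s i) (f.1 x) (g.1 x)
      sub_const_mem := fun x f => sub_holoConst_mem_fiberKernel hp x f
      exists_sup := fun i S hS => ⟨supSeminorm hS (hws.continuous_seminorm i),
        continuous_supSeminorm hS _, fun f x hx => le_supSeminorm hS _ f hx,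
        fun f M hM h => supSeminorm_le hS _ hM h⟩
      exists_bound := fun P hP => ?_
      continuous_iInf := fun i f => ?_ }
  · obtain ⟨R, hR, i, C, hC, hle⟩ := exists_bound_of_continuous_seminorm hws hd hP
    exact ⟨annulus R, isCompact_annulus R, ⟨i, C, hC, hle⟩, fun x hx => exists_holo_lt_one hR hx⟩
  · simp_rw [iInf_fiberKernel_eq_relDist hp hζ]
    exact continuous_relDist_comp hp (s i) f

theorem IsSolidFamily.isFrechetAlgebraBundle_and_isContinuous (hp : IsSolidFamily p)
    (hζ : ∀ j, (ζ j).1 = X j) :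
    (defBundle ζ).IsFrechetAlgebraBundle ∧ (defBundle ζ).IsContinuous := by
  obtain ⟨s, hs, hc⟩ := hp.cofinal
  exact (hp.isEvaluationModel hζ hs hc).isFrechetAlgebraBundle_and_isContinuous

end DeformationBundle

/-! ## The norms of the free polydisk and of the free ball -/

theorem exists_seq_radius {r : ℝ≥0∞} (hr : 0 < r) : ∃ ρ : ℕ → ℝ≥0, Monotone ρ ∧
    (∀ m, 0 < ρ m ∧ (ρ m : ℝ≥0∞) < r) ∧ ∀ t : ℝ≥0, (t : ℝ≥0∞) < r → ∃ m, t ≤ ρ m := by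
  obtain ⟨u, hu, hmem, hlim⟩ := exists_seq_strictMono_tendsto' hr
  -- The terms lie strictly below r, hence are finite even when r = ∞.
  have hfin : ∀ m, u m ≠ ∞ := fun m => ((hmem m).2.trans_le le_top).ne
  refine ⟨fun m => (u m).toNNReal, fun l m h => ENNReal.toNNReal_mono (hfin m) (hu.monotone h),
    fun m => ⟨ENNReal.toNNReal_pos (hmem m).1.ne' (hfin m), ?_⟩, fun t ht => ?_⟩
  · rw [ENNReal.coe_toNNReal (hfin m)]
    exact (hmem m).2
  · obtain ⟨m, hm⟩ := (hlim.eventually (lt_mem_nhds ht)).exists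
    exact ⟨m, (ENNReal.le_toNNReal_of_coe_le hm.le (hfin m))⟩

/-- Once D exceeds ℓ on a finite set s, the remaining terms all lie outside s and are bounded by a
tail of the convergent sum. It is applied with ℓ the word length for the disk and the degree for the
ball. -/
theorem tendsto_tsum_ite_le_zero {α : Type} (ℓ : α → ℕ) {f : α → ℝ≥0∞} (hf : ∑' x, f x ≠ ∞) :
    Tendsto (fun D => ∑' x, if ℓ x ≤ D then 0 else f x) atTop (𝓝 0) := by
  refine tendsto_order.2 ⟨fun _ h => absurd h not_lt_zero, fun ε hε => ?_⟩
  obtain ⟨s, hs⟩ := ((ENNReal.tendsto_tsum_compl_atTop_zero hf).eventually (gt_mem_nhds hε)).exists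
  filter_upwards [eventually_ge_atTop (s.sup ℓ)] with D hD
  refine lt_of_le_of_lt ?_ hs
  refine le_of_le_of_eq ?_ (tsum_subtype {x | x ∉ s} f).symm
  refine ENNReal.tsum_le_tsum fun x => ?_
  split_ifs with hx
  · exact zero_le
  · refine (Set.indicator_of_mem (?_ : x ∈ {x | x ∉ s}) f).ge
    exact fun hxs => hx ((Finset.le_sup hxs).trans hD)

theorem diskNorm_mono {n : ℕ} {ρ ρ' τ τ' : ℝ≥0} (hτ : 1 ≤ τ) (hτ' : 1 ≤ τ') (hρ : ρ ≤ ρ')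
    (h : τ ≤ τ') (a : FreeSeries n) : (diskNorm n ρ τ hτ).toFun a ≤ (diskNorm n ρ' τ' hτ').toFun a :=
  ENNReal.tsum_le_tsum fun w => by gcongr

theorem ballNorm_mono {n : ℕ} {ρ ρ' : ℝ≥0} (hρ : ρ ≤ ρ') (a : FreeSeries n) :
    (ballNorm n ρ).toFun a ≤ (ballNorm n ρ').toFun a :=
  ENNReal.tsum_le_tsum fun d => by gcongr

theorem sub_trunc_apply {n : ℕ} (D : ℕ) (a : FreeSeries n) (w : List (Fin n)) :
    (a - trunc D a) w = if w.length ≤ D then 0 else a w := by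
  rw [sub_apply, trunc_apply]
  split_ifs <;> simp

theorem isSolidFamily_diskNorms (n : ℕ) {r : ℝ≥0∞} (hr : 0 < r) :
    IsSolidFamily (diskNorms n r) where
  solid i a b h := ENNReal.tsum_le_tsum fun w => by
    have : ‖a w‖ₑ ≤ ‖b w‖ₑ := enorm_le_iff_norm_le.2 (h w)
    gcongr
  coeff_le i w := by
    have hρ : 0 < i.1.1 := i.2.1
    have hτ : 0 < i.1.2 := zero_lt_one.trans_le i.2.2.2
    -- The inverse weight of w: the norm is at least its single term at w.
    refine ⟨(i.1.1 ^ w.length * i.1.2 ^ blocks w)⁻¹, fun a => ?_⟩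
    have hne : i.1.1 ^ w.length * i.1.2 ^ blocks w ≠ 0 := by positivity
    rw [ENNReal.coe_inv hne, mul_comm, ← div_eq_mul_inv, ENNReal.le_div_iff_mul_le
      (Or.inl (by exact_mod_cast hne)) (Or.inl ENNReal.coe_ne_top)]
    push_cast
    rw [← mul_assoc]
    exact ENNReal.le_tsum w
  -- Each term is continuous in one coefficient, and a sum of nonnegative continuous terms is lower
  -- semicontinuous.
  lsc i := lowerSemicontinuous_tsum fun w => Continuous.lowerSemicontinuous <|
    (ENNReal.continuous_mul_const (by finiteness)).comp
      ((ENNReal.continuous_mul_const (by finiteness)).comp (continuous_apply w).enorm)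
  tail i a ha := by
    refine (tendsto_tsum_ite_le_zero List.length ha).congr fun D => tsum_congr fun w => ?_
    rw [sub_trunc_apply]
    split_ifs <;> simp
  X_ne_top i j := (FreePolydisk.ζ (r := r) j).2 i
  cofinal := by
    obtain ⟨ρ, hρ, hmem, hcof⟩ := exists_seq_radius hr
    -- The choice τ = m + 1 satisfies τ ≥ 1 also for m = 0.
    refine ⟨fun m => ⟨(ρ m, m + 1), (hmem m).1, (hmem m).2, by simp⟩, fun l m h a =>
      diskNorm_mono _ _ (hρ h) (by simpa using h) a, fun i => ?_⟩
    obtain ⟨l, hl⟩ := hcof i.1.1 i.2.2.1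
    obtain ⟨m, hm⟩ := exists_nat_ge i.1.2
    refine ⟨max l m, fun a => diskNorm_mono _ _ (hl.trans (hρ (le_max_left l m))) (hm.trans ?_) a⟩
    have : (m : ℝ≥0) ≤ (max l m : ℕ) := by exact_mod_cast le_max_right l m
    exact this.trans (le_add_of_nonneg_right zero_le_one)

theorem norm_homPart_le {n : ℕ} (d : ℕ) {a b : FreeSeries n} (h : ∀ w, ‖a w‖ ≤ ‖b w‖) :
    ‖homPart d a‖ ≤ ‖homPart d b‖ := by
  rw [EuclideanSpace.norm_eq, EuclideanSpace.norm_eq]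
  refine Real.sqrt_le_sqrt (Finset.sum_le_sum fun v _ => ?_)
  exact pow_le_pow_left₀ (norm_nonneg _) (h (List.ofFn v)) 2

theorem norm_apply_le_norm_homPart {n : ℕ} (a : FreeSeries n) (w : List (Fin n)) :
    ‖a w‖ ≤ ‖homPart w.length a‖ := by
  have h : (homPart w.length a).ofLp w.get = a w := congrArg a (List.ofFn_get w)
  rw [← h]
  exact PiLp.norm_apply_le _ _

theorem homPart_sub_trunc {n : ℕ} (d D : ℕ) (a : FreeSeries n) :
    homPart d (a - trunc D a) = if d ≤ D then 0 else homPart d a := by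
  ext v
  change (a - trunc D a) (List.ofFn v) = _
  rw [sub_trunc_apply, List.length_ofFn]
  split_ifs <;> rfl

theorem isSolidFamily_ballNorms (n : ℕ) {r : ℝ≥0∞} (hr : 0 < r) :
    IsSolidFamily (ballNorms n r) where
  solid i a b h := ENNReal.tsum_le_tsum fun d => by
    have : ‖homPart d a‖ₑ ≤ ‖homPart d b‖ₑ := enorm_le_iff_norm_le.2 (norm_homPart_le d h)
    gcongr
  coeff_le i w := by
    have hne : i.1 ^ w.length ≠ 0 := pow_ne_zero _ i.2.1.ne'
    refine ⟨(i.1 ^ w.length)⁻¹, fun a => ?_⟩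
    rw [ENNReal.coe_inv hne, mul_comm, ← div_eq_mul_inv, ENNReal.le_div_iff_mul_le
      (Or.inl (by exact_mod_cast hne)) (Or.inl ENNReal.coe_ne_top)]
    have : ‖a w‖ₑ ≤ ‖homPart w.length a‖ₑ :=
      enorm_le_iff_norm_le.2 (norm_apply_le_norm_homPart a w)
    push_cast
    refine le_trans ?_ (ENNReal.le_tsum w.length)
    gcongr
  -- Here the term of degree d depends continuously on the finitely many coefficients of words of
  -- length d.
  lsc i := lowerSemicontinuous_tsum fun d => Continuous.lowerSemicontinuous <|
    (ENNReal.continuous_mul_const (by finiteness)).comp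
      ((PiLp.continuous_toLp 2 _).comp
        (continuous_pi fun v : Fin d → Fin n => continuous_apply (List.ofFn v))).enorm
  tail i a ha := by
    refine (tendsto_tsum_ite_le_zero id ha).congr fun D => tsum_congr fun d => ?_
    rw [homPart_sub_trunc, id]
    split_ifs <;> simp
  X_ne_top i j := (FreeBall.ζ (r := r) j).2 i
  cofinal := by
    obtain ⟨ρ, hρ, hmem, hcof⟩ := exists_seq_radius hr
    refine ⟨fun m => ⟨ρ m, hmem m⟩, fun l m h a => ballNorm_mono (hρ h) a, fun i => ?_⟩
    obtain ⟨l, hl⟩ := hcof i.1 i.2.2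
    exact ⟨l, fun a => ballNorm_mono hl a⟩

end

end QDef

theorem corollary8p19 (n : ℕ) (hn : 1 ≤ n) (r : ENNReal) (hr : 0 < r) :
    ((QDef.diskBundle n r).IsFrechetAlgebraBundle ∧ (QDef.diskBundle n r).IsContinuous) ∧
      ((QDef.ballBundle n r).IsFrechetAlgebraBundle ∧ (QDef.ballBundle n r).IsContinuous) :=
  ⟨(QDef.isSolidFamily_diskNorms n hr).isFrechetAlgebraBundle_and_isContinuous fun _ => rfl,
    (QDef.isSolidFamily_ballNorms n hr).isFrechetAlgebraBundle_and_isContinuous fun _ => rfl⟩
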